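/- Let $\mathcal B$ be a strict 2-category with a chosen iso-comma object for every cospan $f:X\to Z\leftarrow Y:g$: an object $P$ with 1-cells $\pi_1:P\to X$, $\pi_2:P\to Y$ and an invertible 2-cell $\kappa:f\pi_1\cong g\pi_2$ such that (i) for all $p:W\to X$, $q:W\to Y$ and invertible $k:fp\cong gq$ there is a unique $h:W\to P$ with $\pi_1h=p$, $\pi_2h=q$, $\kappa h=k$; and (ii) for all $j,k:W\to P$ and 2-cells $\alpha:\pi_1j\Rightarrow\pi_1k$, $\beta:\pi_2j\Rightarrow\pi_2k$ with $(\kappa k)(f\alpha)=(g\beta)(\kappa j)$ there is a unique $\gamma:j\Rightarrow k$ with $\pi_1\gamma=\alpha$, $\pi_2\gamma=\beta$. For objects $X,Y$ of $\mathcal B$ let $\mathrm{Span}(X,Y)$ consist of: spans $R=(X\xleftarrow{p_R}R\xrightarrow{q_R}Y)$; maps of spans $(\varpi,f,\varrho):R\to R'$, where $f:R\to R'$ is a 1-cell and $\varpi:p_R\Rightarrow p_{R'}f$, $\varrho:q_R\Rightarrow q_{R'}f$ are invertible 2-cells; and maps of maps of spans $\gamma:f\Rightarrow f'$ with $(p_{R'}\gamma)\varpi=\varpi'$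 and $(q_{R'}\gamma)\varrho=\varrho'$. Maps compose by $(\varpi',f',\varrho')(\varpi,f,\varrho)=((\varpi' f)\varpi,\,f'f,\,(\varrho' f)\varrho)$, with identities $(1,1,1)$. Let $I_X$ be the identity span $(1_X,1_X)$. The composite $R*S$ of $R:X\to Y$ and $S:Y\to Z$ is the iso-comma object of $q_R,p_S$ (with its $\kappa:q_R\pi_1\cong p_S\pi_2$), with legs $p_R\pi_1$ and $q_S\pi_2$. For maps $f:R\to R'$ and $g:S\to S'$, $f*g$ is the unique 1-cell with $\pi_1(f*g)=f\pi_1$, $\pi_2(f*g)=g\pi_2$ and $\kappa'(f*g)=(\varpi_g\pi_2)\,\kappa\,(\varrho_f^{-1}\pi_1)$, with 2-cells $\varpi_f\pi_1$ and $\varrho_g\pi_2$; $\gamma*\delta$ is the unique 2-cell with $\pi_1(\gamma*\delta)=\gamma\pi_1$ and $\pi_2(\gamma*\delta)=\delta\pi_2$. Then each $\mathrm{Span}(X,Y)$ is a strict 2-category, and $*$ and the functor $1\to\mathrm{Span}(X,X)$ picking out $I_X$ are strict 2-functors. Together with the objects of $\mathcal B$ they underlie a semi-strict cubical tricategory $\mathrm{Span}(\mathcal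 B)$. That is, there are adjoint equivalences $a,l,r$ in the 2-categories of 2-functors, strong transformations and modifications, and invertible modifications $\Pi,\Lambda,M,P$, which satisfy the three tricategory axioms (the nonabelian 4-cocycle condition and the two normalisation conditions), such that: 1. $a:(R*S)*T\to R*(S*T)$ is a strict adjoint equivalence: $a$ and its adjoint inverse $a^{-1}$ are strictly natural, and unit and counit are identities. The component $a_{R,S,T}$ and its inverse have identity 2-cells $\varpi,\varrho$ and commute with the three projections to $R,S,T$ and the two iso-comma 2-cells (that of $q_R,p_S$ and that of $q_S,p_T$). 2. $l_R:R*I_Y\to R$ is strictly natural, with 1-cell $\pi_1$ and 2-cells $(1,\kappa^{-1})$. Its adjoint inverse $l_R^{-1}:R\to R*I_Y$ has $\pi_1l_R^{-1}=1$, $\pi_2l_R^{-1}=q_R$, $\kappa l_R^{-1}=1$ and identity 2-cells. It is a strong transformation whose naturality 2-cell $l^{-1}_{R'}f\Rightarrow(f*1)l^{-1}_R$ at $f:R\to R'$ has projections $1$ (under $\pi_1$) and $\varrho_f^{-1}$ (under $\pi_2$). The counit $ll^{-1}\Rightarrow1$ is the identity, and the unit $1\Rightarrow l^{-1}l$ has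 projections $1$ and $\kappa^{-1}$. 3. $r_R:I_X*R\to R$ is strictly natural, with 1-cell $\pi_2$ and 2-cells $(\kappa,1)$. Its adjoint inverse $r_R^{-1}:R\to I_X*R$ has $\pi_1r_R^{-1}=p_R$, $\pi_2r_R^{-1}=1$, $\kappa r_R^{-1}=1$ and identity 2-cells. It is a strong transformation whose naturality 2-cell $r^{-1}_{R'}f\Rightarrow(1*f)r^{-1}_R$ at $f:R\to R'$ has projections $\varpi_f^{-1}$ (under $\pi_1$) and $1$ (under $\pi_2$). The counit $rr^{-1}\Rightarrow1$ is the identity, and the unit $1\Rightarrow r^{-1}r$ has projections $\kappa$ and $1$. 4. The pentagonator $\Pi:(1*a)\,a\,(a*1)\Rightarrow a\,a$ of strong transformations $((R*S)*T)*U\to R*(S*(T*U))$, and the three unit modifications $\Lambda:1*l\Rightarrow l\,a^{-1}$ on $R*(S*I)$, $M:(l*1)\,a^{-1}\,(1*r^{-1})\Rightarrow 1$ on $R*S$, and $P:r*1\Rightarrow r\,a$ on $(I*R)*S$, are all identities; in each case source and target are equal as strong transformations. -/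

import Mathlib

open CategoryTheory Bicategory
open scoped Pseudofunctor.StrongTrans

universe w₁ w₂ w₃ w₄ v₁ v₂ v₃ v₄ u₁ u₂ u₃ u₄ w v u u₀

namespace SpanTri

set_option linter.checkUnivs false
set_option linter.unusedSectionVars false

/-! ### Strict 2-functors, strong transformations, whiskering -/

section TwoFunctors

variable {A : Type u₁} [Bicategory.{w₁, v₁} A] {B : Type u₂} [Bicategory.{w₂, v₂} B]
  {C : Type u₃} [Bicategory.{w₃, v₃} C] {D : Type u₄} [Bicategory.{w₄, v₄} D]

/-- A strict 2-functor (between strict 2-categories). -/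
abbrev TwoFunctor (A : Type u₁) [Bicategory.{w₁, v₁} A] (B : Type u₂) [Bicategory.{w₂, v₂} B] :=
  StrictPseudofunctorPreCore A B

namespace TwoFunctor

/-- The identity 2-functor. -/
abbrev id (A : Type u₁) [Bicategory.{w₁, v₁} A] : TwoFunctor A A where
  obj X := X
  map f := f
  map₂ η := η

/-- Composition of 2-functors (in diagrammatic order). -/
abbrev comp (F : TwoFunctor A B) (G : TwoFunctor B C) : TwoFunctor A C where
  obj X := G.obj (F.obj X)
  map f := G.map (F.map f)
  map₂ η := G.map₂ (F.map₂ η)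
  map_id X := by rw [F.map_id, G.map_id]
  map_comp f g := by rw [F.map_comp, G.map_comp]
  map₂_whisker_left f g g' η := by
    simp [F.map₂_whisker_left, G.map₂_whisker_left, PrelaxFunctor.map₂_eqToHom]
  map₂_whisker_right η g := by
    simp [F.map₂_whisker_right, G.map₂_whisker_right, PrelaxFunctor.map₂_eqToHom]

/-- The first projection of a product. -/
abbrev fst (A : Type u₁) [Bicategory.{w₁, v₁} A] (B : Type u₂) [Bicategory.{w₂, v₂} B] :
    TwoFunctor (A × B) A where
  obj X := X.1
  map f := f.1
  map₂ η := η.1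

/-- The second projection of a product. -/
abbrev snd (A : Type u₁) [Bicategory.{w₁, v₁} A] (B : Type u₂) [Bicategory.{w₂, v₂} B] :
    TwoFunctor (A × B) B where
  obj X := X.2
  map f := f.2
  map₂ η := η.2

/-- The 2-functor to a product induced by two 2-functors. -/
abbrev pair (F : TwoFunctor A B) (G : TwoFunctor A C) : TwoFunctor A (B × C) where
  obj X := (F.obj X, G.obj X)
  map f := (F.map f, G.map f)
  map₂ η := (F.map₂ η, G.map₂ η)
  map₂_id f := by simp
  map₂_comp f g := by simp
  map_id X := by simp [F.map_id, G.map_id]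
  map_comp f g := by simp [F.map_comp, G.map_comp]
  map₂_whisker_left f g g' η := by
    apply Prod.ext <;> simp [F.map₂_whisker_left, G.map₂_whisker_left]
  map₂_whisker_right η g := by
    apply Prod.ext <;> simp [F.map₂_whisker_right, G.map₂_whisker_right]

/-- The terminal 2-category. -/
abbrev One := LocallyDiscrete (Discrete PUnit.{1})

/-- The unique 2-functor to the terminal 2-category. -/
abbrev toOne (A : Type u₁) [Bicategory.{w₁, v₁} A] : TwoFunctor A One where
  obj _ := ⟨⟨⟨⟩⟩⟩
  map _ := 𝟙 _
  map₂ _ := 𝟙 _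
  map₂_whisker_left _ _ _ _ := Subsingleton.elim _ _
  map₂_whisker_right _ _ := Subsingleton.elim _ _

variable [Strict A] [Strict B] [Strict C] [Strict D]

/-- A strict 2-functor, regarded as a pseudofunctor. -/
abbrev toPs (F : TwoFunctor A B) : Pseudofunctor A B :=
  Pseudofunctor.mk F.toPrelaxFunctor (fun X => eqToIso (F.map_id X))
    (fun f g => eqToIso (F.map_comp f g))
    (fun f _ _ η => by simpa using F.map₂_whisker_left f η)
    (fun η f => by simpa using F.map₂_whisker_right η f)
    (fun f g h => by simp [Strict.associator_eqToIso, PrelaxFunctor.map₂_eqToHom])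
    (fun f => by simp [Strict.leftUnitor_eqToIso, PrelaxFunctor.map₂_eqToHom])
    (fun f => by simp [Strict.rightUnitor_eqToIso, PrelaxFunctor.map₂_eqToHom])

theorem naturality_congr {F G : TwoFunctor A B} (η : F.toPs ⟶ G.toPs) {X Y : A} {f g : X ⟶ Y}
    (h : f = g) : (η.naturality f).hom =
      eqToHom (by rw [h]) ≫ (η.naturality g).hom ≫ eqToHom (by rw [h]) := by
  subst h; simp

theorem naturality_id_eq {F G : TwoFunctor A B} (η : F.toPs ⟶ G.toPs) (X : A) :
    (η.naturality (𝟙 X)).hom =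
      eqToHom (by simp [F.map_id, G.map_id]) := by
  rw [Pseudofunctor.StrongTrans.naturality_id_hom]
  simp [Strict.leftUnitor_eqToIso, Strict.rightUnitor_eqToIso]

theorem naturality_comp_eq {F G : TwoFunctor A B} (η : F.toPs ⟶ G.toPs) {X Y Z : A}
    (f : X ⟶ Y) (g : Y ⟶ Z) :
    (η.naturality (f ≫ g)).hom =
      eqToHom (by simp [F.map_comp]) ≫ F.map f ◁ (η.naturality g).hom ≫
        eqToHom (by simp) ≫ (η.naturality f).hom ▷ G.map g ≫
          eqToHom (by simp [G.map_comp]) := by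
  rw [Pseudofunctor.StrongTrans.naturality_comp_hom]
  simp [Strict.associator_eqToIso]

/-- Precomposition of a strong transformation with a 2-functor. -/
def whiskerL (F : TwoFunctor A B) {G H : TwoFunctor B C} (η : G.toPs ⟶ H.toPs) :
    (F.comp G).toPs ⟶ (F.comp H).toPs where
  app X := η.app (F.obj X)
  naturality f := η.naturality (F.map f)
  naturality_naturality θ := η.naturality_naturality (F.map₂ θ)
  naturality_id X := by
    rw [naturality_congr η (F.map_id X), naturality_id_eq]
    simp [Strict.leftUnitor_eqToIso, Strict.rightUnitor_eqToIso]
  naturality_comp f g := by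
    rw [naturality_congr η (F.map_comp f g), naturality_comp_eq]
    simp [Strict.associator_eqToIso, comp]

/-- Postcomposition of a strong transformation with a 2-functor. -/
def whiskerR {F G : TwoFunctor A B} (η : F.toPs ⟶ G.toPs) (K : TwoFunctor B C) :
    (F.comp K).toPs ⟶ (G.comp K).toPs where
  app X := K.map (η.app X)
  naturality f := eqToIso (K.map_comp _ _).symm ≪≫ K.map₂Iso (η.naturality f) ≪≫
    eqToIso (K.map_comp _ _)
  naturality_naturality θ := by
    have h := congrArg K.map₂ (η.naturality_naturality θ)
    rw [PrelaxFunctor.map₂_comp, PrelaxFunctor.map₂_comp, K.map₂_whisker_left,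
      K.map₂_whisker_right] at h
    have h' := congrArg (fun x => eqToHom (K.map_comp _ _).symm ≫ x ≫ eqToHom (K.map_comp _ _)) h
    simpa using h'
  naturality_id X := by
    simp [naturality_id_eq, PrelaxFunctor.map₂_eqToHom,
      Strict.leftUnitor_eqToIso, Strict.rightUnitor_eqToIso]
  naturality_comp f g := by
    simp [naturality_comp_eq, PrelaxFunctor.map₂_eqToHom, K.map₂_whisker_left,
      K.map₂_whisker_right, Strict.associator_eqToIso, comp]

/-- The pairing of two strong transformations. -/
def pairT {F F' : TwoFunctor A B} {G G' : TwoFunctor A C} (η : F.toPs ⟶ F'.toPs)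
    (θ : G.toPs ⟶ G'.toPs) : (pair F G).toPs ⟶ (pair F' G').toPs where
  app X := (η.app X, θ.app X)
  naturality f := Iso.prod (η.naturality f) (θ.naturality f)
  naturality_naturality σ :=
    Prod.ext (η.naturality_naturality σ) (θ.naturality_naturality σ)
  naturality_id X := by
    apply Prod.ext <;>
    simp [naturality_id_eq,
      Strict.leftUnitor_eqToIso, Strict.rightUnitor_eqToIso]
  naturality_comp f g := by
    apply Prod.ext <;>
    simp [naturality_comp_eq, Strict.associator_eqToIso, pair]

end TwoFunctor
end TwoFunctors

/-! ### Tricategories -/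

/-- The part of a tricategory consisting of objects, hom-2-categories, composition and units, in the
case where the hom-2-categories are strict 2-categories and the composition and unit are strict
2-functors. Composition is written in diagrammatic order. -/
structure TriBase (Obj : Type u₀) where
  /-- the hom-2-categories -/
  Hom : Obj → Obj → Type u
  [bicategory : ∀ A B, Bicategory.{w, v} (Hom A B)]
  [strict : ∀ A B, Strict (Hom A B)]
  /-- composition -/
  comp : ∀ A B C, TwoFunctor (Hom A B × Hom B C) (Hom A C)
  /-- units -/
  unit : ∀ A, TwoFunctor TwoFunctor.One (Hom A A)

attribute [instance] TriBase.bicategory TriBase.strict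

namespace TriBase

open TwoFunctor

variable {Obj : Type u₀} {H : TriBase.{w, v, u} Obj} {A B C D E : Obj}

section
variable {X : Type u₁} [Bicategory.{w₁, v₁} X] [Strict X]

/-- The composite of two families of 1-morphisms parametrised by `X`: the 2-functor
`x ↦ F x * G x`. -/
abbrev tensor (F : TwoFunctor X (H.Hom A B)) (G : TwoFunctor X (H.Hom B C)) :
    TwoFunctor X (H.Hom A C) :=
  (pair F G).comp (H.comp A B C)

/-- The 2-functor constant at the unit `I_A`. -/
abbrev unitF (H : TriBase.{w, v, u} Obj) (X : Type u₁) [Bicategory.{w₁, v₁} X] (A : Obj) :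
    TwoFunctor X (H.Hom A A) :=
  (toOne X).comp (H.unit A)

/-- The composite `η * θ` of two strong transformations. -/
abbrev tensorT {F F' : TwoFunctor X (H.Hom A B)} {G G' : TwoFunctor X (H.Hom B C)}
    (η : F.toPs ⟶ F'.toPs) (θ : G.toPs ⟶ G'.toPs) :
    (tensor F G).toPs ⟶ (tensor F' G').toPs :=
  whiskerR (pairT η θ) (H.comp A B C)

end

variable (H) in
/-- `(R, S) ↦ R` -/
abbrev p₁ (A B C : Obj) : TwoFunctor (H.Hom A B × H.Hom B C) (H.Hom A B) := fst _ _
variable (H) in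
/-- `(R, S) ↦ S` -/
abbrev p₂ (A B C : Obj) : TwoFunctor (H.Hom A B × H.Hom B C) (H.Hom B C) := snd _ _
variable (H) in
/-- `((R, S), T) ↦ R` -/
abbrev q₁ (A B C D : Obj) :
    TwoFunctor ((H.Hom A B × H.Hom B C) × H.Hom C D) (H.Hom A B) := (fst _ _).comp (fst _ _)
variable (H) in
/-- `((R, S), T) ↦ S` -/
abbrev q₂ (A B C D : Obj) :
    TwoFunctor ((H.Hom A B × H.Hom B C) × H.Hom C D) (H.Hom B C) := (fst _ _).comp (snd _ _)
variable (H) in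
/-- `((R, S), T) ↦ T` -/
abbrev q₃ (A B C D : Obj) :
    TwoFunctor ((H.Hom A B × H.Hom B C) × H.Hom C D) (H.Hom C D) := snd _ _
variable (H) in
/-- `(((R, S), T), U) ↦ R` -/
abbrev s₁ (A B C D E : Obj) :
    TwoFunctor (((H.Hom A B × H.Hom B C) × H.Hom C D) × H.Hom D E) (H.Hom A B) :=
  (fst _ _).comp (H.q₁ A B C D)
variable (H) in
/-- `(((R, S), T), U) ↦ S` -/
abbrev s₂ (A B C D E : Obj) :
    TwoFunctor (((H.Hom A B × H.Hom B C) × H.Hom C D) × H.Hom D E) (H.Hom B C) :=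
  (fst _ _).comp (H.q₂ A B C D)
variable (H) in
/-- `(((R, S), T), U) ↦ T` -/
abbrev s₃ (A B C D E : Obj) :
    TwoFunctor (((H.Hom A B × H.Hom B C) × H.Hom C D) × H.Hom D E) (H.Hom C D) :=
  (fst _ _).comp (H.q₃ A B C D)
variable (H) in
/-- `(((R, S), T), U) ↦ U` -/
abbrev s₄ (A B C D E : Obj) :
    TwoFunctor (((H.Hom A B × H.Hom B C) × H.Hom C D) × H.Hom D E) (H.Hom D E) := snd _ _

/-- Composition of 1-morphisms, `R * S`. -/
def tObj (R : H.Hom A B) (S : H.Hom B C) : H.Hom A C := (H.comp A B C).obj (R, S)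

/-- Composition of 2-morphisms along an object. -/
def tMap {R R' : H.Hom A B} {S S' : H.Hom B C} (α : R ⟶ R') (β : S ⟶ S') :
    tObj R S ⟶ tObj R' S' :=
  (H.comp A B C).map (X := (R, S)) (Y := (R', S')) (α, β)

/-- Composition of 3-morphisms along an object. -/
def tMap₂ {R R' : H.Hom A B} {S S' : H.Hom B C} {α α' : R ⟶ R'} {β β' : S ⟶ S'}
    (x : α ⟶ α') (y : β ⟶ β') : tMap α β ⟶ tMap α' β' :=
  (H.comp A B C).map₂ (a := (R, S)) (b := (R', S')) (f := (α, β)) (g := (α', β')) (x, y)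

/-- The unit 1-morphism. -/
def one (H : TriBase.{w, v, u} Obj) (A : Obj) : H.Hom A A := (H.unit A).obj ⟨⟨⟨⟩⟩⟩

variable {R R' R'' : H.Hom A B} {S S' S'' : H.Hom B C}

theorem tMap_id (R : H.Hom A B) (S : H.Hom B C) : tMap (𝟙 R) (𝟙 S) = 𝟙 (tObj R S) :=
  (H.comp A B C).map_id (R, S)

theorem tMap_comp_id (α : R ⟶ R') (α' : R' ⟶ R'') (S : H.Hom B C) :
    tMap (α ≫ α') (𝟙 S) = tMap α (𝟙 S) ≫ tMap α' (𝟙 S) := by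
  have h := (H.comp A B C).map_comp (a := (R, S)) (b := (R', S)) (c := (R'', S))
    (α, 𝟙 S) (α', 𝟙 S)
  refine Eq.trans ?_ h
  simp only [tMap]
  congr 1
  exact Prod.ext rfl (Strict.comp_id _).symm

theorem tMap_id_comp (R : H.Hom A B) (β : S ⟶ S') (β' : S' ⟶ S'') :
    tMap (𝟙 R) (β ≫ β') = tMap (𝟙 R) β ≫ tMap (𝟙 R) β' := by
  have h := (H.comp A B C).map_comp (a := (R, S)) (b := (R, S')) (c := (R, S''))
    (𝟙 R, β) (𝟙 R, β')
  refine Eq.trans ?_ h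
  simp only [tMap]
  congr 1
  exact Prod.ext (Strict.comp_id _).symm rfl

/-- Composition of 2-cells in a strict 2-category, where the target of the first and the source of
the second are equal. -/
def comp₂ {X : Type u₁} [Bicategory.{w₁, v₁} X] [Strict X] {x y : X} {f g g' h : x ⟶ y}
    (α : f ⟶ g) (β : g' ⟶ h)
    (e : g = g' := by simp [tMap_id, tMap_comp_id, tMap_id_comp]) : f ⟶ h :=
  α ≫ eqToHom e ≫ β

infixr:60 " ⨟ " => comp₂

/-- A 2-cell in a strict 2-category, with source and target replaced by equal 1-cells. -/
def cast₂ {X : Type u₁} [Bicategory.{w₁, v₁} X] [Strict X] {x y : X} {f f' g g' : x ⟶ y}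
    (α : f ⟶ g) (e : f' = f := by simp [tMap_id, tMap_comp_id, tMap_id_comp])
    (e' : g = g' := by simp [tMap_id, tMap_comp_id, tMap_id_comp]) : f' ⟶ g' :=
  eqToHom e ≫ α ≫ eqToHom e'

end TriBase

open TriBase TwoFunctor

/-- The associativity and unit adjoint equivalences of a tricategory: adjoint equivalences in the
2-category of strict 2-functors, strong transformations and modifications. -/
structure TriAdj {Obj : Type u₀} (H : TriBase.{w, v, u} Obj) where
  /-- the associator, with components `(R * S) * T ⟶ R * (S * T)` -/
  assoc : ∀ A B C D, Bicategory.Equivalence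
    (tensor (tensor (H.q₁ A B C D) (H.q₂ A B C D)) (H.q₃ A B C D)).toPs
    (tensor (H.q₁ A B C D) (tensor (H.q₂ A B C D) (H.q₃ A B C D))).toPs
  /-- the left unitor, with components `R * I_B ⟶ R` -/
  left : ∀ A B, Bicategory.Equivalence
    (tensor (TwoFunctor.id (H.Hom A B)) (H.unitF (H.Hom A B) B)).toPs
    (TwoFunctor.id (H.Hom A B)).toPs
  /-- the right unitor, with components `I_A * R ⟶ R` -/
  right : ∀ A B, Bicategory.Equivalence
    (tensor (H.unitF (H.Hom A B) A) (TwoFunctor.id (H.Hom A B))).toPs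
    (TwoFunctor.id (H.Hom A B)).toPs

namespace TriAdj

variable {Obj : Type u₀} {H : TriBase.{w, v, u} Obj} (T : TriAdj H) {A B C D E : Obj}

section
variable {X : Type u₁} [Bicategory.{w₁, v₁} X] [Strict X]
  (F : TwoFunctor X (H.Hom A B)) (G : TwoFunctor X (H.Hom B C)) (K : TwoFunctor X (H.Hom C D))

/-- The associator `(F * G) * K ⟶ F * (G * K)`. -/
def aT : (tensor (tensor F G) K).toPs ⟶ (tensor F (tensor G K)).toPs :=
  whiskerL (pair (pair F G) K) (T.assoc A B C D).hom

/-- The inverse associator `F * (G * K) ⟶ (F * G) * K`. -/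
def aT' : (tensor F (tensor G K)).toPs ⟶ (tensor (tensor F G) K).toPs :=
  whiskerL (pair (pair F G) K) (T.assoc A B C D).inv

/-- The left unitor `F * I ⟶ F`. -/
def lT : (tensor F (H.unitF X B)).toPs ⟶ F.toPs :=
  whiskerL F (T.left A B).hom

/-- The inverse left unitor `F ⟶ F * I`. -/
def lT' : F.toPs ⟶ (tensor F (H.unitF X B)).toPs :=
  whiskerL F (T.left A B).inv

/-- The right unitor `I * F ⟶ F`. -/
def rT : (tensor (H.unitF X A) F).toPs ⟶ F.toPs :=
  whiskerL F (T.right A B).hom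

/-- The inverse right unitor `F ⟶ I * F`. -/
def rT' : F.toPs ⟶ (tensor (H.unitF X A) F).toPs :=
  whiskerL F (T.right A B).inv

end

/-- The source of the pentagonator,
`((R * S) * T) * U ⟶ (R * (S * T)) * U ⟶ R * ((S * T) * U) ⟶ R * (S * (T * U))`. -/
def pentSource (A B C D E : Obj) :=
  tensorT (T.aT (H.s₁ A B C D E) (H.s₂ A B C D E) (H.s₃ A B C D E)) (𝟙 (H.s₄ A B C D E).toPs) ≫
    T.aT (H.s₁ A B C D E) (tensor (H.s₂ A B C D E) (H.s₃ A B C D E)) (H.s₄ A B C D E) ≫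
      tensorT (𝟙 (H.s₁ A B C D E).toPs)
        (T.aT (H.s₂ A B C D E) (H.s₃ A B C D E) (H.s₄ A B C D E))

/-- The target of the pentagonator,
`((R * S) * T) * U ⟶ (R * S) * (T * U) ⟶ R * (S * (T * U))`. -/
def pentTarget (A B C D E : Obj) :=
  T.aT (tensor (H.s₁ A B C D E) (H.s₂ A B C D E)) (H.s₃ A B C D E) (H.s₄ A B C D E) ≫
    T.aT (H.s₁ A B C D E) (H.s₂ A B C D E) (tensor (H.s₃ A B C D E) (H.s₄ A B C D E))

/-- `R * (S * I) ⟶ R * S` -/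
def leftSource (A B C : Obj) :=
  tensorT (𝟙 (H.p₁ A B C).toPs) (T.lT (H.p₂ A B C))

/-- `R * (S * I) ⟶ (R * S) * I ⟶ R * S` -/
def leftTarget (A B C : Obj) :=
  T.aT' (H.p₁ A B C) (H.p₂ A B C) (H.unitF _ C) ≫ T.lT (tensor (H.p₁ A B C) (H.p₂ A B C))

/-- `R * S ⟶ R * (I * S) ⟶ (R * I) * S ⟶ R * S` -/
def middleSource (A B C : Obj) :=
  tensorT (𝟙 (H.p₁ A B C).toPs) (T.rT' (H.p₂ A B C)) ≫
    T.aT' (H.p₁ A B C) (H.unitF _ B) (H.p₂ A B C) ≫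
      tensorT (T.lT (H.p₁ A B C)) (𝟙 (H.p₂ A B C).toPs)

/-- the identity of `R * S` -/
def middleTarget (_ : TriAdj H) (A B C : Obj) :=
  𝟙 (tensor (H.p₁ A B C) (H.p₂ A B C)).toPs

/-- `(I * R) * S ⟶ R * S` -/
def rightSource (A B C : Obj) :=
  tensorT (T.rT (H.p₁ A B C)) (𝟙 (H.p₂ A B C).toPs)

/-- `(I * R) * S ⟶ I * (R * S) ⟶ R * S` -/
def rightTarget (A B C : Obj) :=
  T.aT (H.unitF _ A) (H.p₁ A B C) (H.p₂ A B C) ≫ T.rT (tensor (H.p₁ A B C) (H.p₂ A B C))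

/-! #### Components -/

section components

/-- `a_{R,S,T} : (R * S) * T ⟶ R * (S * T)` -/
def a (R : H.Hom A B) (S : H.Hom B C) (U : H.Hom C D) :
    tObj (tObj R S) U ⟶ tObj R (tObj S U) :=
  (T.assoc A B C D).hom.app ((R, S), U)

/-- `a'_{R,S,T} : R * (S * T) ⟶ (R * S) * T` -/
def a' (R : H.Hom A B) (S : H.Hom B C) (U : H.Hom C D) :
    tObj R (tObj S U) ⟶ tObj (tObj R S) U :=
  (T.assoc A B C D).inv.app ((R, S), U)

/-- `l_R : R * I ⟶ R` -/
def l (R : H.Hom A B) : tObj R (H.one B) ⟶ R := (T.left A B).hom.app R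

/-- `l'_R : R ⟶ R * I` -/
def l' (R : H.Hom A B) : R ⟶ tObj R (H.one B) := (T.left A B).inv.app R

/-- `r_R : I * R ⟶ R` -/
def r (R : H.Hom A B) : tObj (H.one A) R ⟶ R := (T.right A B).hom.app R

/-- `r'_R : R ⟶ I * R` -/
def r' (R : H.Hom A B) : R ⟶ tObj (H.one A) R := (T.right A B).inv.app R

/-- The naturality 2-cell of the associator. -/
def aNat {R R' : H.Hom A B} {S S' : H.Hom B C} {U U' : H.Hom C D}
    (α : R ⟶ R') (β : S ⟶ S') (γ : U ⟶ U') :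
    tMap (tMap α β) γ ≫ T.a R' S' U' ≅ T.a R S U ≫ tMap α (tMap β γ) :=
  (T.assoc A B C D).hom.naturality (a := ((R, S), U)) (b := ((R', S'), U')) ((α, β), γ)

/-- The naturality 2-cell of the inverse left unitor. -/
def lNat' {R R' : H.Hom A B} (α : R ⟶ R') :
    α ≫ T.l' R' ⟶ T.l' R ≫ tMap α (𝟙 (H.one B)) :=
  ((T.left A B).inv.naturality α).hom ≫
    eqToHom (congrArg (fun x => T.l' R ≫ tMap α x) ((H.unit B).map_id _))

/-- The naturality 2-cell of the inverse right unitor. -/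
def rNat' {R R' : H.Hom A B} (α : R ⟶ R') :
    α ≫ T.r' R' ⟶ T.r' R ≫ tMap (𝟙 (H.one A)) α :=
  ((T.right A B).inv.naturality α).hom ≫
    eqToHom (congrArg (fun x => T.r' R ≫ tMap x α) ((H.unit A).map_id _))

/-- The inverse of the unit of the adjoint equivalence `a`. -/
def aUnitInv (R : H.Hom A B) (S : H.Hom B C) (U : H.Hom C D) :
    T.a R S U ≫ T.a' R S U ⟶ 𝟙 (tObj (tObj R S) U) :=
  (T.assoc A B C D).unit.inv.as.app ((R, S), U)

/-- The unit of the adjoint equivalence `l`. -/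
def lUnit (R : H.Hom A B) : 𝟙 (tObj R (H.one B)) ⟶ T.l R ≫ T.l' R :=
  (T.left A B).unit.hom.as.app R

/-- The unit of the adjoint equivalence `r`. -/
def rUnit (R : H.Hom A B) : 𝟙 (tObj (H.one A) R) ⟶ T.r R ≫ T.r' R :=
  (T.right A B).unit.hom.as.app R

/-- The inverse of the unit of the adjoint equivalence `r`. -/
def rUnitInv (R : H.Hom A B) : T.r R ≫ T.r' R ⟶ 𝟙 (tObj (H.one A) R) :=
  (T.right A B).unit.inv.as.app R

end components

end TriAdj

/-- The data of a tricategory: composition and units, the associativity and unit adjoint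
equivalences, the invertible pentagonator modification and the three invertible unit
modifications. -/
structure TriData {Obj : Type u₀} (H : TriBase.{w, v, u} Obj) extends TriAdj H where
  /-- the pentagonator `Π` -/
  pent : ∀ A B C D E, toTriAdj.pentSource A B C D E ≅ toTriAdj.pentTarget A B C D E
  /-- the left unit modification `Λ` -/
  leftMod : ∀ A B C, toTriAdj.leftSource A B C ≅ toTriAdj.leftTarget A B C
  /-- the middle unit modification `M` -/
  middleMod : ∀ A B C, toTriAdj.middleSource A B C ≅ toTriAdj.middleTarget A B C
  /-- the right unit modification `P` -/
  rightMod : ∀ A B C, toTriAdj.rightSource A B C ≅ toTriAdj.rightTarget A B C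

namespace TriData

open TriAdj

variable {Obj : Type u₀} {H : TriBase.{w, v, u} Obj} (T : TriData H) {A B C D E F : Obj}

/-- The component of the pentagonator. -/
def pi (R : H.Hom A B) (S : H.Hom B C) (U : H.Hom C D) (V : H.Hom D E) :
    tMap (T.a R S U) (𝟙 V) ≫ T.a R (tObj S U) V ≫ tMap (𝟙 R) (T.a S U V) ⟶
      T.a (tObj R S) U V ≫ T.a R S (tObj U V) :=
  (T.pent A B C D E).hom.as.app (((R, S), U), V)

/-- The component of the left unit modification. -/
def lam (R : H.Hom A B) (S : H.Hom B C) :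
    tMap (𝟙 R) (T.l S) ⟶ T.a' R S (H.one C) ≫ T.l (tObj R S) :=
  (T.leftMod A B C).hom.as.app (R, S)

/-- The component of the middle unit modification. -/
def mid (R : H.Hom A B) (S : H.Hom B C) :
    tMap (𝟙 R) (T.r' S) ≫ T.a' R (H.one B) S ≫ tMap (T.l R) (𝟙 S) ⟶ 𝟙 (tObj R S) :=
  (T.middleMod A B C).hom.as.app (R, S)

/-- The component of the inverse of the middle unit modification. -/
def midInv (R : H.Hom A B) (S : H.Hom B C) :
    𝟙 (tObj R S) ⟶ tMap (𝟙 R) (T.r' S) ≫ T.a' R (H.one B) S ≫ tMap (T.l R) (𝟙 S) :=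
  (T.middleMod A B C).inv.as.app (R, S)

/-- The component of the right unit modification. -/
def rho (R : H.Hom A B) (S : H.Hom B C) :
    tMap (T.r R) (𝟙 S) ⟶ T.a (H.one A) R S ≫ T.r (tObj R S) :=
  (T.rightMod A B C).hom.as.app (R, S)

/-- The mate of the left unit modification. -/
def lamMate (R : H.Hom A B) (S : H.Hom B C) :
    T.a R S (H.one C) ≫ tMap (𝟙 R) (T.l S) ⟶ T.l (tObj R S) :=
  cast₂ (T.a R S (H.one C) ◁ T.lam R S ⨟ T.aUnitInv R S (H.one C) ▷ T.l (tObj R S))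

/-- The mate of the (inverse) middle unit modification. -/
def midMate (R : H.Hom A B) (S : H.Hom B C) :
    T.a R (H.one B) S ≫ tMap (𝟙 R) (T.r S) ⟶ tMap (T.l R) (𝟙 S) :=
  cast₂ ((T.a R (H.one B) S ≫ tMap (𝟙 R) (T.r S)) ◁ T.midInv R S ⨟
    T.a R (H.one B) S ◁ tMap₂ (𝟙 (𝟙 R)) (T.rUnitInv S) ▷
        (T.a' R (H.one B) S ≫ tMap (T.l R) (𝟙 S)) ⨟
      T.aUnitInv R (H.one B) S ▷ tMap (T.l R) (𝟙 S))

/-- The first pasting composite of the cocycle condition. -/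
def cocycleLeft (R : H.Hom A B) (S : H.Hom B C) (U : H.Hom C D) (V : H.Hom D E) (W : H.Hom E F) :
    tMap (tMap (T.a R S U) (𝟙 V)) (𝟙 W) ≫ tMap (T.a R (tObj S U) V) (𝟙 W) ≫
      tMap (tMap (𝟙 R) (T.a S U V)) (𝟙 W) ≫ T.a R (tObj S (tObj U V)) W ≫
        tMap (𝟙 R) (T.a S (tObj U V) W) ≫ tMap (𝟙 R) (tMap (𝟙 S) (T.a U V W)) ⟶
    T.a (tObj (tObj R S) U) V W ≫ T.a (tObj R S) U (tObj V W) ≫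
      T.a R S (tObj U (tObj V W)) :=
  cast₂
    (tMap₂ (T.pi R S U V) (𝟙 (𝟙 W)) ▷ (T.a R (tObj S (tObj U V)) W ≫
        tMap (𝟙 R) (T.a S (tObj U V) W) ≫ tMap (𝟙 R) (tMap (𝟙 S) (T.a U V W))) ⨟
      tMap (T.a (tObj R S) U V) (𝟙 W) ◁ T.pi R S (tObj U V) W ▷
        tMap (𝟙 R) (tMap (𝟙 S) (T.a U V W)) ⨟
      (tMap (T.a (tObj R S) U V) (𝟙 W) ≫ T.a (tObj R S) (tObj U V) W) ◁
        (T.aNat (𝟙 R) (𝟙 S) (T.a U V W)).inv ⨟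
      T.pi (tObj R S) U V W ▷ T.a R S (tObj U (tObj V W)))

/-- The second pasting composite of the cocycle condition. -/
def cocycleRight (R : H.Hom A B) (S : H.Hom B C) (U : H.Hom C D) (V : H.Hom D E) (W : H.Hom E F) :
    tMap (tMap (T.a R S U) (𝟙 V)) (𝟙 W) ≫ tMap (T.a R (tObj S U) V) (𝟙 W) ≫
      tMap (tMap (𝟙 R) (T.a S U V)) (𝟙 W) ≫ T.a R (tObj S (tObj U V)) W ≫
        tMap (𝟙 R) (T.a S (tObj U V) W) ≫ tMap (𝟙 R) (tMap (𝟙 S) (T.a U V W)) ⟶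
    T.a (tObj (tObj R S) U) V W ≫ T.a (tObj R S) U (tObj V W) ≫
      T.a R S (tObj U (tObj V W)) :=
  cast₂
    ((tMap (tMap (T.a R S U) (𝟙 V)) (𝟙 W) ≫ tMap (T.a R (tObj S U) V) (𝟙 W)) ◁
        (T.aNat (𝟙 R) (T.a S U V) (𝟙 W)).hom ▷
          (tMap (𝟙 R) (T.a S (tObj U V) W) ≫ tMap (𝟙 R) (tMap (𝟙 S) (T.a U V W))) ⨟
      (tMap (tMap (T.a R S U) (𝟙 V)) (𝟙 W) ≫ tMap (T.a R (tObj S U) V) (𝟙 W) ≫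
        T.a R (tObj (tObj S U) V) W) ◁ tMap₂ (𝟙 (𝟙 R)) (T.pi S U V W) ⨟
      tMap (tMap (T.a R S U) (𝟙 V)) (𝟙 W) ◁ T.pi R (tObj S U) V W ▷
        tMap (𝟙 R) (T.a S U (tObj V W)) ⨟
      (T.aNat (T.a R S U) (𝟙 V) (𝟙 W)).hom ▷
        (T.a R (tObj S U) (tObj V W) ≫ tMap (𝟙 R) (T.a S U (tObj V W))) ⨟
      T.a (tObj (tObj R S) U) V W ◁ T.pi R S U (tObj V W))

/-- The first pasting composite of the left normalisation condition. -/
def normLeft₁ (R : H.Hom A B) (S : H.Hom B C) (U : H.Hom C D) :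
    tMap (T.a R (H.one B) S) (𝟙 U) ≫ T.a R (tObj (H.one B) S) U ≫
      tMap (𝟙 R) (tMap (T.r S) (𝟙 U)) ⟶ tMap (tMap (T.l R) (𝟙 S)) (𝟙 U) ≫ T.a R S U :=
  cast₂
    (tMap (T.a R (H.one B) S) (𝟙 U) ◁ (T.aNat (𝟙 R) (T.r S) (𝟙 U)).inv ⨟
      tMap₂ (T.midMate R S) (𝟙 (𝟙 U)) ▷ T.a R S U)

/-- The second pasting composite of the left normalisation condition. -/
def normRight₁ (R : H.Hom A B) (S : H.Hom B C) (U : H.Hom C D) :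
    tMap (T.a R (H.one B) S) (𝟙 U) ≫ T.a R (tObj (H.one B) S) U ≫
      tMap (𝟙 R) (tMap (T.r S) (𝟙 U)) ⟶ tMap (tMap (T.l R) (𝟙 S)) (𝟙 U) ≫ T.a R S U :=
  cast₂
    ((tMap (T.a R (H.one B) S) (𝟙 U) ≫ T.a R (tObj (H.one B) S) U) ◁
        tMap₂ (𝟙 (𝟙 R)) (T.rho S U) ⨟
      T.pi R (H.one B) S U ▷ tMap (𝟙 R) (T.r (tObj S U)) ⨟
      T.a (tObj R (H.one B)) S U ◁ T.midMate R (tObj S U) ⨟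
      (T.aNat (T.l R) (𝟙 S) (𝟙 U)).inv)

/-- The first pasting composite of the right normalisation condition. -/
def normLeft₂ (R : H.Hom A B) (S : H.Hom B C) (U : H.Hom C D) :
    tMap (T.a R S (H.one C)) (𝟙 U) ≫ T.a R (tObj S (H.one C)) U ≫
      tMap (𝟙 R) (T.a S (H.one C) U) ≫ tMap (𝟙 R) (tMap (𝟙 S) (T.r U)) ⟶
        tMap (T.l (tObj R S)) (𝟙 U) ≫ T.a R S U :=
  cast₂
    ((tMap (T.a R S (H.one C)) (𝟙 U) ≫ T.a R (tObj S (H.one C)) U) ◁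
        tMap₂ (𝟙 (𝟙 R)) (T.midMate S U) ⨟
      tMap (T.a R S (H.one C)) (𝟙 U) ◁ (T.aNat (𝟙 R) (T.l S) (𝟙 U)).inv ⨟
      tMap₂ (T.lamMate R S) (𝟙 (𝟙 U)) ▷ T.a R S U)

/-- The second pasting composite of the right normalisation condition. -/
def normRight₂ (R : H.Hom A B) (S : H.Hom B C) (U : H.Hom C D) :
    tMap (T.a R S (H.one C)) (𝟙 U) ≫ T.a R (tObj S (H.one C)) U ≫
      tMap (𝟙 R) (T.a S (H.one C) U) ≫ tMap (𝟙 R) (tMap (𝟙 S) (T.r U)) ⟶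
        tMap (T.l (tObj R S)) (𝟙 U) ≫ T.a R S U :=
  cast₂
    (T.pi R S (H.one C) U ▷ tMap (𝟙 R) (tMap (𝟙 S) (T.r U)) ⨟
      T.a (tObj R S) (H.one C) U ◁ (T.aNat (𝟙 R) (𝟙 S) (T.r U)).inv ⨟
      T.midMate (tObj R S) U ▷ T.a R S U)

end TriData

/-- A tricategory whose hom-2-categories are strict 2-categories and whose composition and units
are strict 2-functors: the data together with the nonabelian 4-cocycle condition and the two
normalisation conditions. -/
structure Tricategory {Obj : Type u₀} (H : TriBase.{w, v, u} Obj) extends TriData H where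
  /-- the nonabelian 4-cocycle condition (the associahedron `K₅`) -/
  cocycle : ∀ {A B C D E F : Obj} (R : H.Hom A B) (S : H.Hom B C) (U : H.Hom C D)
    (V : H.Hom D E) (W : H.Hom E F),
    toTriData.cocycleLeft R S U V W = toTriData.cocycleRight R S U V W
  /-- the left normalisation condition -/
  norm₁ : ∀ {A B C D : Obj} (R : H.Hom A B) (S : H.Hom B C) (U : H.Hom C D),
    toTriData.normLeft₁ R S U = toTriData.normRight₁ R S U
  /-- the right normalisation condition -/
  norm₂ : ∀ {A B C D : Obj} (R : H.Hom A B) (S : H.Hom B C) (U : H.Hom C D),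
    toTriData.normLeft₂ R S U = toTriData.normRight₂ R S U

/-! ### Equality of 2-cells whose boundaries are only propositionally equal -/

section EqTwo

variable {B : Type u} [Bicategory.{w, v} B] {X Y Z : B}

/-- Equality of 2-cells in a strict 2-category whose sources and whose targets are equal (but
not syntactically the same). -/
def Eq₂ {f g f' g' : X ⟶ Y} (α : f ⟶ g) (β : f' ⟶ g') : Prop :=
  ∃ (hf : f = f') (hg : g = g'), α = eqToHom hf ≫ β ≫ eqToHom hg.symm

/-- A morphism is an identity if its source and target are equal and it is the identity of this
object. -/
def IsIdentity {C : Type u} [Category.{v} C] {X Y : C} (e : X ⟶ Y) : Prop :=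
  ∃ h : X = Y, e = eqToHom h

namespace Eq₂

variable {f g h f' g' h' f'' g'' h'' : X ⟶ Y}

theorem refl (α : f ⟶ g) : Eq₂ α α := ⟨rfl, rfl, by simp⟩

theorem of_eq {α β : f ⟶ g} (e : α = β) : Eq₂ α β := e ▸ refl _

theorem eq {α β : f ⟶ g} (e : Eq₂ α β) : α = β := by
  obtain ⟨_, _, e⟩ := e; simpa using e

theorem symm {α : f ⟶ g} {β : f' ⟶ g'} (e : Eq₂ α β) : Eq₂ β α := by
  obtain ⟨rfl, rfl, e⟩ := e; exact ⟨rfl, rfl, by simp [e]⟩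

theorem trans {α : f ⟶ g} {β : f' ⟶ g'} {γ : f'' ⟶ g''} (e : Eq₂ α β) (e' : Eq₂ β γ) :
    Eq₂ α γ := by
  obtain ⟨rfl, rfl, e⟩ := e; obtain ⟨rfl, rfl, e'⟩ := e'; exact ⟨rfl, rfl, by simp [e, e']⟩

theorem comp {α : f ⟶ g} {β : g ⟶ h} {α' : f' ⟶ g'} {β' : g' ⟶ h'} (e : Eq₂ α α')
    (e' : Eq₂ β β') : Eq₂ (α ≫ β) (α' ≫ β') := by
  obtain ⟨rfl, rfl, e⟩ := e; obtain ⟨_, rfl, e'⟩ := e'; exact ⟨rfl, rfl, by simp [e, e']⟩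

theorem iso_inv {α : f ≅ g} {α' : f' ≅ g'} (e : Eq₂ α.hom α'.hom) : Eq₂ α.inv α'.inv := by
  obtain ⟨rfl, rfl, e⟩ := e
  refine ⟨rfl, rfl, ?_⟩
  have : α = α' := by ext; simpa using e
  simp [this]

theorem whiskerLeft {k k' : Z ⟶ X} (hk : k = k') {α : f ⟶ g} {α' : f' ⟶ g'} (e : Eq₂ α α') :
    Eq₂ (k ◁ α) (k' ◁ α') := by
  subst hk; obtain ⟨rfl, rfl, e⟩ := e; exact ⟨rfl, rfl, by simp [e]⟩

theorem whiskerRight {k k' : Y ⟶ Z} (hk : k = k') {α : f ⟶ g} {α' : f' ⟶ g'} (e : Eq₂ α α') :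
    Eq₂ (α ▷ k) (α' ▷ k') := by
  subst hk; obtain ⟨rfl, rfl, e⟩ := e; exact ⟨rfl, rfl, by simp [e]⟩

theorem eqToHom_comp (e : f = g) (α : g ⟶ h) : Eq₂ (eqToHom e ≫ α) α := by
  subst e; simpa using refl α

theorem comp_eqToHom (α : f ⟶ g) (e : g = h) : Eq₂ (α ≫ eqToHom e) α := by
  subst e; simpa using refl α

theorem conj (e : f' = f) (α : f ⟶ g) (e' : g = g') : Eq₂ (eqToHom e ≫ α ≫ eqToHom e') α := by
  subst e e'; simpa using refl α

theorem eqToHom_eqToHom (e : f = g) (e' : f' = g') (e'' : f = f') :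
    Eq₂ (eqToHom e) (eqToHom e') := by
  subst e e' e''; exact refl _

variable [Strict B]

theorem assoc_hom_comp {W : B} {f : X ⟶ Y} {g : Y ⟶ Z} {h : Z ⟶ W} {k : X ⟶ W}
    (α : f ≫ g ≫ h ⟶ k) : Eq₂ ((α_ f g h).hom ≫ α) α := by
  rw [Strict.associator_eqToIso]; exact eqToHom_comp (Strict.assoc f g h) α

theorem assoc_inv_comp {W : B} {f : X ⟶ Y} {g : Y ⟶ Z} {h : Z ⟶ W} {k : X ⟶ W}
    (α : (f ≫ g) ≫ h ⟶ k) : Eq₂ ((α_ f g h).inv ≫ α) α := by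
  rw [Strict.associator_eqToIso]; exact eqToHom_comp (Strict.assoc f g h).symm α

theorem comp_assoc_hom {W : B} {f : X ⟶ Y} {g : Y ⟶ Z} {h : Z ⟶ W} {k : X ⟶ W}
    (α : k ⟶ (f ≫ g) ≫ h) : Eq₂ (α ≫ (α_ f g h).hom) α := by
  rw [Strict.associator_eqToIso]; exact comp_eqToHom α (Strict.assoc f g h)

theorem comp_assoc_inv {W : B} {f : X ⟶ Y} {g : Y ⟶ Z} {h : Z ⟶ W} {k : X ⟶ W}
    (α : k ⟶ f ≫ g ≫ h) : Eq₂ (α ≫ (α_ f g h).inv) α := by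
  rw [Strict.associator_eqToIso]; exact comp_eqToHom α (Strict.assoc f g h).symm

theorem comp_whiskerLeft {W : B} (k : Z ⟶ X) (l : W ⟶ Z) (α : f ⟶ g) :
    Eq₂ ((l ≫ k) ◁ α) (l ◁ k ◁ α) := by
  rw [Bicategory.comp_whiskerLeft]
  exact (assoc_hom_comp _).trans (comp_assoc_inv _)

theorem whiskerRight_comp {W : B} (k : Y ⟶ Z) (l : Z ⟶ W) (α : f ⟶ g) :
    Eq₂ (α ▷ (k ≫ l)) (α ▷ k ▷ l) := by
  rw [Bicategory.whiskerRight_comp]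
  exact (assoc_inv_comp _).trans (comp_assoc_hom _)

theorem whisker_assoc {W : B} (k : Z ⟶ X) (l : Y ⟶ W) (α : f ⟶ g) :
    Eq₂ ((k ◁ α) ▷ l) (k ◁ α ▷ l) := by
  rw [Bicategory.whisker_assoc]
  exact (assoc_hom_comp _).trans (comp_assoc_inv _)

theorem id_whiskerLeft (α : f ⟶ g) : Eq₂ (𝟙 X ◁ α) α := by
  rw [Bicategory.id_whiskerLeft, Strict.leftUnitor_eqToIso, Strict.leftUnitor_eqToIso]
  exact (eqToHom_comp (Strict.id_comp f) _).trans (comp_eqToHom α (Strict.id_comp g).symm)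

theorem whiskerRight_id (α : f ⟶ g) : Eq₂ (α ▷ 𝟙 Y) α := by
  rw [Bicategory.whiskerRight_id, Strict.rightUnitor_eqToIso, Strict.rightUnitor_eqToIso]
  exact (eqToHom_comp (Strict.comp_id f) _).trans (comp_eqToHom α (Strict.comp_id g).symm)

end Eq₂
end EqTwo

/-! ### Iso-comma objects -/

section IsoComma

variable {B : Type u} [Bicategory.{w, v} B] {X Y Z : B}

/-- An iso-comma object of a cospan in a 2-category: its one-dimensional
universal property is up to equality, and it also has the two-dimensional universal property. -/
structure IsoComma (f : X ⟶ Z) (g : Y ⟶ Z) where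
  /-- the iso-comma object -/
  pt : B
  /-- the first projection -/
  π₁ : pt ⟶ X
  /-- the second projection -/
  π₂ : pt ⟶ Y
  /-- the universal invertible 2-cell -/
  κ : π₁ ≫ f ≅ π₂ ≫ g
  existsUnique_lift : ∀ {W : B} (p : W ⟶ X) (q : W ⟶ Y) (k : p ≫ f ≅ q ≫ g),
    ∃! h : W ⟶ pt, h ≫ π₁ = p ∧ h ≫ π₂ = q ∧ Eq₂ (h ◁ κ.hom) k.hom
  existsUnique_lift₂ : ∀ {W : B} (j k : W ⟶ pt) (α : j ≫ π₁ ⟶ k ≫ π₁) (β : j ≫ π₂ ⟶ k ≫ π₂),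
    (α_ j π₁ f).inv ≫ α ▷ f ≫ (α_ k π₁ f).hom ≫ k ◁ κ.hom =
        j ◁ κ.hom ≫ (α_ j π₂ g).inv ≫ β ▷ g ≫ (α_ k π₂ g).hom →
      ∃! γ : j ⟶ k, γ ▷ π₁ = α ∧ γ ▷ π₂ = β

namespace IsoComma

variable {f : X ⟶ Z} {g : Y ⟶ Z} (K : IsoComma f g) {W : B}

/-- The 1-cell into an iso-comma object given by its universal property. -/
noncomputable def lift (p : W ⟶ X) (q : W ⟶ Y) (k : p ≫ f ≅ q ≫ g) : W ⟶ K.pt :=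
  (K.existsUnique_lift p q k).choose

theorem lift_π₁ (p : W ⟶ X) (q : W ⟶ Y) (k : p ≫ f ≅ q ≫ g) : K.lift p q k ≫ K.π₁ = p :=
  (K.existsUnique_lift p q k).choose_spec.1.1

theorem lift_π₂ (p : W ⟶ X) (q : W ⟶ Y) (k : p ≫ f ≅ q ≫ g) : K.lift p q k ≫ K.π₂ = q :=
  (K.existsUnique_lift p q k).choose_spec.1.2.1

theorem lift_κ (p : W ⟶ X) (q : W ⟶ Y) (k : p ≫ f ≅ q ≫ g) :
    Eq₂ (K.lift p q k ◁ K.κ.hom) k.hom :=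
  (K.existsUnique_lift p q k).choose_spec.1.2.2

/-- The 2-cell into an iso-comma object given by its universal property. -/
noncomputable def lift₂ {j k : W ⟶ K.pt} (α : j ≫ K.π₁ ⟶ k ≫ K.π₁) (β : j ≫ K.π₂ ⟶ k ≫ K.π₂)
    (e : (α_ j K.π₁ f).inv ≫ α ▷ f ≫ (α_ k K.π₁ f).hom ≫ k ◁ K.κ.hom =
      j ◁ K.κ.hom ≫ (α_ j K.π₂ g).inv ≫ β ▷ g ≫ (α_ k K.π₂ g).hom) : j ⟶ k :=
  (K.existsUnique_lift₂ j k α β e).choose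

theorem lift₂_π₁ {j k : W ⟶ K.pt} (α : j ≫ K.π₁ ⟶ k ≫ K.π₁) (β : j ≫ K.π₂ ⟶ k ≫ K.π₂)
    (e : (α_ j K.π₁ f).inv ≫ α ▷ f ≫ (α_ k K.π₁ f).hom ≫ k ◁ K.κ.hom =
      j ◁ K.κ.hom ≫ (α_ j K.π₂ g).inv ≫ β ▷ g ≫ (α_ k K.π₂ g).hom) :
    K.lift₂ α β e ▷ K.π₁ = α :=
  (K.existsUnique_lift₂ j k α β e).choose_spec.1.1

theorem lift₂_π₂ {j k : W ⟶ K.pt} (α : j ≫ K.π₁ ⟶ k ≫ K.π₁) (β : j ≫ K.π₂ ⟶ k ≫ K.π₂)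
    (e : (α_ j K.π₁ f).inv ≫ α ▷ f ≫ (α_ k K.π₁ f).hom ≫ k ◁ K.κ.hom =
      j ◁ K.κ.hom ≫ (α_ j K.π₂ g).inv ≫ β ▷ g ≫ (α_ k K.π₂ g).hom) :
    K.lift₂ α β e ▷ K.π₂ = β :=
  (K.existsUnique_lift₂ j k α β e).choose_spec.1.2

variable [Strict B]

theorem hom_ext {h k : W ⟶ K.pt} (e₁ : h ≫ K.π₁ = k ≫ K.π₁) (e₂ : h ≫ K.π₂ = k ≫ K.π₂)
    (e : Eq₂ (h ◁ K.κ.hom) (k ◁ K.κ.hom)) : h = k := by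
  have e' : Eq₂ (k ◁ K.κ.hom) ((α_ _ _ _) ≪≫ k ◁ᵢ K.κ ≪≫ (α_ _ _ _).symm :
      (k ≫ K.π₁) ≫ f ≅ (k ≫ K.π₂) ≫ g).hom :=
    ((Eq₂.assoc_hom_comp _).trans (Eq₂.comp_assoc_inv _)).symm
  exact (K.existsUnique_lift (k ≫ K.π₁) (k ≫ K.π₂) _).unique ⟨e₁, e₂, e.trans e'⟩ ⟨rfl, rfl, e'⟩

theorem hom_ext₂' {j k : W ⟶ K.pt} {γ δ : j ⟶ k} (e₁ : γ ▷ K.π₁ = δ ▷ K.π₁)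
    (e₂ : γ ▷ K.π₂ = δ ▷ K.π₂) : γ = δ :=
  (K.existsUnique_lift₂ j k (δ ▷ K.π₁) (δ ▷ K.π₂) (by
    rw [← Bicategory.whiskerRight_comp_assoc, ← Bicategory.whiskerRight_comp,
      whisker_exchange])).unique ⟨e₁, e₂⟩ ⟨rfl, rfl⟩

theorem hom_ext₂ {j k j' k' : W ⟶ K.pt} {γ : j ⟶ k} {δ : j' ⟶ k'} (ej : j = j') (ek : k = k')
    (e₁ : Eq₂ (γ ▷ K.π₁) (δ ▷ K.π₁)) (e₂ : Eq₂ (γ ▷ K.π₂) (δ ▷ K.π₂)) : Eq₂ γ δ := by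
  subst ej ek
  exact Eq₂.of_eq (K.hom_ext₂' e₁.eq e₂.eq)

end IsoComma
end IsoComma

/-! ### The 2-category of spans -/

section Span

variable {B : Type u} [Bicategory.{w, v} B]

/-- A span from `X` to `Y`. -/
structure Span (X Y : B) where
  /-- the apex -/
  pt : B
  /-- the left leg -/
  p : pt ⟶ X
  /-- the right leg -/
  q : pt ⟶ Y

/-- A map of spans: a 1-cell between the apexes and invertible 2-cells filling the two triangles. -/
structure SpanMap {X Y : B} (R S : Span X Y) where
  /-- the 1-cell between the apexes -/
  hom : R.pt ⟶ S.pt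
  /-- the left 2-cell -/
  ϖ : R.p ≅ hom ≫ S.p
  /-- the right 2-cell -/
  ϱ : R.q ≅ hom ≫ S.q

/-- A map of maps of spans. -/
@[ext]
structure SpanMap₂ {X Y : B} {R S : Span X Y} (f g : SpanMap R S) where
  /-- the underlying 2-cell -/
  hom : f.hom ⟶ g.hom
  w_p : f.ϖ.hom ≫ hom ▷ S.p = g.ϖ.hom
  w_q : f.ϱ.hom ≫ hom ▷ S.q = g.ϱ.hom

variable {X Y Z : B}

/-- The identity map of spans. -/
def SpanMap.id (R : Span X Y) : SpanMap R R where
  hom := 𝟙 R.pt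
  ϖ := (λ_ R.p).symm
  ϱ := (λ_ R.q).symm

/-- Composition of maps of spans. -/
def SpanMap.comp {R S T : Span X Y} (f : SpanMap R S) (g : SpanMap S T) : SpanMap R T where
  hom := f.hom ≫ g.hom
  ϖ := f.ϖ ≪≫ f.hom ◁ᵢ g.ϖ ≪≫ (α_ f.hom g.hom T.p).symm
  ϱ := f.ϱ ≪≫ f.hom ◁ᵢ g.ϱ ≪≫ (α_ f.hom g.hom T.q).symm

instance SpanMap.category (R S : Span X Y) : Category (SpanMap R S) where
  Hom f g := SpanMap₂ f g
  id f := ⟨𝟙 f.hom, by simp, by simp⟩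
  comp γ δ := ⟨γ.hom ≫ δ.hom, by rw [comp_whiskerRight, ← Category.assoc, γ.w_p, δ.w_p],
    by rw [comp_whiskerRight, ← Category.assoc, γ.w_q, δ.w_q]⟩
  id_comp _ := SpanMap₂.ext (Category.id_comp _)
  comp_id _ := SpanMap₂.ext (Category.comp_id _)
  assoc _ _ _ := SpanMap₂.ext (Category.assoc _ _ _)

namespace SpanMap

variable {R S T U : Span X Y}

/-- Invertible maps of maps of spans. -/
def isoMk {f g : SpanMap R S} (e : f.hom ≅ g.hom) (h : f.ϖ.hom ≫ e.hom ▷ S.p = g.ϖ.hom)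
    (h' : f.ϱ.hom ≫ e.hom ▷ S.q = g.ϱ.hom) : f ≅ g where
  hom := ⟨e.hom, h, h'⟩
  inv := ⟨e.inv, by rw [← h]; simp, by rw [← h']; simp⟩
  hom_inv_id := SpanMap₂.ext e.hom_inv_id
  inv_hom_id := SpanMap₂.ext e.inv_hom_id

/-- Left whiskering. -/
def whiskerL (f : SpanMap R S) {g h : SpanMap S T} (γ : SpanMap₂ g h) :
    SpanMap₂ (f.comp g) (f.comp h) where
  hom := f.hom ◁ γ.hom
  w_p := by simp [comp, ← γ.w_p]
  w_q := by simp [comp, ← γ.w_q]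

/-- Right whiskering. -/
def whiskerR {f g : SpanMap R S} (γ : SpanMap₂ f g) (h : SpanMap S T) :
    SpanMap₂ (f.comp h) (g.comp h) where
  hom := γ.hom ▷ h.hom
  w_p := by
    simp only [comp, Iso.trans_hom, Iso.symm_hom, whiskerLeftIso_hom, Category.assoc, ← γ.w_p]
    rw [← associator_inv_naturality_left, whisker_exchange_assoc]
  w_q := by
    simp only [comp, Iso.trans_hom, Iso.symm_hom, whiskerLeftIso_hom, Category.assoc, ← γ.w_q]
    rw [← associator_inv_naturality_left, whisker_exchange_assoc]

theorem hom_ext {f g : SpanMap R S} (h : f.hom = g.hom) (hp : Eq₂ f.ϖ.hom g.ϖ.hom)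
    (hq : Eq₂ f.ϱ.hom g.ϱ.hom) : f = g := by
  cases f; cases g
  dsimp at h
  subst h
  congr
  · ext; exact hp.eq
  · ext; exact hq.eq

end SpanMap

namespace Span

variable {R S T U : Span X Y}

instance bicategory : Bicategory (Span X Y) where
  Hom := SpanMap
  id := SpanMap.id
  comp := SpanMap.comp
  homCategory R S := SpanMap.category R S
  whiskerLeft f _ _ γ := SpanMap.whiskerL f γ
  whiskerRight γ f := SpanMap.whiskerR γ f
  associator f g h := SpanMap.isoMk (α_ f.hom g.hom h.hom) (by simp [SpanMap.comp])
    (by simp [SpanMap.comp])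
  leftUnitor f := SpanMap.isoMk (λ_ f.hom) (by simp [SpanMap.comp, SpanMap.id])
    (by simp [SpanMap.comp, SpanMap.id])
  rightUnitor f := SpanMap.isoMk (ρ_ f.hom) (by simp [SpanMap.comp, SpanMap.id])
    (by simp [SpanMap.comp, SpanMap.id])
  whiskerLeft_id f g := SpanMap₂.ext (Bicategory.whiskerLeft_id f.hom g.hom)
  whiskerLeft_comp f _ _ _ γ δ := SpanMap₂.ext (Bicategory.whiskerLeft_comp f.hom _ _)
  id_whiskerLeft γ := SpanMap₂.ext (Bicategory.id_whiskerLeft _)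
  comp_whiskerLeft f g _ _ γ := SpanMap₂.ext (Bicategory.comp_whiskerLeft f.hom g.hom _)
  id_whiskerRight f g := SpanMap₂.ext (Bicategory.id_whiskerRight f.hom g.hom)
  comp_whiskerRight γ δ f := SpanMap₂.ext (Bicategory.comp_whiskerRight _ _ f.hom)
  whiskerRight_id γ := SpanMap₂.ext (Bicategory.whiskerRight_id _)
  whiskerRight_comp γ f g := SpanMap₂.ext (Bicategory.whiskerRight_comp _ f.hom g.hom)
  whisker_assoc f _ _ γ g := SpanMap₂.ext (Bicategory.whisker_assoc f.hom _ g.hom)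
  whisker_exchange γ δ := SpanMap₂.ext (Bicategory.whisker_exchange _ _)
  pentagon f g h i := SpanMap₂.ext (Bicategory.pentagon f.hom g.hom h.hom i.hom)
  triangle f g := SpanMap₂.ext (Bicategory.triangle f.hom g.hom)

@[ext]
theorem hom₂_ext {f g : R ⟶ S} {γ δ : f ⟶ g} (h : γ.hom = δ.hom) : γ = δ := SpanMap₂.ext h

@[simp] theorem id_hom : SpanMap.hom (𝟙 R) = 𝟙 R.pt := rfl
@[simp] theorem id_ϖ : SpanMap.ϖ (𝟙 R) = (λ_ R.p).symm := rfl
@[simp] theorem id_ϱ : SpanMap.ϱ (𝟙 R) = (λ_ R.q).symm := rfl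
@[simp] theorem comp_hom (f : R ⟶ S) (g : S ⟶ T) : (f ≫ g).hom = f.hom ≫ g.hom := rfl
@[simp] theorem comp_ϖ (f : R ⟶ S) (g : S ⟶ T) :
    (f ≫ g).ϖ = f.ϖ ≪≫ f.hom ◁ᵢ g.ϖ ≪≫ (α_ f.hom g.hom T.p).symm := rfl
@[simp] theorem comp_ϱ (f : R ⟶ S) (g : S ⟶ T) :
    (f ≫ g).ϱ = f.ϱ ≪≫ f.hom ◁ᵢ g.ϱ ≪≫ (α_ f.hom g.hom T.q).symm := rfl
@[simp] theorem id₂_hom (f : R ⟶ S) : SpanMap₂.hom (𝟙 f) = 𝟙 f.hom := rfl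
@[simp] theorem comp₂_hom {f g h : R ⟶ S} (γ : f ⟶ g) (δ : g ⟶ h) :
    (γ ≫ δ).hom = γ.hom ≫ δ.hom := rfl
@[simp] theorem whiskerLeft_hom (f : R ⟶ S) {g h : S ⟶ T} (γ : g ⟶ h) :
    (f ◁ γ).hom = f.hom ◁ γ.hom := rfl
@[simp] theorem whiskerRight_hom {f g : R ⟶ S} (γ : f ⟶ g) (h : S ⟶ T) :
    (γ ▷ h).hom = γ.hom ▷ h.hom := rfl
@[simp] theorem associator_hom_hom (f : R ⟶ S) (g : S ⟶ T) (h : T ⟶ U) :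
    (α_ f g h).hom.hom = (α_ f.hom g.hom h.hom).hom := rfl
@[simp] theorem leftUnitor_hom_hom (f : R ⟶ S) : (λ_ f).hom.hom = (λ_ f.hom).hom := rfl
@[simp] theorem rightUnitor_hom_hom (f : R ⟶ S) : (ρ_ f).hom.hom = (ρ_ f.hom).hom := rfl

theorem eqToHom_hom {f g : R ⟶ S} (h : f = g) :
    (eqToHom h).hom = eqToHom (congrArg SpanMap.hom h) := by
  subst h; rfl

theorem eq₂_of_hom {f g f' g' : R ⟶ S} {γ : f ⟶ g} {δ : f' ⟶ g'} (hf : f = f') (hg : g = g')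
    (h : Eq₂ γ.hom δ.hom) : Eq₂ γ δ := by
  subst hf hg
  exact Eq₂.of_eq (hom₂_ext h.eq)

variable [Strict B]

theorem id_comp_aux {X Y Z : B} {p : X ⟶ Y} {f : X ⟶ Z} {q : Z ⟶ Y} (e : p ⟶ f ≫ q) :
    Eq₂ ((λ_ p).inv ≫ 𝟙 X ◁ e ≫ (α_ _ _ _).inv) e := by
  rw [← leftUnitor_inv_naturality_assoc, Strict.leftUnitor_eqToIso, Strict.associator_eqToIso]
  simpa using Eq₂.comp_eqToHom e (g := f ≫ q) (h := (𝟙 X ≫ f) ≫ q) (by simp)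

theorem comp_id_aux {X Y Z : B} {p : X ⟶ Y} {f : X ⟶ Z} {q : Z ⟶ Y} (e : p ⟶ f ≫ q) :
    Eq₂ (e ≫ f ◁ (λ_ q).inv ≫ (α_ _ _ _).inv) e := by
  simp only [Strict.leftUnitor_eqToIso, Strict.associator_eqToIso, eqToIso.inv,
    whiskerLeft_eqToHom, eqToHom_trans]
  exact Eq₂.comp_eqToHom _ _

theorem assoc_aux {X Y Z V W : B} {p : X ⟶ Y} {f : X ⟶ Z} {q : Z ⟶ Y} {g : Z ⟶ W} {r : W ⟶ Y}
    {h : W ⟶ V} {s : V ⟶ Y} (e : p ⟶ f ≫ q) (e' : q ⟶ g ≫ r) (e'' : r ⟶ h ≫ s) :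
    Eq₂ ((e ≫ f ◁ e' ≫ (α_ _ _ _).inv) ≫ (f ≫ g) ◁ e'' ≫ (α_ _ _ _).inv)
      (e ≫ f ◁ (e' ≫ g ◁ e'' ≫ (α_ _ _ _).inv) ≫ (α_ _ _ _).inv) := by
  refine ⟨rfl, by simp, ?_⟩
  simp [Strict.associator_eqToIso]

instance strict : Strict (Span X Y) where
  id_comp f := SpanMap.hom_ext (Strict.id_comp f.hom) (id_comp_aux f.ϖ.hom) (id_comp_aux f.ϱ.hom)
  comp_id f := SpanMap.hom_ext (Strict.comp_id f.hom) (comp_id_aux f.ϖ.hom) (comp_id_aux f.ϱ.hom)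
  assoc f g h := SpanMap.hom_ext (Strict.assoc f.hom g.hom h.hom)
    (assoc_aux f.ϖ.hom g.ϖ.hom h.ϖ.hom) (assoc_aux f.ϱ.hom g.ϱ.hom h.ϱ.hom)
  leftUnitor_eqToIso f := by
    ext; simp [eqToHom_hom, Strict.leftUnitor_eqToIso]
  rightUnitor_eqToIso f := by
    ext; simp [eqToHom_hom, Strict.rightUnitor_eqToIso]
  associator_eqToIso f g h := by
    ext; simp [eqToHom_hom, Strict.associator_eqToIso]

end Span
end Span

/-! ### Composition of spans -/

section Comp

open TwoFunctor

variable {B : Type u} [Bicategory.{w, v} B] {X Y Z : B}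

/-- The composite of two spans, formed with an iso-comma object. -/
abbrev compObj (R : Span X Y) (S : Span Y Z) (K : IsoComma R.q S.p) : Span X Z where
  pt := K.pt
  p := K.π₁ ≫ R.p
  q := K.π₂ ≫ S.q

variable {R R' R'' : Span X Y} {S S' S'' : Span Y Z}

/-- The cone defining the composite of two maps of spans. -/
def compCone (K : IsoComma R.q S.p) (f : SpanMap R R') (g : SpanMap S S') :
    (K.π₁ ≫ f.hom) ≫ R'.q ≅ (K.π₂ ≫ g.hom) ≫ S'.p :=
  α_ _ _ _ ≪≫ K.π₁ ◁ᵢ f.ϱ.symm ≪≫ K.κ ≪≫ K.π₂ ◁ᵢ g.ϖ ≪≫ (α_ _ _ _).symm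

theorem compCone_naturality (K : IsoComma R.q S.p) {f f' : SpanMap R R'} {g g' : SpanMap S S'}
    (γ : SpanMap₂ f f') (δ : SpanMap₂ g g') :
    (K.π₁ ◁ γ.hom) ▷ R'.q ≫ (compCone K f' g').hom =
      (compCone K f g).hom ≫ (K.π₂ ◁ δ.hom) ▷ S'.p := by
  have h₁ : γ.hom ▷ R'.q ≫ f'.ϱ.inv = f.ϱ.inv := by
    rw [Iso.comp_inv_eq, ← γ.w_q]; simp
  simp [compCone, ← δ.w_p, ← h₁]

variable [Strict B] (K : IsoComma R.q S.p) (K' : IsoComma R'.q S'.p) (K'' : IsoComma R''.q S''.p)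

/-- The 1-cell underlying the composite of two maps of spans. -/
noncomputable def compHom (f : SpanMap R R') (g : SpanMap S S') : K.pt ⟶ K'.pt :=
  K'.lift (K.π₁ ≫ f.hom) (K.π₂ ≫ g.hom) (compCone K f g)

theorem compHom_π₁ (f : SpanMap R R') (g : SpanMap S S') :
    compHom K K' f g ≫ K'.π₁ = K.π₁ ≫ f.hom := K'.lift_π₁ _ _ _

theorem compHom_π₂ (f : SpanMap R R') (g : SpanMap S S') :
    compHom K K' f g ≫ K'.π₂ = K.π₂ ≫ g.hom := K'.lift_π₂ _ _ _

theorem compHom_κ (f : SpanMap R R') (g : SpanMap S S') :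
    Eq₂ (compHom K K' f g ◁ K'.κ.hom) (compCone K f g).hom := K'.lift_κ _ _ _

theorem compHom_p (f : SpanMap R R') (g : SpanMap S S') :
    K.π₁ ≫ f.hom ≫ R'.p = compHom K K' f g ≫ K'.π₁ ≫ R'.p := by
  rw [← Strict.assoc, ← compHom_π₁ K K' f g, Strict.assoc]

theorem compHom_q (f : SpanMap R R') (g : SpanMap S S') :
    K.π₂ ≫ g.hom ≫ S'.q = compHom K K' f g ≫ K'.π₂ ≫ S'.q := by
  rw [← Strict.assoc, ← compHom_π₂ K K' f g, Strict.assoc]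

/-- The composite of two maps of spans. -/
noncomputable def compMap (f : SpanMap R R') (g : SpanMap S S') :
    SpanMap (compObj R S K) (compObj R' S' K') where
  hom := compHom K K' f g
  ϖ := K.π₁ ◁ᵢ f.ϖ ≪≫ eqToIso (compHom_p K K' f g)
  ϱ := K.π₂ ◁ᵢ g.ϱ ≪≫ eqToIso (compHom_q K K' f g)

theorem compMap_ϖ (f : SpanMap R R') (g : SpanMap S S') :
    Eq₂ (compMap K K' f g).ϖ.hom (K.π₁ ◁ f.ϖ.hom) :=
  Eq₂.comp_eqToHom (K.π₁ ◁ f.ϖ.hom) (compHom_p K K' f g)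

theorem compMap_ϱ (f : SpanMap R R') (g : SpanMap S S') :
    Eq₂ (compMap K K' f g).ϱ.hom (K.π₂ ◁ g.ϱ.hom) :=
  Eq₂.comp_eqToHom (K.π₂ ◁ g.ϱ.hom) (compHom_q K K' f g)

theorem compMap₂_aux {f f' : SpanMap R R'} {g g' : SpanMap S S'} (γ : SpanMap₂ f f')
    (δ : SpanMap₂ g g') :
    (α_ _ _ _).inv ≫ (eqToHom (compHom_π₁ K K' f g) ≫ K.π₁ ◁ γ.hom ≫
        eqToHom (compHom_π₁ K K' f' g').symm) ▷ R'.q ≫ (α_ _ _ _).hom ≫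
          compHom K K' f' g' ◁ K'.κ.hom =
      compHom K K' f g ◁ K'.κ.hom ≫ (α_ _ _ _).inv ≫ (eqToHom (compHom_π₂ K K' f g) ≫
        K.π₂ ◁ δ.hom ≫ eqToHom (compHom_π₂ K K' f' g').symm) ▷ S'.p ≫ (α_ _ _ _).hom := by
  refine Eq₂.eq (Eq₂.trans (Eq₂.trans ?_ (Eq₂.of_eq (compCone_naturality K γ δ)))
    (Eq₂.symm ?_))
  · exact (Eq₂.assoc_inv_comp _).trans ((Eq₂.whiskerRight rfl (Eq₂.conj _ _ _)).comp
      ((Eq₂.assoc_hom_comp _).trans (compHom_κ K K' f' g')))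
  · exact (compHom_κ K K' f g).comp ((Eq₂.assoc_inv_comp _).trans
      ((Eq₂.comp_assoc_hom _).trans (Eq₂.whiskerRight rfl (Eq₂.conj _ _ _))))

/-- The 2-cell underlying the composite of two maps of maps of spans. -/
noncomputable def compMap₂Hom {f f' : SpanMap R R'} {g g' : SpanMap S S'} (γ : SpanMap₂ f f')
    (δ : SpanMap₂ g g') : compHom K K' f g ⟶ compHom K K' f' g' :=
  K'.lift₂
    (eqToHom (compHom_π₁ K K' f g) ≫ K.π₁ ◁ γ.hom ≫ eqToHom (compHom_π₁ K K' f' g').symm)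
    (eqToHom (compHom_π₂ K K' f g) ≫ K.π₂ ◁ δ.hom ≫ eqToHom (compHom_π₂ K K' f' g').symm)
    (compMap₂_aux K K' γ δ)

theorem compMap₂_π₁ {f f' : SpanMap R R'} {g g' : SpanMap S S'} (γ : SpanMap₂ f f')
    (δ : SpanMap₂ g g') : Eq₂ (compMap₂Hom K K' γ δ ▷ K'.π₁) (K.π₁ ◁ γ.hom) :=
  (Eq₂.of_eq (K'.lift₂_π₁ _ _ _)).trans (Eq₂.conj _ _ _)

theorem compMap₂_π₂ {f f' : SpanMap R R'} {g g' : SpanMap S S'} (γ : SpanMap₂ f f')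
    (δ : SpanMap₂ g g') : Eq₂ (compMap₂Hom K K' γ δ ▷ K'.π₂) (K.π₂ ◁ δ.hom) :=
  (Eq₂.of_eq (K'.lift₂_π₂ _ _ _)).trans (Eq₂.conj _ _ _)

/-- The composite of two maps of maps of spans. -/
noncomputable def compMap₂ {f f' : SpanMap R R'} {g g' : SpanMap S S'} (γ : SpanMap₂ f f')
    (δ : SpanMap₂ g g') : SpanMap₂ (compMap K K' f g) (compMap K K' f' g') where
  hom := compMap₂Hom K K' γ δ
  w_p := by
    refine Eq₂.eq (Eq₂.trans (Eq₂.comp (compMap_ϖ K K' f g)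
      (β' := K.π₁ ◁ γ.hom ▷ R'.p) ?_) ?_)
    · exact (Eq₂.whiskerRight_comp _ _ _).trans
        ((Eq₂.whiskerRight rfl (compMap₂_π₁ K K' γ δ)).trans (Eq₂.whisker_assoc _ _ _))
    · rw [← Bicategory.whiskerLeft_comp, γ.w_p]
      exact (compMap_ϖ K K' f' g').symm
  w_q := by
    refine Eq₂.eq (Eq₂.trans (Eq₂.comp (compMap_ϱ K K' f g)
      (β' := K.π₂ ◁ δ.hom ▷ S'.q) ?_) ?_)
    · exact (Eq₂.whiskerRight_comp _ _ _).trans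
        ((Eq₂.whiskerRight rfl (compMap₂_π₂ K K' γ δ)).trans (Eq₂.whisker_assoc _ _ _))
    · rw [← Bicategory.whiskerLeft_comp, δ.w_q]
      exact (compMap_ϱ K K' f' g').symm

theorem compHom_id : compHom K K (SpanMap.id R) (SpanMap.id S) = 𝟙 K.pt := by
  refine K.hom_ext ((compHom_π₁ K K _ _).trans ?_) ((compHom_π₂ K K _ _).trans ?_)
    ((compHom_κ K K _ _).trans ?_)
  · simp [SpanMap.id]
  · simp [SpanMap.id]
  · refine Eq₂.trans ?_ (Eq₂.id_whiskerLeft _).symm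
    refine ⟨by simp [SpanMap.id], by simp [SpanMap.id], ?_⟩
    simp [compCone, SpanMap.id, Strict.associator_eqToIso, Strict.leftUnitor_eqToIso]

theorem compMap_id : compMap K K (SpanMap.id R) (SpanMap.id S) = SpanMap.id (compObj R S K) := by
  refine SpanMap.hom_ext (compHom_id K) ((compMap_ϖ K K _ _).trans ?_)
    ((compMap_ϱ K K _ _).trans ?_)
  · refine ⟨rfl, by simp [SpanMap.id], ?_⟩
    simp [SpanMap.id, Strict.leftUnitor_eqToIso]
  · refine ⟨rfl, by simp [SpanMap.id], ?_⟩
    simp [SpanMap.id, Strict.leftUnitor_eqToIso]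

theorem compCone_comp (f : SpanMap R R') (f' : SpanMap R' R'') (g : SpanMap S S')
    (g' : SpanMap S' S'') : Eq₂ (compCone K (f.comp f') (g.comp g')).hom
      (compHom K K' f g ◁ (compCone K' f' g').hom) := by
  have e : Eq₂ (compHom K K' f g ◁ (compCone K' f' g').hom)
      ((K.π₁ ≫ f.hom) ◁ f'.ϱ.inv ≫ (compCone K f g).hom ≫ (K.π₂ ≫ g.hom) ◁ g'.ϖ.hom) := by
    have e₁ : Eq₂ (compCone K' f' g').hom (K'.π₁ ◁ f'.ϱ.inv ≫ K'.κ.hom ≫ K'.π₂ ◁ g'.ϖ.hom) := by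
      refine ⟨by simp, by simp, ?_⟩
      simp [compCone, Strict.associator_eqToIso]
    refine (Eq₂.whiskerLeft rfl e₁).trans ?_
    rw [Bicategory.whiskerLeft_comp, Bicategory.whiskerLeft_comp]
    refine Eq₂.comp ?_ (Eq₂.comp (compHom_κ K K' f g) ?_)
    · exact (Eq₂.comp_whiskerLeft _ _ _).symm.trans
        (Eq₂.whiskerLeft (compHom_π₁ K K' f g) (Eq₂.refl _))
    · exact (Eq₂.comp_whiskerLeft _ _ _).symm.trans
        (Eq₂.whiskerLeft (compHom_π₂ K K' f g) (Eq₂.refl _))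
  refine Eq₂.trans ?_ e.symm
  refine ⟨by simp [SpanMap.comp], by simp [SpanMap.comp], ?_⟩
  simp [compCone, SpanMap.comp, Strict.associator_eqToIso]
  erw [eqToHom_trans_assoc, eqToHom_trans]

theorem compHom_comp (f : SpanMap R R') (f' : SpanMap R' R'') (g : SpanMap S S')
    (g' : SpanMap S' S'') : compHom K K'' (f.comp f') (g.comp g') =
      compHom K K' f g ≫ compHom K' K'' f' g' := by
  refine K''.hom_ext ?_ ?_ ((compHom_κ K K'' _ _).trans (Eq₂.trans ?_
      (Eq₂.comp_whiskerLeft _ _ _).symm))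
  · rw [Strict.assoc, compHom_π₁, compHom_π₁, ← Strict.assoc, compHom_π₁, Strict.assoc]
    rfl
  · rw [Strict.assoc, compHom_π₂, compHom_π₂, ← Strict.assoc, compHom_π₂, Strict.assoc]
    rfl
  · exact (compCone_comp K K' f f' g g').trans
      (Eq₂.whiskerLeft rfl (compHom_κ K' K'' f' g')).symm

theorem compMap_comp (f : SpanMap R R') (f' : SpanMap R' R'') (g : SpanMap S S')
    (g' : SpanMap S' S'') : compMap K K'' (f.comp f') (g.comp g') =
      (compMap K K' f g).comp (compMap K' K'' f' g') := by
  refine SpanMap.hom_ext (compHom_comp K K' K'' f f' g g') ((compMap_ϖ K K'' _ _).trans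
    (Eq₂.symm ?_)) ((compMap_ϱ K K'' _ _).trans (Eq₂.symm ?_))
  · refine (Eq₂.comp (compMap_ϖ K K' f g) (((Eq₂.comp_assoc_inv _).trans
      (Eq₂.whiskerLeft rfl (compMap_ϖ K' K'' f' g'))).trans
        ((Eq₂.comp_whiskerLeft _ _ _).symm.trans (Eq₂.whiskerLeft (compHom_π₁ K K' f g)
          (Eq₂.refl _)) |>.trans (Eq₂.comp_whiskerLeft _ _ _)))).trans ?_
    rw [← Bicategory.whiskerLeft_comp]
    exact Eq₂.whiskerLeft rfl (Eq₂.comp (Eq₂.refl _) (Eq₂.comp_assoc_inv _).symm)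
  · refine (Eq₂.comp (compMap_ϱ K K' f g) (((Eq₂.comp_assoc_inv _).trans
      (Eq₂.whiskerLeft rfl (compMap_ϱ K' K'' f' g'))).trans
        ((Eq₂.comp_whiskerLeft _ _ _).symm.trans (Eq₂.whiskerLeft (compHom_π₂ K K' f g)
          (Eq₂.refl _)) |>.trans (Eq₂.comp_whiskerLeft _ _ _)))).trans ?_
    rw [← Bicategory.whiskerLeft_comp]
    exact Eq₂.whiskerLeft rfl (Eq₂.comp (Eq₂.refl _) (Eq₂.comp_assoc_inv _).symm)

variable (R S) in
theorem compMap₂_id (f : SpanMap R R') (g : SpanMap S S') :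
    compMap₂ K K' (𝟙 f) (𝟙 g) = 𝟙 (compMap K K' f g) := by
  refine SpanMap₂.ext (K'.hom_ext₂' (Eq₂.eq ?_) (Eq₂.eq ?_))
  · refine (compMap₂_π₁ K K' _ _).trans ?_
    change Eq₂ (K.π₁ ◁ 𝟙 f.hom) (𝟙 (compHom K K' f g) ▷ K'.π₁)
    rw [Bicategory.whiskerLeft_id, Bicategory.id_whiskerRight, compHom_π₁]
    exact Eq₂.refl _
  · refine (compMap₂_π₂ K K' _ _).trans ?_
    change Eq₂ (K.π₂ ◁ 𝟙 g.hom) (𝟙 (compHom K K' f g) ▷ K'.π₂)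
    rw [Bicategory.whiskerLeft_id, Bicategory.id_whiskerRight, compHom_π₂]
    exact Eq₂.refl _

theorem compMap₂_comp {f f' f'' : SpanMap R R'} {g g' g'' : SpanMap S S'} (γ : f ⟶ f')
    (γ' : f' ⟶ f'') (δ : g ⟶ g') (δ' : g' ⟶ g'') :
    compMap₂ K K' (γ ≫ γ' : f ⟶ f'') (δ ≫ δ' : g ⟶ g'') =
      (show compMap K K' f g ⟶ compMap K K' f' g' from compMap₂ K K' γ δ) ≫
        (show compMap K K' f' g' ⟶ compMap K K' f'' g'' from compMap₂ K K' γ' δ') := by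
  refine SpanMap₂.ext (K'.hom_ext₂' (Eq₂.eq ?_) (Eq₂.eq ?_))
  · refine (compMap₂_π₁ K K' _ _).trans ?_
    change Eq₂ (K.π₁ ◁ (γ.hom ≫ γ'.hom)) ((compMap₂Hom K K' γ δ ≫ compMap₂Hom K K' γ' δ') ▷ K'.π₁)
    rw [Bicategory.whiskerLeft_comp, Bicategory.comp_whiskerRight]
    exact (Eq₂.comp (compMap₂_π₁ K K' _ _) (compMap₂_π₁ K K' _ _)).symm
  · refine (compMap₂_π₂ K K' _ _).trans ?_
    change Eq₂ (K.π₂ ◁ (δ.hom ≫ δ'.hom)) ((compMap₂Hom K K' γ δ ≫ compMap₂Hom K K' γ' δ') ▷ K'.π₂)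
    rw [Bicategory.whiskerLeft_comp, Bicategory.comp_whiskerRight]
    exact (Eq₂.comp (compMap₂_π₂ K K' _ _) (compMap₂_π₂ K K' _ _)).symm

theorem compMap₂_whiskerLeft (f : SpanMap R R') (g : SpanMap S S') {f' f'' : SpanMap R' R''}
    {g' g'' : SpanMap S' S''} (γ : SpanMap₂ f' f'') (δ : SpanMap₂ g' g'') :
    Eq₂ (compMap₂Hom K K'' (SpanMap.whiskerL f γ) (SpanMap.whiskerL g δ))
      (compHom K K' f g ◁ compMap₂Hom K' K'' γ δ) := by
  refine K''.hom_ext₂ (compHom_comp K K' K'' _ _ _ _) (compHom_comp K K' K'' _ _ _ _) ?_ ?_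
  · exact (compMap₂_π₁ K K'' _ _).trans ((Eq₂.comp_whiskerLeft _ _ _).symm.trans
      ((Eq₂.whiskerLeft (compHom_π₁ K K' f g) (Eq₂.refl γ.hom)).symm.trans
        ((Eq₂.comp_whiskerLeft _ _ _).trans ((Eq₂.whiskerLeft rfl
          (compMap₂_π₁ K' K'' γ δ)).symm.trans (Eq₂.whisker_assoc _ _ _).symm))))
  · exact (compMap₂_π₂ K K'' _ _).trans ((Eq₂.comp_whiskerLeft _ _ _).symm.trans
      ((Eq₂.whiskerLeft (compHom_π₂ K K' f g) (Eq₂.refl δ.hom)).symm.trans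
        ((Eq₂.comp_whiskerLeft _ _ _).trans ((Eq₂.whiskerLeft rfl
          (compMap₂_π₂ K' K'' γ δ)).symm.trans (Eq₂.whisker_assoc _ _ _).symm))))

theorem compMap₂_whiskerRight {f f' : SpanMap R R'} {g g' : SpanMap S S'} (γ : SpanMap₂ f f')
    (δ : SpanMap₂ g g') (f'' : SpanMap R' R'') (g'' : SpanMap S' S'') :
    Eq₂ (compMap₂Hom K K'' (SpanMap.whiskerR γ f'') (SpanMap.whiskerR δ g''))
      (compMap₂Hom K K' γ δ ▷ compHom K' K'' f'' g'') := by
  refine K''.hom_ext₂ (compHom_comp K K' K'' _ _ _ _) (compHom_comp K K' K'' _ _ _ _) ?_ ?_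
  · exact (compMap₂_π₁ K K'' _ _).trans ((Eq₂.whisker_assoc _ _ _).symm.trans
      ((Eq₂.whiskerRight rfl (compMap₂_π₁ K K' γ δ)).symm.trans
        ((Eq₂.whiskerRight_comp _ _ _).symm.trans ((Eq₂.whiskerRight
          (compHom_π₁ K' K'' f'' g'').symm (Eq₂.refl _)).trans (Eq₂.whiskerRight_comp _ _ _)))))
  · exact (compMap₂_π₂ K K'' _ _).trans ((Eq₂.whisker_assoc _ _ _).symm.trans
      ((Eq₂.whiskerRight rfl (compMap₂_π₂ K K' γ δ)).symm.trans
        ((Eq₂.whiskerRight_comp _ _ _).symm.trans ((Eq₂.whiskerRight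
          (compHom_π₂ K' K'' f'' g'').symm (Eq₂.refl _)).trans (Eq₂.whiskerRight_comp _ _ _)))))

/-- Composition of spans, as a 2-functor. -/
noncomputable def spanComp (pb : ∀ {X Y Z : B} (f : X ⟶ Z) (g : Y ⟶ Z), IsoComma f g)
    (X Y Z : B) : TwoFunctor (Span X Y × Span Y Z) (Span X Z) where
  obj P := compObj P.1 P.2 (pb _ _)
  map f := compMap _ _ f.1 f.2
  map₂ γ := compMap₂ _ _ γ.1 γ.2
  map₂_id f := compMap₂_id _ _ _ _ f.1 f.2
  map₂_comp γ δ := compMap₂_comp _ _ γ.1 δ.1 γ.2 δ.2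
  map_id P := compMap_id _
  map_comp f g := compMap_comp _ _ _ f.1 g.1 f.2 g.2
  map₂_whisker_left f _ _ γ := by
    obtain ⟨_, _, h⟩ := Span.eq₂_of_hom
      (γ := compMap₂ _ _ (SpanMap.whiskerL f.1 γ.1) (SpanMap.whiskerL f.2 γ.2))
      (δ := SpanMap.whiskerL (compMap _ _ f.1 f.2) (compMap₂ _ _ γ.1 γ.2))
      (compMap_comp _ _ _ _ _ _ _) (compMap_comp _ _ _ _ _ _ _)
      (compMap₂_whiskerLeft (pb _ _) (pb _ _) (pb _ _) f.1 f.2 γ.1 γ.2)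
    exact h
  map₂_whisker_right γ f := by
    obtain ⟨_, _, h⟩ := Span.eq₂_of_hom
      (γ := compMap₂ _ _ (SpanMap.whiskerR γ.1 f.1) (SpanMap.whiskerR γ.2 f.2))
      (δ := SpanMap.whiskerR (compMap₂ _ _ γ.1 γ.2) (compMap _ _ f.1 f.2))
      (compMap_comp _ _ _ _ _ _ _) (compMap_comp _ _ _ _ _ _ _)
      (compMap₂_whiskerRight (pb _ _) (pb _ _) (pb _ _) γ.1 γ.2 f.1 f.2)
    exact h

/-- The identity span. -/
def idSpan (X : B) : Span X X := ⟨X, 𝟙 X, 𝟙 X⟩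

/-- The unit, as a 2-functor. -/
def spanUnit (X : B) : TwoFunctor One (Span X X) where
  obj _ := idSpan X
  map _ := 𝟙 _
  map₂ _ := 𝟙 _
  map_comp _ _ := (Strict.comp_id _).symm
  map₂_whisker_left _ _ _ _ := by simp
  map₂_whisker_right _ _ := by simp

/-- Composition and units of spans in a 2-category with iso-comma objects. -/
noncomputable def spanBase (pb : ∀ {X Y Z : B} (f : X ⟶ Z) (g : Y ⟶ Z), IsoComma f g) :
    TriBase B where
  Hom X Y := Span X Y
  comp X Y Z := spanComp pb X Y Z
  unit X := spanUnit X

end Comp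

/-! ### Explicit descriptions of the structure of the tricategory of spans -/

section Spec

/-- A strong transformation is strict if its naturality 2-cells are identities. -/
def IsStrict {A : Type u₁} [Bicategory.{w₁, v₁} A] {B : Type u₂} [Bicategory.{w₂, v₂} B]
    {F G : Pseudofunctor A B} (η : F ⟶ G) : Prop :=
  ∀ {x y : A} (f : x ⟶ y), IsIdentity (η.naturality f).hom

/-- An adjoint equivalence in a 2-category of 2-functors is strict if both transformations are
strict and the unit and the counit are identities. -/
structure IsStrictEquivalence {A : Type u₁} [Bicategory.{w₁, v₁} A] {B : Type u₂}
    [Bicategory.{w₂, v₂} B] {F G : Pseudofunctor A B} (e : Bicategory.Equivalence F G) : Prop where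
  hom : IsStrict e.hom
  inv : IsStrict e.inv
  unit : IsIdentity e.unit.hom
  counit : IsIdentity e.counit.hom

variable {B : Type u} [Bicategory.{w, v} B]

/-- The chosen iso-comma object over which two composable spans are composed. -/
abbrev comma (pb : ∀ {X Y Z : B} (f : X ⟶ Z) (g : Y ⟶ Z), IsoComma f g) {X Y Z : B}
    (R : Span X Y) (S : Span Y Z) : IsoComma R.q S.p :=
  pb R.q S.p

/-- The composite of two spans with respect to the chosen iso-comma objects. -/
abbrev spanObj (pb : ∀ {X Y Z : B} (f : X ⟶ Z) (g : Y ⟶ Z), IsoComma f g) {X Y Z : B}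
    (R : Span X Y) (S : Span Y Z) : Span X Z :=
  compObj R S (comma pb R S)

variable [Strict B] {pb : ∀ {X Y Z : B} (f : X ⟶ Z) (g : Y ⟶ Z), IsoComma f g}
  (T : Tricategory (spanBase pb)) {W X Y Z : B}

/-- The component `(R * S) * U ⟶ R * (S * U)` of the associator is the map of spans with identity
2-cells that is compatible with the three projections and the two iso-comma 2-cells. -/
structure IsSpanAssociator (R : Span W X) (S : Span X Y) (U : Span Y Z) : Prop where
  π₁ : (T.a R S U).hom ≫ (comma pb R (spanObj pb S U)).π₁ =
    (comma pb (spanObj pb R S) U).π₁ ≫ (comma pb R S).π₁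
  π₂ : (T.a R S U).hom ≫ (comma pb R (spanObj pb S U)).π₂ ≫ (comma pb S U).π₁ =
    (comma pb (spanObj pb R S) U).π₁ ≫ (comma pb R S).π₂
  π₃ : (T.a R S U).hom ≫ (comma pb R (spanObj pb S U)).π₂ ≫ (comma pb S U).π₂ =
    (comma pb (spanObj pb R S) U).π₂
  κ₁ : Eq₂ ((T.a R S U).hom ◁ (comma pb R (spanObj pb S U)).κ.hom)
    ((comma pb (spanObj pb R S) U).π₁ ◁ (comma pb R S).κ.hom)
  κ₂ : Eq₂ ((T.a R S U).hom ◁ (comma pb R (spanObj pb S U)).π₂ ◁ (comma pb S U).κ.hom)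
    (comma pb (spanObj pb R S) U).κ.hom
  ϖ : IsIdentity (T.a R S U).ϖ.hom
  ϱ : IsIdentity (T.a R S U).ϱ.hom

/-- The component `R * (S * U) ⟶ (R * S) * U` of the inverse associator is the map of spans with
identity 2-cells that is compatible with the three projections and the two iso-comma 2-cells. -/
structure IsSpanAssociatorInv (R : Span W X) (S : Span X Y) (U : Span Y Z) : Prop where
  π₁ : (T.a' R S U).hom ≫ (comma pb (spanObj pb R S) U).π₁ ≫ (comma pb R S).π₁ =
    (comma pb R (spanObj pb S U)).π₁
  π₂ : (T.a' R S U).hom ≫ (comma pb (spanObj pb R S) U).π₁ ≫ (comma pb R S).π₂ =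
    (comma pb R (spanObj pb S U)).π₂ ≫ (comma pb S U).π₁
  π₃ : (T.a' R S U).hom ≫ (comma pb (spanObj pb R S) U).π₂ =
    (comma pb R (spanObj pb S U)).π₂ ≫ (comma pb S U).π₂
  κ₁ : Eq₂ ((T.a' R S U).hom ◁ (comma pb (spanObj pb R S) U).π₁ ◁ (comma pb R S).κ.hom)
    (comma pb R (spanObj pb S U)).κ.hom
  κ₂ : Eq₂ ((T.a' R S U).hom ◁ (comma pb (spanObj pb R S) U).κ.hom)
    ((comma pb R (spanObj pb S U)).π₂ ◁ (comma pb S U).κ.hom)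
  ϖ : IsIdentity (T.a' R S U).ϖ.hom
  ϱ : IsIdentity (T.a' R S U).ϱ.hom

/-- The left unitor at a span `R`: its component `R * I ⟶ R` is the projection, with an identity and
the inverse of the iso-comma 2-cell as its 2-cells; the component of the inverse is the map
`R ⟶ R * I` induced by the identity 2-cell; the unit is induced by the inverse of the iso-comma
2-cell. -/
structure IsSpanLeftUnitor (R : Span X Y) : Prop where
  hom : (T.l R).hom = (comma pb R (idSpan Y)).π₁
  hom_ϖ : IsIdentity (T.l R).ϖ.hom
  hom_ϱ : Eq₂ (T.l R).ϱ.hom (comma pb R (idSpan Y)).κ.inv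
  inv_π₁ : (T.l' R).hom ≫ (comma pb R (idSpan Y)).π₁ = 𝟙 R.pt
  inv_π₂ : (T.l' R).hom ≫ (comma pb R (idSpan Y)).π₂ = R.q
  inv_κ : IsIdentity ((T.l' R).hom ◁ (comma pb R (idSpan Y)).κ.hom)
  inv_ϖ : IsIdentity (T.l' R).ϖ.hom
  inv_ϱ : IsIdentity (T.l' R).ϱ.hom
  unit_π₁ : IsIdentity ((T.lUnit R).hom ▷ (comma pb R (idSpan Y)).π₁)
  unit_π₂ : Eq₂ ((T.lUnit R).hom ▷ (comma pb R (idSpan Y)).π₂)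
    (comma pb R (idSpan Y)).κ.inv

/-- The naturality 2-cell of the inverse left unitor at a map of spans. -/
structure IsSpanLeftUnitorInvNat {R R' : Span X Y} (f : R ⟶ R') : Prop where
  π₁ : IsIdentity ((T.lNat' f).hom ▷ (comma pb R' (idSpan Y)).π₁)
  π₂ : Eq₂ ((T.lNat' f).hom ▷ (comma pb R' (idSpan Y)).π₂) f.ϱ.inv

/-- The right unitor at a span `R`: its component `I * R ⟶ R` is the projection, with the
iso-comma 2-cell and an identity as its 2-cells; the component of the inverse is the map
`R ⟶ I * R` induced by the identity 2-cell; the unit is induced by the iso-comma 2-cell. -/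
structure IsSpanRightUnitor (R : Span X Y) : Prop where
  hom : (T.r R).hom = (comma pb (idSpan X) R).π₂
  hom_ϖ : Eq₂ (T.r R).ϖ.hom (comma pb (idSpan X) R).κ.hom
  hom_ϱ : IsIdentity (T.r R).ϱ.hom
  inv_π₁ : (T.r' R).hom ≫ (comma pb (idSpan X) R).π₁ = R.p
  inv_π₂ : (T.r' R).hom ≫ (comma pb (idSpan X) R).π₂ = 𝟙 R.pt
  inv_κ : IsIdentity ((T.r' R).hom ◁ (comma pb (idSpan X) R).κ.hom)
  inv_ϖ : IsIdentity (T.r' R).ϖ.hom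
  inv_ϱ : IsIdentity (T.r' R).ϱ.hom
  unit_π₁ : Eq₂ ((T.rUnit R).hom ▷ (comma pb (idSpan X) R).π₁)
    (comma pb (idSpan X) R).κ.hom
  unit_π₂ : IsIdentity ((T.rUnit R).hom ▷ (comma pb (idSpan X) R).π₂)

/-- The naturality 2-cell of the inverse right unitor at a map of spans. -/
structure IsSpanRightUnitorInvNat {R R' : Span X Y} (f : R ⟶ R') : Prop where
  π₁ : Eq₂ ((T.rNat' f).hom ▷ (comma pb (idSpan X) R').π₁) f.ϖ.inv
  π₂ : IsIdentity ((T.rNat' f).hom ▷ (comma pb (idSpan X) R').π₂)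

end Spec

end SpanTri

/-!
Maps and 2-cells into an iso-comma object are determined by their projections and, for 1-cells, by
the comma 2-cell; iterating this, 1-cells into an iterated composite of spans are determined by
their projections to the factors and the comma 2-cells between neighbouring factors
(`hom_ext_right`, `hom_ext_left`). The associator is the 1-cell that preserves all of these, so it
is invertible, natural on the nose (`assocMap_naturality`), and satisfies the pentagon as an
equation of maps of spans (`assocMap_pentagon`). The projections `l` and `r` are also natural on
the nose. Their inverses are sections of the projections, and are natural only up to the 2-cells
induced by the inverses of `ϱ_f` and `ϖ_f`.

The principle behind the coherence axioms is `IsoComma.isIdentity`: a 2-cell into an iso-comma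
object whose projections are both identities is itself an identity. Strict transformations are
determined by their components (`IsStrict.ext`), so the pentagonator, `Λ` and `P` come from
equations between maps of spans. The source of `M` involves the non-strict transformation `r⁻¹`, but
its naturality 2-cells are identities after both outer projections, and only these projections
survive contracting the middle unit (`contractMap_isIdentity`); hence this composite is strict as
well, and in fact the identity. The same observation shows that the mate of `M` entering the
normalisation conditions is an identity (`midMate_isIdentity`), although the unit of `r` is not.
All 2-cells pasted together in the three tricategory axioms are then identities, and two parallel
identities agree.

As boundaries of 2-cells often agree only propositionally, 2-cells are compared with `Eq₂`, and
`IsIdentity` expresses that a 2-cell is an `eqToHom`.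
-/

namespace SpanTri

/-! ### Identity 2-cells -/

namespace IsIdentity

section Category

variable {C : Type u} [Category.{v} C] {X Y Z : C}

theorem eqToHom (h : X = Y) : IsIdentity (CategoryTheory.eqToHom h) := ⟨h, rfl⟩

theorem id (X : C) : IsIdentity (𝟙 X) := ⟨rfl, rfl⟩

theorem comp {e : X ⟶ Y} {e' : Y ⟶ Z} (h : IsIdentity e) (h' : IsIdentity e') :
    IsIdentity (e ≫ e') := by
  obtain ⟨rfl, rfl⟩ := h
  obtain ⟨rfl, rfl⟩ := h'
  exact ⟨rfl, by simp⟩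

theorem eq {e e' : X ⟶ Y} (h : IsIdentity e) (h' : IsIdentity e') : e = e' := by
  obtain ⟨_, rfl⟩ := h
  obtain ⟨_, rfl⟩ := h'
  rfl

theorem inv {e : X ≅ Y} (h : IsIdentity e.hom) : IsIdentity e.inv := by
  obtain ⟨rfl, h⟩ := h
  refine ⟨rfl, ?_⟩
  rw [← cancel_epi e.hom, e.hom_inv_id, h]
  simp

end Category

section Bicategory

variable {B : Type u} [Bicategory.{w, v} B] {X Y Z : B} {f g f' g' : X ⟶ Y}

theorem whiskerLeft {α : f ⟶ g} (h : IsIdentity α) (k : Z ⟶ X) : IsIdentity (k ◁ α) := by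
  obtain ⟨rfl, rfl⟩ := h
  exact ⟨rfl, by simp⟩

theorem whiskerRight {α : f ⟶ g} (h : IsIdentity α) (k : Y ⟶ Z) : IsIdentity (α ▷ k) := by
  obtain ⟨rfl, rfl⟩ := h
  exact ⟨rfl, by simp⟩

theorem of_eq₂ {α : f ⟶ g} {β : f' ⟶ g'} (e : Eq₂ α β) (h : IsIdentity β) : IsIdentity α := by
  obtain ⟨rfl, rfl, rfl⟩ := e
  simpa using h

theorem eq₂ {α : f ⟶ g} {β : f' ⟶ g'} (h : IsIdentity α) (h' : IsIdentity β) (e : f = f') :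
    Eq₂ α β := by
  obtain ⟨rfl, rfl⟩ := h
  obtain ⟨rfl, rfl⟩ := h'
  exact Eq₂.eqToHom_eqToHom _ _ e

theorem eq₂' {α : f ⟶ g} {β : f' ⟶ g'} (h : IsIdentity α) (h' : IsIdentity β) (e : g = g') :
    Eq₂ α β := by
  obtain ⟨rfl, rfl⟩ := h
  obtain ⟨rfl, rfl⟩ := h'
  exact Eq₂.eqToHom_eqToHom _ _ e

variable [Strict B] {W : B}

theorem associator (f : X ⟶ Y) (g : Y ⟶ Z) (h : Z ⟶ W) : IsIdentity (α_ f g h).hom := by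
  rw [Strict.associator_eqToIso]
  exact eqToHom (Strict.assoc f g h)

theorem associator_inv (f : X ⟶ Y) (g : Y ⟶ Z) (h : Z ⟶ W) : IsIdentity (α_ f g h).inv :=
  inv (associator f g h)

theorem leftUnitor (f : X ⟶ Y) : IsIdentity (λ_ f).hom := by
  rw [Strict.leftUnitor_eqToIso]
  exact eqToHom (Strict.id_comp f)

theorem leftUnitor_inv (f : X ⟶ Y) : IsIdentity (λ_ f).inv := inv (leftUnitor f)

theorem rightUnitor (f : X ⟶ Y) : IsIdentity (ρ_ f).hom := by
  rw [Strict.rightUnitor_eqToIso]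
  exact eqToHom (Strict.comp_id f)

theorem rightUnitor_inv (f : X ⟶ Y) : IsIdentity (ρ_ f).inv := inv (rightUnitor f)

end Bicategory

section Strict

open TriBase

variable {B : Type u₁} [Bicategory.{w₁, v₁} B] [Strict B] {X Y : B} {f g g' h : X ⟶ Y}

theorem comp₂ {α : f ⟶ g} {β : g' ⟶ h} (hα : IsIdentity α) (hβ : IsIdentity β) (e : g = g') :
    IsIdentity (comp₂ α β e) :=
  hα.comp ((eqToHom e).comp hβ)

theorem cast₂ {f' : X ⟶ Y} {α : f ⟶ g} (hα : IsIdentity α) (e : f' = f) (e' : g = g') :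
    IsIdentity (cast₂ α e e') :=
  (eqToHom e).comp (hα.comp (eqToHom e'))

end Strict

end IsIdentity

namespace Eq₂

variable {B : Type u} [Bicategory.{w, v} B] {X Y : B} {f g h f' g' : X ⟶ Y}

theorem id_comp' {α : f ⟶ g} {β : g ⟶ h} (i : IsIdentity α) : Eq₂ (α ≫ β) β := by
  obtain ⟨rfl, rfl⟩ := i
  exact eqToHom_comp _ _

theorem comp_id' {α : f ⟶ g} {β : g ⟶ h} (i : IsIdentity β) : Eq₂ (α ≫ β) α := by
  obtain ⟨rfl, rfl⟩ := i
  exact comp_eqToHom _ _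

end Eq₂

/-! ### Detecting identities through an iso-comma object -/

section

variable {B : Type u} [Bicategory.{w, v} B] [Strict B] {X Y Z W : B}

/-- A 2-cell into an iso-comma object whose two projections are identities is itself an identity:
naturality of `κ` forces the two 1-cells to agree on `κ`, hence to be equal. -/
theorem IsoComma.isIdentity {f : X ⟶ Z} {g : Y ⟶ Z} (K : IsoComma f g) {j k : W ⟶ K.pt}
    {γ : j ⟶ k} (h₁ : IsIdentity (γ ▷ K.π₁)) (h₂ : IsIdentity (γ ▷ K.π₂)) : IsIdentity γ := by
  have hγ := whisker_exchange γ K.κ.hom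
  have i₁ : IsIdentity (γ ▷ (K.π₁ ≫ f)) :=
    .of_eq₂ (Eq₂.whiskerRight_comp _ _ _) (h₁.whiskerRight f)
  have i₂ : IsIdentity (γ ▷ (K.π₂ ≫ g)) :=
    .of_eq₂ (Eq₂.whiskerRight_comp _ _ _) (h₂.whiskerRight g)
  have e : j = k := K.hom_ext h₁.choose h₂.choose
    ((Eq₂.comp_id' i₂).symm.trans ((Eq₂.of_eq hγ).trans (Eq₂.id_comp' i₁)))
  subst e
  refine .of_eq₂ (Eq₂.of_eq (K.hom_ext₂' ?_ ?_)) (.id j)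
  · exact h₁.eq (.of_eq₂ (.of_eq (id_whiskerRight _ _)) (.id _))
  · exact h₂.eq (.of_eq₂ (.of_eq (id_whiskerRight _ _)) (.id _))

/-- A map of maps of spans is an identity if its underlying 2-cell is. -/
theorem Span.isIdentity {R S : Span X Y} {f g : R ⟶ S} {γ : f ⟶ g} (h : IsIdentity γ.hom) :
    IsIdentity γ := by
  have e : f = g := SpanMap.hom_ext h.choose
    ((Eq₂.comp_id' (h.whiskerRight _)).symm.trans (Eq₂.of_eq γ.w_p))
    ((Eq₂.comp_id' (h.whiskerRight _)).symm.trans (Eq₂.of_eq γ.w_q))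
  subst e
  exact ⟨rfl, Span.hom₂_ext (h.eq (.id _))⟩

theorem Span.isIdentity_hom {R S : Span X Y} {f g : R ⟶ S} {γ : f ⟶ g} (h : IsIdentity γ) :
    IsIdentity γ.hom := by
  obtain ⟨rfl, rfl⟩ := h
  exact ⟨rfl, rfl⟩

theorem Span.eq₂_hom {R S : Span X Y} {f g f' g' : R ⟶ S} {γ : f ⟶ g} {δ : f' ⟶ g'}
    (h : Eq₂ γ δ) : Eq₂ γ.hom δ.hom := by
  obtain ⟨rfl, rfl, h⟩ := h
  exact Eq₂.of_eq (by rw [show γ = δ by simpa using h])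

end

/-! ### Strict transformations between 2-functors -/

section Transformations

open TwoFunctor

variable {A : Type u₁} [Bicategory.{w₁, v₁} A] {B : Type u₂} [Bicategory.{w₂, v₂} B]
  {C : Type u₃} [Bicategory.{w₃, v₃} C]

theorem IsIdentity.map₂ (F : TwoFunctor A B) {X Y : A} {f g : X ⟶ Y} {α : f ⟶ g}
    (h : IsIdentity α) : IsIdentity (F.map₂ α) := by
  obtain ⟨rfl, rfl⟩ := h
  exact ⟨rfl, by simp⟩

theorem IsIdentity.prod {X Y : A × B} {f g : X ⟶ Y} {α : f ⟶ g} (h₁ : IsIdentity α.1)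
    (h₂ : IsIdentity α.2) : IsIdentity α := by
  obtain ⟨f₁, f₂⟩ := f
  obtain ⟨g₁, g₂⟩ := g
  obtain ⟨α₁, α₂⟩ := α
  obtain ⟨h, rfl⟩ := h₁
  obtain ⟨h', rfl⟩ := h₂
  dsimp at h h'
  subst h h'
  exact ⟨rfl, rfl⟩

variable [Strict A] [Strict B] [Strict C]

/-- A strong transformation between 2-functors, from components and naturality 2-cells; the
conditions on identities and composites only have to be checked up to a change of boundary. -/
def mkTrans {F G : TwoFunctor A B} (app : ∀ X, F.obj X ⟶ G.obj X)
    (nat : ∀ {X Y : A} (f : X ⟶ Y), F.map f ≫ app Y ≅ app X ≫ G.map f)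
    (nat₂ : ∀ {X Y : A} {f g : X ⟶ Y} (θ : f ⟶ g),
      F.map₂ θ ▷ app Y ≫ (nat g).hom = (nat f).hom ≫ app X ◁ G.map₂ θ)
    (nat_id : ∀ X, IsIdentity (nat (𝟙 X)).hom)
    (nat_comp : ∀ {X Y Z : A} (f : X ⟶ Y) (g : Y ⟶ Z), Eq₂ (nat (f ≫ g)).hom
      ((α_ _ _ _).hom ≫ F.map f ◁ (nat g).hom ≫ (α_ _ _ _).inv ≫ (nat f).hom ▷ G.map g)) :
    F.toPs ⟶ G.toPs where
  app := app
  naturality := nat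
  naturality_naturality := nat₂
  naturality_id X := ((nat_id X).comp ((IsIdentity.eqToHom (G.map_id X)).whiskerLeft _)).eq
    (((IsIdentity.eqToHom (F.map_id X)).whiskerRight _).comp
      ((IsIdentity.leftUnitor _).comp (IsIdentity.rightUnitor_inv _)))
  naturality_comp f g := by
    have h := (Eq₂.comp_id' ((IsIdentity.eqToHom (G.map_comp f g)).whiskerLeft _)).trans
      ((nat_comp f g).trans ((Eq₂.id_comp' ((IsIdentity.eqToHom
        (F.map_comp f g)).whiskerRight _)).trans (Eq₂.comp_id' (β := (α_ _ _ _).hom)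
          (IsIdentity.associator _ _ _))).symm)
    simpa using h.eq

/-- The strict transformation between 2-functors with given components. -/
def mkStrict {F G : TwoFunctor A B} (app : ∀ X, F.obj X ⟶ G.obj X)
    (nat : ∀ {X Y : A} (f : X ⟶ Y), F.map f ≫ app Y = app X ≫ G.map f)
    (nat₂ : ∀ {X Y : A} {f g : X ⟶ Y} (θ : f ⟶ g),
      Eq₂ (F.map₂ θ ▷ app Y) (app X ◁ G.map₂ θ)) : F.toPs ⟶ G.toPs :=
  mkTrans app (fun f => eqToIso (nat f))
    (fun {_ _ f g} θ => ((Eq₂.comp_eqToHom _ (nat g)).trans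
      ((nat₂ θ).trans (Eq₂.eqToHom_comp (nat f) _).symm)).eq)
    (fun X => IsIdentity.eqToHom (nat (𝟙 X)))
    (fun f g => (IsIdentity.eqToHom (nat (f ≫ g))).eq₂ ((IsIdentity.associator _ _ _).comp
      (((IsIdentity.eqToHom (nat g)).whiskerLeft _).comp ((IsIdentity.associator_inv _ _ _).comp
        ((IsIdentity.eqToHom (nat f)).whiskerRight _)))) (by rw [F.map_comp]))

namespace IsStrict

/-- A strict transformation is determined by its components. -/
theorem ext {F G : TwoFunctor A B} {η θ : F.toPs ⟶ G.toPs} (hη : IsStrict η) (hθ : IsStrict θ)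
    (h : ∀ X, η.app X = θ.app X) : η = θ := by
  obtain ⟨a, n, _, _, _⟩ := η
  obtain ⟨a', n', _, _, _⟩ := θ
  obtain rfl : a = a' := funext h
  congr
  funext X Y f
  ext
  exact (hη f).eq (hθ f)

theorem id (F : TwoFunctor A B) : IsStrict (𝟙 F.toPs) := fun f =>
  (IsIdentity.rightUnitor (F.map f)).comp (IsIdentity.leftUnitor_inv (F.map f))

theorem comp_naturality {F G H : TwoFunctor A B} (η : F.toPs ⟶ G.toPs) (θ : G.toPs ⟶ H.toPs)
    {X Y : A} (f : X ⟶ Y) : ((η ≫ θ).naturality f).hom =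
      (α_ _ _ _).inv ≫ (η.naturality f).hom ▷ θ.app Y ≫ (α_ _ _ _).hom ≫
        η.app X ◁ (θ.naturality f).hom ≫ (α_ _ _ _).inv := by
  exact Pseudofunctor.StrongTrans.categoryStruct_comp_naturality_hom _ _ _

theorem comp_naturality_left {F G H : TwoFunctor A B} {η : F.toPs ⟶ G.toPs} (hη : IsStrict η)
    (θ : G.toPs ⟶ H.toPs) {X Y : A} (f : X ⟶ Y) :
    Eq₂ ((η ≫ θ).naturality f).hom (η.app X ◁ (θ.naturality f).hom) := by
  rw [comp_naturality]
  exact (Eq₂.assoc_inv_comp _).trans ((Eq₂.id_comp' ((hη f).whiskerRight _)).trans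
    ((Eq₂.assoc_hom_comp _).trans (Eq₂.comp_assoc_inv _)))

theorem comp_naturality_right {F G H : TwoFunctor A B} (η : F.toPs ⟶ G.toPs)
    {θ : G.toPs ⟶ H.toPs} (hθ : IsStrict θ) {X Y : A} (f : X ⟶ Y) :
    Eq₂ ((η ≫ θ).naturality f).hom ((η.naturality f).hom ▷ θ.app Y) := by
  rw [comp_naturality]
  exact (Eq₂.assoc_inv_comp _).trans (Eq₂.comp_id' ((IsIdentity.associator _ _ _).comp
    (((hθ f).whiskerLeft _).comp (IsIdentity.associator_inv _ _ _))))

theorem comp {F G H : TwoFunctor A B} {η : F.toPs ⟶ G.toPs} {θ : G.toPs ⟶ H.toPs}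
    (hη : IsStrict η) (hθ : IsStrict θ) : IsStrict (η ≫ θ) := fun f => by
  exact .of_eq₂ (comp_naturality_left hη θ f) ((hθ f).whiskerLeft _)

theorem whiskerL (F : TwoFunctor A B) {G H : TwoFunctor B C} {η : G.toPs ⟶ H.toPs}
    (h : IsStrict η) : IsStrict (TwoFunctor.whiskerL F η) := fun f => h (F.map f)

theorem whiskerR_naturality {F G : TwoFunctor A B} (η : F.toPs ⟶ G.toPs) (K : TwoFunctor B C)
    {X Y : A} (f : X ⟶ Y) : Eq₂ ((TwoFunctor.whiskerR η K).naturality f).hom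
      (K.map₂ (η.naturality f).hom) :=
  Eq₂.conj (K.map_comp _ _).symm _ (K.map_comp _ _)

theorem whiskerR {F G : TwoFunctor A B} {η : F.toPs ⟶ G.toPs} (h : IsStrict η)
    (K : TwoFunctor B C) : IsStrict (TwoFunctor.whiskerR η K) := fun f =>
  .of_eq₂ (whiskerR_naturality η K f) ((h f).map₂ K)

theorem pairT {F F' : TwoFunctor A B} {G G' : TwoFunctor A C} {η : F.toPs ⟶ F'.toPs}
    {θ : G.toPs ⟶ G'.toPs} (hη : IsStrict η) (hθ : IsStrict θ) :
    IsStrict (TwoFunctor.pairT η θ) := fun f => IsIdentity.prod (hη f) (hθ f)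

end IsStrict

theorem isIdentity_as_app {F G : TwoFunctor A B} {η θ : F.toPs ⟶ G.toPs} {Γ : η ⟶ θ}
    (h : IsIdentity Γ) (X : A) : IsIdentity (Γ.as.app X) := by
  obtain ⟨rfl, rfl⟩ := h
  exact ⟨rfl, rfl⟩

/-- An adjoint equivalence between 2-functors. As the hom-2-categories are strict, the triangle
identity says that its left-hand side is an identity at each component. -/
def mkEquivalence {F G : TwoFunctor A B} (η : F.toPs ⟶ G.toPs) (θ : G.toPs ⟶ F.toPs)
    (unit : 𝟙 F.toPs ≅ η ≫ θ) (counit : θ ≫ η ≅ 𝟙 G.toPs)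
    (h : ∀ X, IsIdentity (unit.hom.as.app X ▷ η.app X ≫
      (α_ (η.app X) (θ.app X) (η.app X)).hom ≫ η.app X ◁ counit.hom.as.app X)) :
    Bicategory.Equivalence F.toPs G.toPs where
  hom := η
  inv := θ
  unit := unit
  counit := counit
  left_triangle := by
    have e : leftZigzag unit.hom counit.hom =
        unit.hom ▷ η ≫ (α_ η θ η).hom ≫ η ◁ counit.hom := by
      simp [leftZigzag, bicategoricalComp]
    refine Iso.ext (e.trans ?_)
    ext X
    exact (h X).eq ((IsIdentity.leftUnitor (η.app X)).comp (IsIdentity.rightUnitor_inv (η.app X)))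

/-- Mutually inverse strict transformations form an adjoint equivalence with identity unit and
counit. -/
def strictEquivalence {F G : TwoFunctor A B} (η : F.toPs ⟶ G.toPs) (θ : G.toPs ⟶ F.toPs)
    (h : 𝟙 F.toPs = η ≫ θ) (h' : θ ≫ η = 𝟙 G.toPs) : Bicategory.Equivalence F.toPs G.toPs :=
  mkEquivalence η θ (eqToIso h) (eqToIso h') fun X =>
    ((isIdentity_as_app (IsIdentity.eqToHom h) X).whiskerRight _).comp
      ((IsIdentity.associator _ _ _).comp
        ((isIdentity_as_app (IsIdentity.eqToHom h') X).whiskerLeft _))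

theorem isStrictEquivalence_strictEquivalence {F G : TwoFunctor A B} {η : F.toPs ⟶ G.toPs}
    {θ : G.toPs ⟶ F.toPs} (hη : IsStrict η) (hθ : IsStrict θ) (h : 𝟙 F.toPs = η ≫ θ)
    (h' : θ ≫ η = 𝟙 G.toPs) : IsStrictEquivalence (strictEquivalence η θ h h') :=
  ⟨hη, hθ, .eqToHom h, .eqToHom h'⟩

end Transformations

/-! ### The tricategory axioms when all constraint 3-cells are identities -/

section Axioms

open TriBase TriAdj

variable {Obj : Type u₀} {H : TriBase.{w, v, u} Obj} {A B C D E F : Obj}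

theorem IsIdentity.tMap₂ {R R' : H.Hom A B} {S S' : H.Hom B C} {α α' : R ⟶ R'} {β β' : S ⟶ S'}
    {x : α ⟶ α'} {y : β ⟶ β'} (hx : IsIdentity x) (hy : IsIdentity y) :
    IsIdentity (tMap₂ x y) := by
  obtain ⟨rfl, rfl⟩ := hx
  obtain ⟨rfl, rfl⟩ := hy
  exact ⟨rfl, (H.comp A B C).map₂_id _⟩

namespace TriData

variable (T : TriData H)

/-- If the pentagonator and the naturality 2-cells of the associator are identities, then both
pasting composites of the cocycle condition consist of identities only. -/
theorem cocycle_of_isIdentity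
    (hπ : ∀ {A B C D E : Obj} (R : H.Hom A B) (S : H.Hom B C) (U : H.Hom C D) (V : H.Hom D E),
      IsIdentity (T.pi R S U V))
    (ha : ∀ {A B C D : Obj} {R R' : H.Hom A B} {S S' : H.Hom B C} {U U' : H.Hom C D}
      (α : R ⟶ R') (β : S ⟶ S') (γ : U ⟶ U'), IsIdentity (T.aNat α β γ).hom)
    (R : H.Hom A B) (S : H.Hom B C) (U : H.Hom C D) (V : H.Hom D E) (W : H.Hom E F) :
    T.cocycleLeft R S U V W = T.cocycleRight R S U V W := by
  refine IsIdentity.eq (.cast₂ (.comp₂ ?_ (.comp₂ ?_ (.comp₂ ?_ ?_ _) _) _) _ _)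
    (.cast₂ (.comp₂ ?_ (.comp₂ ?_ (.comp₂ ?_ (.comp₂ ?_ ?_ _) _) _) _) _ _)
  · exact .whiskerRight (.tMap₂ (hπ _ _ _ _) (.id _)) _
  · exact .whiskerLeft (.whiskerRight (hπ _ _ _ _) _) _
  · exact .whiskerLeft (.inv (ha _ _ _)) _
  · exact .whiskerRight (hπ _ _ _ _) _
  · exact .whiskerLeft (.whiskerRight (ha _ _ _) _) _
  · exact .whiskerLeft (.tMap₂ (.id _) (hπ _ _ _ _)) _
  · exact .whiskerLeft (.whiskerRight (hπ _ _ _ _) _) _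
  · exact .whiskerRight (ha _ _ _) _
  · exact .whiskerLeft (hπ _ _ _ _) _

/-- The left normalisation condition only involves the mate of `M`, not `M` itself: the unit of the
right unitor need not be an identity. -/
theorem norm₁_of_isIdentity
    (hπ : ∀ {A B C D E : Obj} (R : H.Hom A B) (S : H.Hom B C) (U : H.Hom C D) (V : H.Hom D E),
      IsIdentity (T.pi R S U V))
    (ha : ∀ {A B C D : Obj} {R R' : H.Hom A B} {S S' : H.Hom B C} {U U' : H.Hom C D}
      (α : R ⟶ R') (β : S ⟶ S') (γ : U ⟶ U'), IsIdentity (T.aNat α β γ).hom)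
    (hμ : ∀ {A B C : Obj} (R : H.Hom A B) (S : H.Hom B C), IsIdentity (T.midMate R S))
    (hρ : ∀ {A B C : Obj} (R : H.Hom A B) (S : H.Hom B C),
      IsIdentity (T.rho R S)) (R : H.Hom A B) (S : H.Hom B C) (U : H.Hom C D) :
    T.normLeft₁ R S U = T.normRight₁ R S U := by
  refine IsIdentity.eq (.cast₂ (.comp₂ ?_ ?_ _) _ _)
    (.cast₂ (.comp₂ ?_ (.comp₂ ?_ (.comp₂ ?_ ?_ _) _) _) _ _)
  · exact .whiskerLeft (.inv (ha _ _ _)) _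
  · exact .whiskerRight (.tMap₂ (hμ _ _) (.id _)) _
  · exact .whiskerLeft (.tMap₂ (.id _) (hρ _ _)) _
  · exact .whiskerRight (hπ _ _ _ _) _
  · exact .whiskerLeft (hμ _ _) _
  · exact .inv (ha _ _ _)

theorem norm₂_of_isIdentity
    (hπ : ∀ {A B C D E : Obj} (R : H.Hom A B) (S : H.Hom B C) (U : H.Hom C D) (V : H.Hom D E),
      IsIdentity (T.pi R S U V))
    (ha : ∀ {A B C D : Obj} {R R' : H.Hom A B} {S S' : H.Hom B C} {U U' : H.Hom C D}
      (α : R ⟶ R') (β : S ⟶ S') (γ : U ⟶ U'), IsIdentity (T.aNat α β γ).hom)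
    (hμ : ∀ {A B C : Obj} (R : H.Hom A B) (S : H.Hom B C), IsIdentity (T.midMate R S))
    (hl : ∀ {A B C : Obj} (R : H.Hom A B) (S : H.Hom B C),
      IsIdentity (T.lamMate R S)) (R : H.Hom A B) (S : H.Hom B C) (U : H.Hom C D) :
    T.normLeft₂ R S U = T.normRight₂ R S U := by
  refine IsIdentity.eq (.cast₂ (.comp₂ ?_ (.comp₂ ?_ ?_ _) _) _ _)
    (.cast₂ (.comp₂ ?_ (.comp₂ ?_ ?_ _) _) _ _)
  · exact .whiskerLeft (.tMap₂ (.id _) (hμ _ _)) _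
  · exact .whiskerLeft (.inv (ha _ _ _)) _
  · exact .whiskerRight (.tMap₂ (hl _ _) (.id _)) _
  · exact .whiskerRight (hπ _ _ _ _) _
  · exact .whiskerLeft (.inv (ha _ _ _)) _
  · exact .whiskerRight (hμ _ _) _

end TriData
end Axioms

/-! ### Calculus of whiskered 2-cells up to a change of boundary -/

namespace Eq₂

variable {B : Type u} [Bicategory.{w, v} B] {V W X Y Z Z' : B}

instance {f g f' g' f'' g'' : X ⟶ Y} :
    Trans (Eq₂ (f := f) (g := g) (f' := f') (g' := g'))
      (Eq₂ (f := f') (g := g') (f' := f'') (g' := g''))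
      (Eq₂ (f := f) (g := g) (f' := f'') (g' := g'')) := ⟨Eq₂.trans⟩

variable [Strict B] {f g f' g' : X ⟶ Y}

theorem whiskerLeft_comp_eq {k : W ⟶ Z} {l : Z ⟶ X} {m : W ⟶ X} (h : k ≫ l = m) (α : f ⟶ g) :
    Eq₂ (k ◁ l ◁ α) (m ◁ α) :=
  (comp_whiskerLeft l k α).symm.trans (whiskerLeft h (refl α))

theorem whiskerLeft_comp_congr {k : W ⟶ Z} {l : Z ⟶ X} {k' : W ⟶ Z'} {l' : Z' ⟶ X}
    (h : k ≫ l = k' ≫ l') (α : f ⟶ g) : Eq₂ (k ◁ l ◁ α) (k' ◁ l' ◁ α) :=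
  (whiskerLeft_comp_eq h α).trans (comp_whiskerLeft l' k' α)

theorem whiskerRight_comp_eq {k : Y ⟶ Z} {l : Z ⟶ W} {m : Y ⟶ W} (h : k ≫ l = m) (α : f ⟶ g) :
    Eq₂ (α ▷ k ▷ l) (α ▷ m) :=
  (whiskerRight_comp k l α).symm.trans (whiskerRight h (refl α))

theorem whiskerRight_comp_congr {k : Y ⟶ Z} {l : Z ⟶ W} {k' : Y ⟶ Z'} {l' : Z' ⟶ W}
    (h : k ≫ l = k' ≫ l') (α : f ⟶ g) : Eq₂ (α ▷ k ▷ l) (α ▷ k' ▷ l') :=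
  (whiskerRight_comp_eq h α).trans (whiskerRight_comp k' l' α)

end Eq₂

/-- If the components of a strict transformation are isomorphisms, then their inverses are
strictly natural as well. -/
theorem inverse_naturality {A : Type u₁} [Bicategory.{w₁, v₁} A] {B : Type u₂}
    [Bicategory.{w₂, v₂} B] [Strict A] [Strict B] {F G : TwoFunctor A B} (η : F.toPs ⟶ G.toPs)
    (hη : IsStrict η) (inv : ∀ X, G.obj X ⟶ F.obj X) (h : ∀ X, η.app X ≫ inv X = 𝟙 (F.obj X))
    (h' : ∀ X, inv X ≫ η.app X = 𝟙 (G.obj X)) {X Y : A} (f : X ⟶ Y) :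
    G.map f ≫ inv Y = inv X ≫ F.map f := by
  have e : F.map f ≫ η.app Y = η.app X ≫ G.map f := (hη f).choose
  calc
    G.map f ≫ inv Y = (inv X ≫ η.app X) ≫ G.map f ≫ inv Y := by rw [h', Strict.id_comp]
    _ = inv X ≫ (η.app X ≫ G.map f) ≫ inv Y := by simp only [Strict.assoc]
    _ = inv X ≫ F.map f ≫ η.app Y ≫ inv Y := by rw [← e, Strict.assoc]
    _ = inv X ≫ F.map f := by rw [h, Strict.comp_id]

theorem inverse_naturality₂ {A : Type u₁} [Bicategory.{w₁, v₁} A] {B : Type u₂}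
    [Bicategory.{w₂, v₂} B] [Strict A] [Strict B] {F G : TwoFunctor A B} (η : F.toPs ⟶ G.toPs)
    (hη : IsStrict η) (inv : ∀ X, G.obj X ⟶ F.obj X) (h : ∀ X, η.app X ≫ inv X = 𝟙 (F.obj X))
    (h' : ∀ X, inv X ≫ η.app X = 𝟙 (G.obj X)) {X Y : A} {f g : X ⟶ Y} (θ : f ⟶ g) :
    Eq₂ (G.map₂ θ ▷ inv Y) (inv X ◁ F.map₂ θ) := by
  have e : Eq₂ (F.map₂ θ ▷ η.app Y) (η.app X ◁ G.map₂ θ) :=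
    (Eq₂.comp_id' (hη g)).symm.trans ((Eq₂.of_eq (η.naturality_naturality θ)).trans
      (Eq₂.id_comp' (hη f)))
  calc
    Eq₂ (G.map₂ θ ▷ inv Y) (inv X ◁ η.app X ◁ G.map₂ θ ▷ inv Y) :=
      ((Eq₂.whiskerLeft_comp_eq (h' X) _).trans (Eq₂.id_whiskerLeft _)).symm
    Eq₂ _ (inv X ◁ (η.app X ◁ G.map₂ θ) ▷ inv Y) :=
      Eq₂.whiskerLeft rfl (Eq₂.whisker_assoc _ _ _).symm
    Eq₂ _ (inv X ◁ F.map₂ θ ▷ η.app Y ▷ inv Y) :=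
      Eq₂.whiskerLeft rfl (Eq₂.whiskerRight rfl e.symm)
    Eq₂ _ (inv X ◁ F.map₂ θ) := Eq₂.whiskerLeft rfl
      ((Eq₂.whiskerRight_comp_eq (h Y) _).trans (Eq₂.whiskerRight_id _))

/-! ### Maps into iterated iso-comma objects -/

section

variable {B : Type u} [Bicategory.{w, v} B] {X Y Z W : B}

/-- The 1-cell into an iso-comma object induced by an invertible 2-cell whose boundary is only
propositionally equal to the one required. -/
noncomputable def IsoComma.liftOf {f : X ⟶ Z} {g : Y ⟶ Z} (K : IsoComma f g) (p : W ⟶ X)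
    (q : W ⟶ Y) {s t : W ⟶ Z} (k : s ≅ t) (hs : p ≫ f = s) (ht : q ≫ g = t) : W ⟶ K.pt :=
  K.lift p q (eqToIso hs ≪≫ k ≪≫ eqToIso ht.symm)

section

variable {f : X ⟶ Z} {g : Y ⟶ Z} (K : IsoComma f g) (p : W ⟶ X) (q : W ⟶ Y) {s t : W ⟶ Z}
  (k : s ≅ t) (hs : p ≫ f = s) (ht : q ≫ g = t)

theorem IsoComma.liftOf_π₁ : K.liftOf p q k hs ht ≫ K.π₁ = p := K.lift_π₁ _ _ _

theorem IsoComma.liftOf_π₂ : K.liftOf p q k hs ht ≫ K.π₂ = q := K.lift_π₂ _ _ _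

theorem IsoComma.liftOf_κ : Eq₂ (K.liftOf p q k hs ht ◁ K.κ.hom) k.hom :=
  (K.lift_κ _ _ _).trans (Eq₂.conj hs k.hom ht.symm)

end

/-- The map of spans with identity 2-cells given by a 1-cell that commutes with the legs. -/
def SpanMap.ofEq {R S : Span X Y} (h : R.pt ⟶ S.pt) (hp : h ≫ S.p = R.p) (hq : h ≫ S.q = R.q) :
    SpanMap R S where
  hom := h
  ϖ := eqToIso hp.symm
  ϱ := eqToIso hq.symm

theorem SpanMap.ofEq_ϖ {R S : Span X Y} (h : R.pt ⟶ S.pt) (hp : h ≫ S.p = R.p)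
    (hq : h ≫ S.q = R.q) : IsIdentity (SpanMap.ofEq h hp hq).ϖ.hom := .eqToHom hp.symm

theorem SpanMap.ofEq_ϱ {R S : Span X Y} (h : R.pt ⟶ S.pt) (hp : h ≫ S.p = R.p)
    (hq : h ≫ S.q = R.q) : IsIdentity (SpanMap.ofEq h hp hq).ϱ.hom := .eqToHom hq.symm

variable [Strict B]

section

variable {R R' : Span X Y} {S S' : Span Y Z} (K : IsoComma R.q S.p) (K' : IsoComma R'.q S'.p)

theorem compHom_κ_eq₂ (f : SpanMap R R') (g : SpanMap S S') :
    Eq₂ (compHom K K' f g ◁ K'.κ.hom)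
      (K.π₁ ◁ f.ϱ.inv ≫ K.κ.hom ≫ K.π₂ ◁ g.ϖ.hom) := by
  refine (compHom_κ K K' f g).trans ?_
  refine (Eq₂.assoc_hom_comp _).trans (Eq₂.comp (.refl _) (Eq₂.comp (.refl _) ?_))
  exact Eq₂.comp_assoc_inv _

/-- The comma 2-cell of a composite of maps, when the second map has an identity left 2-cell. -/
theorem compHom_κ_left (f : SpanMap R R') (g : SpanMap S S') (hg : IsIdentity g.ϖ.hom) :
    Eq₂ (compHom K K' f g ◁ K'.κ.hom) (K.π₁ ◁ f.ϱ.inv ≫ K.κ.hom) :=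
  (compHom_κ_eq₂ K K' f g).trans (Eq₂.comp (.refl _) (Eq₂.comp_id' (hg.whiskerLeft _)))

/-- The comma 2-cell of a composite of maps, when the first map has an identity right 2-cell. -/
theorem compHom_κ_right (f : SpanMap R R') (g : SpanMap S S') (hf : IsIdentity f.ϱ.hom) :
    Eq₂ (compHom K K' f g ◁ K'.κ.hom) (K.κ.hom ≫ K.π₂ ◁ g.ϖ.hom) :=
  (compHom_κ_eq₂ K K' f g).trans (Eq₂.id_comp' (hf.inv.whiskerLeft _))

theorem compHom_κ_id (f : SpanMap R R') (g : SpanMap S S') (hf : IsIdentity f.ϱ.hom)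
    (hg : IsIdentity g.ϖ.hom) : Eq₂ (compHom K K' f g ◁ K'.κ.hom) K.κ.hom :=
  (compHom_κ_left K K' f g hg).trans (Eq₂.id_comp' (hf.inv.whiskerLeft _))

end

end

/-! ### The associator of spans -/

section Associator

-- `K`, `L`, `M`, `N` are arbitrary iso-comma objects for `R * S`, `S * U`, `(R * S) * U` and
-- `R * (S * U)`.
variable {B : Type u} [Bicategory.{w, v} B] [Strict B] {V W X Y Z : B}
  {R : Span W X} {S : Span X Y} {U : Span Y Z}
  (K : IsoComma R.q S.p) (L : IsoComma S.q U.p)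
  (M : IsoComma (K.π₂ ≫ S.q) U.p) (N : IsoComma R.q (L.π₁ ≫ S.p))

/-- The 1-cell `(R * S) * U ⟶ S * U`. -/
noncomputable def assocMid : M.pt ⟶ L.pt :=
  L.liftOf (M.π₁ ≫ K.π₂) M.π₂ M.κ (Strict.assoc _ _ _) rfl

theorem assocMid_π₁ : assocMid K L M ≫ L.π₁ = M.π₁ ≫ K.π₂ := L.liftOf_π₁ _ _ _ _ _

theorem assocMid_π₂ : assocMid K L M ≫ L.π₂ = M.π₂ := L.liftOf_π₂ _ _ _ _ _

theorem assocMid_κ : Eq₂ (assocMid K L M ◁ L.κ.hom) M.κ.hom := L.liftOf_κ _ _ _ _ _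

/-- The 1-cell `(R * S) * U ⟶ R * (S * U)`. -/
noncomputable def assocHom : M.pt ⟶ N.pt :=
  N.liftOf (M.π₁ ≫ K.π₁) (assocMid K L M) (M.π₁ ◁ᵢ K.κ) (Strict.assoc _ _ _)
    (by rw [← Strict.assoc, assocMid_π₁, Strict.assoc])

theorem assocHom_π₁ : assocHom K L M N ≫ N.π₁ = M.π₁ ≫ K.π₁ := N.liftOf_π₁ _ _ _ _ _

theorem assocHom_π₂ : assocHom K L M N ≫ N.π₂ = assocMid K L M := N.liftOf_π₂ _ _ _ _ _

theorem assocHom_π₂_π₁ : assocHom K L M N ≫ N.π₂ ≫ L.π₁ = M.π₁ ≫ K.π₂ := by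
  rw [← Strict.assoc, assocHom_π₂, assocMid_π₁]

theorem assocHom_π₂_π₂ : assocHom K L M N ≫ N.π₂ ≫ L.π₂ = M.π₂ := by
  rw [← Strict.assoc, assocHom_π₂, assocMid_π₂]

theorem assocHom_κ : Eq₂ (assocHom K L M N ◁ N.κ.hom) (M.π₁ ◁ K.κ.hom) := N.liftOf_κ _ _ _ _ _

theorem assocHom_π₂_κ : Eq₂ (assocHom K L M N ◁ N.π₂ ◁ L.κ.hom) M.κ.hom :=
  (Eq₂.whiskerLeft_comp_eq (assocHom_π₂ K L M N) _).trans (assocMid_κ K L M)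

/-- The 1-cell `R * (S * U) ⟶ R * S`. -/
noncomputable def assocInvMid : N.pt ⟶ K.pt :=
  K.liftOf N.π₁ (N.π₂ ≫ L.π₁) N.κ rfl (Strict.assoc _ _ _)

theorem assocInvMid_π₁ : assocInvMid K L N ≫ K.π₁ = N.π₁ := K.liftOf_π₁ _ _ _ _ _

theorem assocInvMid_π₂ : assocInvMid K L N ≫ K.π₂ = N.π₂ ≫ L.π₁ := K.liftOf_π₂ _ _ _ _ _

theorem assocInvMid_κ : Eq₂ (assocInvMid K L N ◁ K.κ.hom) N.κ.hom := K.liftOf_κ _ _ _ _ _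

/-- The 1-cell `R * (S * U) ⟶ (R * S) * U`. -/
noncomputable def assocInv : N.pt ⟶ M.pt :=
  M.liftOf (assocInvMid K L N) (N.π₂ ≫ L.π₂) (N.π₂ ◁ᵢ L.κ)
    (by rw [← Strict.assoc, assocInvMid_π₂, Strict.assoc]) (Strict.assoc _ _ _)

theorem assocInv_π₁ : assocInv K L M N ≫ M.π₁ = assocInvMid K L N := M.liftOf_π₁ _ _ _ _ _

theorem assocInv_π₂ : assocInv K L M N ≫ M.π₂ = N.π₂ ≫ L.π₂ := M.liftOf_π₂ _ _ _ _ _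

theorem assocInv_π₁_π₁ : assocInv K L M N ≫ M.π₁ ≫ K.π₁ = N.π₁ := by
  rw [← Strict.assoc, assocInv_π₁, assocInvMid_π₁]

theorem assocInv_π₁_π₂ : assocInv K L M N ≫ M.π₁ ≫ K.π₂ = N.π₂ ≫ L.π₁ := by
  rw [← Strict.assoc, assocInv_π₁, assocInvMid_π₂]

theorem assocInv_κ : Eq₂ (assocInv K L M N ◁ M.κ.hom) (N.π₂ ◁ L.κ.hom) := M.liftOf_κ _ _ _ _ _

theorem assocInv_π₁_κ : Eq₂ (assocInv K L M N ◁ M.π₁ ◁ K.κ.hom) N.κ.hom :=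
  (Eq₂.whiskerLeft_comp_eq (assocInv_π₁ K L M N) _).trans (assocInvMid_κ K L N)

variable {K L M N}

/-- 1-cells into `R * (S * U)` are determined by three projections and two comma 2-cells. -/
theorem hom_ext_right {h k : V ⟶ N.pt} (e₁ : h ≫ N.π₁ = k ≫ N.π₁)
    (e₂ : h ≫ N.π₂ ≫ L.π₁ = k ≫ N.π₂ ≫ L.π₁) (e₃ : h ≫ N.π₂ ≫ L.π₂ = k ≫ N.π₂ ≫ L.π₂)
    (e : Eq₂ (h ◁ N.κ.hom) (k ◁ N.κ.hom))
    (e' : Eq₂ (h ◁ N.π₂ ◁ L.κ.hom) (k ◁ N.π₂ ◁ L.κ.hom)) : h = k := by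
  refine N.hom_ext e₁ (L.hom_ext ?_ ?_ ?_) e
  · rw [Strict.assoc, e₂, Strict.assoc]
  · rw [Strict.assoc, e₃, Strict.assoc]
  · exact (Eq₂.comp_whiskerLeft _ _ _).trans (e'.trans (Eq₂.comp_whiskerLeft _ _ _).symm)

/-- 1-cells into `(R * S) * U` are determined by three projections and two comma 2-cells. -/
theorem hom_ext_left {h k : V ⟶ M.pt} (e₁ : h ≫ M.π₁ ≫ K.π₁ = k ≫ M.π₁ ≫ K.π₁)
    (e₂ : h ≫ M.π₁ ≫ K.π₂ = k ≫ M.π₁ ≫ K.π₂) (e₃ : h ≫ M.π₂ = k ≫ M.π₂)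
    (e : Eq₂ (h ◁ M.π₁ ◁ K.κ.hom) (k ◁ M.π₁ ◁ K.κ.hom))
    (e' : Eq₂ (h ◁ M.κ.hom) (k ◁ M.κ.hom)) : h = k := by
  refine M.hom_ext (K.hom_ext ?_ ?_ ?_) e₃ e'
  · rw [Strict.assoc, e₁, Strict.assoc]
  · rw [Strict.assoc, e₂, Strict.assoc]
  · exact (Eq₂.comp_whiskerLeft _ _ _).trans (e.trans (Eq₂.comp_whiskerLeft _ _ _).symm)

/-- 2-cells into `R * (S * U)` are determined by three projections. -/
theorem hom_ext₂_right {j k j' k' : V ⟶ N.pt} {γ : j ⟶ k} {δ : j' ⟶ k'} (ej : j = j')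
    (ek : k = k') (e₁ : Eq₂ (γ ▷ N.π₁) (δ ▷ N.π₁)) (e₂ : Eq₂ (γ ▷ N.π₂ ▷ L.π₁) (δ ▷ N.π₂ ▷ L.π₁))
    (e₃ : Eq₂ (γ ▷ N.π₂ ▷ L.π₂) (δ ▷ N.π₂ ▷ L.π₂)) : Eq₂ γ δ :=
  N.hom_ext₂ ej ek e₁ (L.hom_ext₂ (by rw [ej]) (by rw [ek]) e₂ e₃)

variable (K L M N)

theorem assocHom_inv : assocHom K L M N ≫ assocInv K L M N = 𝟙 M.pt := by
  refine hom_ext_left (K := K) ?_ ?_ ?_ ?_ ?_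
  · rw [Strict.assoc, assocInv_π₁_π₁, assocHom_π₁, Strict.id_comp]
  · rw [Strict.assoc, assocInv_π₁_π₂, assocHom_π₂_π₁, Strict.id_comp]
  · rw [Strict.assoc, assocInv_π₂, assocHom_π₂_π₂, Strict.id_comp]
  · calc
      Eq₂ _ (assocHom K L M N ◁ assocInv K L M N ◁ M.π₁ ◁ K.κ.hom) := Eq₂.comp_whiskerLeft _ _ _
      Eq₂ _ (assocHom K L M N ◁ N.κ.hom) := Eq₂.whiskerLeft rfl (assocInv_π₁_κ K L M N)
      Eq₂ _ (M.π₁ ◁ K.κ.hom) := assocHom_κ K L M N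
      Eq₂ _ (𝟙 M.pt ◁ M.π₁ ◁ K.κ.hom) := (Eq₂.id_whiskerLeft _).symm
  · calc
      Eq₂ _ (assocHom K L M N ◁ assocInv K L M N ◁ M.κ.hom) := Eq₂.comp_whiskerLeft _ _ _
      Eq₂ _ (assocHom K L M N ◁ N.π₂ ◁ L.κ.hom) := Eq₂.whiskerLeft rfl (assocInv_κ K L M N)
      Eq₂ _ M.κ.hom := assocHom_π₂_κ K L M N
      Eq₂ _ (𝟙 M.pt ◁ M.κ.hom) := (Eq₂.id_whiskerLeft _).symm

theorem assocInv_hom : assocInv K L M N ≫ assocHom K L M N = 𝟙 N.pt := by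
  refine hom_ext_right (L := L) ?_ ?_ ?_ ?_ ?_
  · rw [Strict.assoc, assocHom_π₁, assocInv_π₁_π₁, Strict.id_comp]
  · rw [Strict.assoc, assocHom_π₂_π₁, assocInv_π₁_π₂, Strict.id_comp]
  · rw [Strict.assoc, assocHom_π₂_π₂, assocInv_π₂, Strict.id_comp]
  · calc
      Eq₂ _ (assocInv K L M N ◁ assocHom K L M N ◁ N.κ.hom) := Eq₂.comp_whiskerLeft _ _ _
      Eq₂ _ (assocInv K L M N ◁ M.π₁ ◁ K.κ.hom) := Eq₂.whiskerLeft rfl (assocHom_κ K L M N)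
      Eq₂ _ N.κ.hom := assocInv_π₁_κ K L M N
      Eq₂ _ (𝟙 N.pt ◁ N.κ.hom) := (Eq₂.id_whiskerLeft _).symm
  · calc
      Eq₂ _ (assocInv K L M N ◁ assocHom K L M N ◁ N.π₂ ◁ L.κ.hom) := Eq₂.comp_whiskerLeft _ _ _
      Eq₂ _ (assocInv K L M N ◁ M.κ.hom) := Eq₂.whiskerLeft rfl (assocHom_π₂_κ K L M N)
      Eq₂ _ (N.π₂ ◁ L.κ.hom) := assocInv_κ K L M N
      Eq₂ _ (𝟙 N.pt ◁ N.π₂ ◁ L.κ.hom) := (Eq₂.id_whiskerLeft _).symm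

/-- The associator `(R * S) * U ⟶ R * (S * U)`, as a map of spans. -/
noncomputable def assocMap :
    SpanMap (compObj (compObj R S K) U M) (compObj R (compObj S U L) N) :=
  .ofEq (assocHom K L M N)
    (by rw [← Strict.assoc, assocHom_π₁, Strict.assoc])
    (by rw [← Strict.assoc, ← Strict.assoc, Strict.assoc (assocHom K L M N), assocHom_π₂_π₂])

/-- The inverse associator `R * (S * U) ⟶ (R * S) * U`, as a map of spans. -/
noncomputable def assocInvMap :
    SpanMap (compObj R (compObj S U L) N) (compObj (compObj R S K) U M) :=
  .ofEq (assocInv K L M N)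
    (by rw [← Strict.assoc, ← Strict.assoc, Strict.assoc (assocInv K L M N), assocInv_π₁_π₁])
    (by rw [← Strict.assoc, assocInv_π₂, Strict.assoc])

theorem assocMap_ϖ : IsIdentity (assocMap K L M N).ϖ.hom := SpanMap.ofEq_ϖ _ _ _

theorem assocMap_ϱ : IsIdentity (assocMap K L M N).ϱ.hom := SpanMap.ofEq_ϱ _ _ _

theorem assocInvMap_ϖ : IsIdentity (assocInvMap K L M N).ϖ.hom := SpanMap.ofEq_ϖ _ _ _

theorem assocInvMap_ϱ : IsIdentity (assocInvMap K L M N).ϱ.hom := SpanMap.ofEq_ϱ _ _ _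

end Associator

section

variable {B : Type u} [Bicategory.{w, v} B] [Strict B] {X Y : B} {R S T : Span X Y}

theorem SpanMap.comp_ϖ_left (f : SpanMap R S) (g : SpanMap S T) (hg : IsIdentity g.ϖ.hom) :
    Eq₂ (f.comp g).ϖ.hom f.ϖ.hom :=
  Eq₂.comp_id' ((hg.whiskerLeft _).comp (.associator_inv _ _ _))

theorem SpanMap.comp_ϱ_left (f : SpanMap R S) (g : SpanMap S T) (hg : IsIdentity g.ϱ.hom) :
    Eq₂ (f.comp g).ϱ.hom f.ϱ.hom :=
  Eq₂.comp_id' ((hg.whiskerLeft _).comp (.associator_inv _ _ _))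

theorem SpanMap.comp_ϖ_right (f : SpanMap R S) (g : SpanMap S T) (hf : IsIdentity f.ϖ.hom) :
    Eq₂ (f.comp g).ϖ.hom (f.hom ◁ g.ϖ.hom) :=
  (Eq₂.id_comp' hf).trans (Eq₂.comp_assoc_inv _)

theorem SpanMap.comp_ϱ_right (f : SpanMap R S) (g : SpanMap S T) (hf : IsIdentity f.ϱ.hom) :
    Eq₂ (f.comp g).ϱ.hom (f.hom ◁ g.ϱ.hom) :=
  (Eq₂.id_comp' hf).trans (Eq₂.comp_assoc_inv _)

theorem SpanMap.comp_ϖ_eq₂ (f : SpanMap R S) (g : SpanMap S T) :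
    Eq₂ (f.comp g).ϖ.hom (f.ϖ.hom ≫ f.hom ◁ g.ϖ.hom) :=
  Eq₂.comp (.refl _) (Eq₂.comp_assoc_inv _)

theorem SpanMap.comp_ϱ_eq₂ (f : SpanMap R S) (g : SpanMap S T) :
    Eq₂ (f.comp g).ϱ.hom (f.ϱ.hom ≫ f.hom ◁ g.ϱ.hom) :=
  Eq₂.comp (.refl _) (Eq₂.comp_assoc_inv _)

theorem SpanMap.id_ϖ (R : Span X Y) : IsIdentity (SpanMap.id R).ϖ.hom := .leftUnitor_inv _

theorem SpanMap.id_ϱ (R : Span X Y) : IsIdentity (SpanMap.id R).ϱ.hom := .leftUnitor_inv _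

end

/-! ### Naturality of the associator -/

section Associator

variable {B : Type u} [Bicategory.{w, v} B] [Strict B] {W X Y Z : B}
  {R R' : Span W X} {S S' : Span X Y} {U U' : Span Y Z}
  (K : IsoComma R.q S.p) (L : IsoComma S.q U.p)
  (M : IsoComma (K.π₂ ≫ S.q) U.p) (N : IsoComma R.q (L.π₁ ≫ S.p))
  (K' : IsoComma R'.q S'.p) (L' : IsoComma S'.q U'.p)
  (M' : IsoComma (K'.π₂ ≫ S'.q) U'.p) (N' : IsoComma R'.q (L'.π₁ ≫ S'.p))

theorem assocHom_naturality (f : SpanMap R R') (g : SpanMap S S') (h : SpanMap U U') :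
    compHom (R := compObj R S K) (R' := compObj R' S' K') M M' (compMap K K' f g) h ≫
        assocHom K' L' M' N' =
      assocHom K L M N ≫ compHom (S := compObj S U L) (S' := compObj S' U' L') N N' f
        (compMap L L' g h) := by
  have l₁ := compHom_π₁ (R := compObj R S K) (R' := compObj R' S' K') M M' (compMap K K' f g) h
  have l₂ := compHom_π₂ (R := compObj R S K) (R' := compObj R' S' K') M M' (compMap K K' f g) h
  have l₃ := compHom_κ_eq₂ (R := compObj R S K) (R' := compObj R' S' K') M M' (compMap K K' f g) h
  have r₁ := compHom_π₁ (S := compObj S U L) (S' := compObj S' U' L') N N' f (compMap L L' g h)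
  have r₂ := compHom_π₂ (S := compObj S U L) (S' := compObj S' U' L') N N' f (compMap L L' g h)
  have r₃ := compHom_κ_eq₂ (S := compObj S U L) (S' := compObj S' U' L') N N' f (compMap L L' g h)
  set F := compHom (R := compObj R S K) (R' := compObj R' S' K') M M' (compMap K K' f g) h
  set G := compHom (S := compObj S U L) (S' := compObj S' U' L') N N' f (compMap L L' g h)
  change F ≫ M'.π₁ = M.π₁ ≫ compHom K K' f g at l₁
  change G ≫ N'.π₂ = N.π₂ ≫ compHom L L' g h at r₂
  -- Compare the projections to `R'`, `S'`, `U'`, then the comma 2-cells of `R'`, `S'` and of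
  -- `S'`, `U'`.
  refine hom_ext_right (L := L') ?_ ?_ ?_ ?_ ?_
  · rw [Strict.assoc, assocHom_π₁, ← Strict.assoc, l₁, Strict.assoc, compHom_π₁, Strict.assoc, r₁,
      ← Strict.assoc, ← Strict.assoc, assocHom_π₁]
  · rw [Strict.assoc, assocHom_π₂_π₁, ← Strict.assoc, l₁, Strict.assoc, compHom_π₂, Strict.assoc,
      ← Strict.assoc G, r₂, Strict.assoc, compHom_π₁, ← Strict.assoc N.π₂, ← Strict.assoc,
      ← Strict.assoc, assocHom_π₂_π₁]
  · rw [Strict.assoc, assocHom_π₂_π₂, l₂, Strict.assoc,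
      ← Strict.assoc G, r₂, Strict.assoc, compHom_π₂, ← Strict.assoc N.π₂, ← Strict.assoc,
      assocHom_π₂_π₂]
  · calc
      Eq₂ _ (F ◁ assocHom K' L' M' N' ◁ N'.κ.hom) := Eq₂.comp_whiskerLeft _ _ _
      Eq₂ _ (F ◁ M'.π₁ ◁ K'.κ.hom) := Eq₂.whiskerLeft rfl (assocHom_κ K' L' M' N')
      Eq₂ _ (M.π₁ ◁ compHom K K' f g ◁ K'.κ.hom) := Eq₂.whiskerLeft_comp_congr l₁ _
      Eq₂ _ (M.π₁ ◁ (K.π₁ ◁ f.ϱ.inv ≫ K.κ.hom ≫ K.π₂ ◁ g.ϖ.hom)) :=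
        Eq₂.whiskerLeft rfl (compHom_κ_eq₂ K K' f g)
      Eq₂ _ (M.π₁ ◁ K.π₁ ◁ f.ϱ.inv ≫ M.π₁ ◁ K.κ.hom ≫ M.π₁ ◁ K.π₂ ◁ g.ϖ.hom) := .of_eq (by simp)
      Eq₂ _ (assocHom K L M N ◁ N.π₁ ◁ f.ϱ.inv ≫ assocHom K L M N ◁ N.κ.hom ≫
          assocHom K L M N ◁ N.π₂ ◁ (compMap L L' g h).ϖ.hom) :=
        Eq₂.comp (Eq₂.whiskerLeft_comp_congr (assocHom_π₁ K L M N).symm _)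
          (Eq₂.comp (assocHom_κ K L M N).symm (((Eq₂.whiskerLeft rfl (Eq₂.whiskerLeft rfl
            (compMap_ϖ L L' g h))).trans ((Eq₂.comp_whiskerLeft _ _ _).symm.trans
              ((Eq₂.comp_whiskerLeft _ _ _).symm.trans ((Eq₂.whiskerLeft ((Strict.assoc _ _ _).trans
                (assocHom_π₂_π₁ K L M N)) (.refl _)).trans (Eq₂.comp_whiskerLeft _ _ _))))).symm))
      Eq₂ _ (assocHom K L M N ◁ (N.π₁ ◁ f.ϱ.inv ≫ N.κ.hom ≫
          N.π₂ ◁ (compMap L L' g h).ϖ.hom)) := .of_eq (by simp)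
      Eq₂ _ (assocHom K L M N ◁ G ◁ N'.κ.hom) := Eq₂.whiskerLeft rfl r₃.symm
      Eq₂ _ ((assocHom K L M N ≫ G) ◁ N'.κ.hom) := (Eq₂.comp_whiskerLeft _ _ _).symm
  · calc
      Eq₂ _ (F ◁ assocHom K' L' M' N' ◁ N'.π₂ ◁ L'.κ.hom) := Eq₂.comp_whiskerLeft _ _ _
      Eq₂ _ (F ◁ M'.κ.hom) := Eq₂.whiskerLeft rfl (assocHom_π₂_κ K' L' M' N')
      Eq₂ _ (M.π₁ ◁ (compMap K K' f g).ϱ.inv ≫ M.κ.hom ≫ M.π₂ ◁ h.ϖ.hom) := l₃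
      Eq₂ _ (assocHom K L M N ◁ N.π₂ ◁ L.π₁ ◁ g.ϱ.inv ≫ assocHom K L M N ◁ N.π₂ ◁ L.κ.hom ≫
          assocHom K L M N ◁ N.π₂ ◁ L.π₂ ◁ h.ϖ.hom) :=
        Eq₂.comp
          ((Eq₂.whiskerLeft rfl (Eq₂.iso_inv (α' := K.π₂ ◁ᵢ g.ϱ) (compMap_ϱ K K' f g))).trans
            ((Eq₂.whiskerLeft_comp_congr (assocHom_π₂_π₁ K L M N).symm g.ϱ.inv).trans
              (Eq₂.whiskerLeft rfl (Eq₂.comp_whiskerLeft _ _ _))))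
          (Eq₂.comp (assocHom_π₂_κ K L M N).symm ((Eq₂.whiskerLeft_comp_eq
            (assocHom_π₂_π₂ K L M N) _).symm.trans
              (Eq₂.whiskerLeft rfl (Eq₂.comp_whiskerLeft _ _ _))))
      Eq₂ _ (assocHom K L M N ◁ N.π₂ ◁ (L.π₁ ◁ g.ϱ.inv ≫ L.κ.hom ≫ L.π₂ ◁ h.ϖ.hom)) :=
        .of_eq (by simp)
      Eq₂ _ (assocHom K L M N ◁ N.π₂ ◁ compHom L L' g h ◁ L'.κ.hom) :=
        Eq₂.whiskerLeft rfl (Eq₂.whiskerLeft rfl (compHom_κ_eq₂ L L' g h).symm)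
      Eq₂ _ (assocHom K L M N ◁ G ◁ N'.π₂ ◁ L'.κ.hom) :=
        Eq₂.whiskerLeft rfl (Eq₂.whiskerLeft_comp_congr r₂.symm _)
      Eq₂ _ ((assocHom K L M N ≫ G) ◁ N'.π₂ ◁ L'.κ.hom) := (Eq₂.comp_whiskerLeft _ _ _).symm

theorem assocMap_naturality (f : SpanMap R R') (g : SpanMap S S') (h : SpanMap U U') :
    (compMap (R := compObj R S K) (R' := compObj R' S' K') M M' (compMap K K' f g) h).comp
        (assocMap K' L' M' N') =
      (assocMap K L M N).comp (compMap (S := compObj S U L) (S' := compObj S' U' L') N N' f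
        (compMap L L' g h)) := by
  refine SpanMap.hom_ext (assocHom_naturality K L M N K' L' M' N' f g h) ?_ ?_
  · calc
      Eq₂ _ (M.π₁ ◁ K.π₁ ◁ f.ϖ.hom) :=
        (SpanMap.comp_ϖ_left _ _ (SpanMap.ofEq_ϖ _ _ _)).trans
          ((compMap_ϖ _ _ _ _).trans (Eq₂.whiskerLeft rfl (compMap_ϖ K K' f g)))
      Eq₂ _ (assocHom K L M N ◁ N.π₁ ◁ f.ϖ.hom) :=
        Eq₂.whiskerLeft_comp_congr (assocHom_π₁ K L M N).symm _
      Eq₂ _ _ := ((SpanMap.comp_ϖ_right (assocMap K L M N) _ (assocMap_ϖ K L M N)).trans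
          (Eq₂.whiskerLeft rfl (compMap_ϖ (S := compObj S U L) (S' := compObj S' U' L') N N' f
            (compMap L L' g h)))).symm
  · calc
      Eq₂ _ (M.π₂ ◁ h.ϱ.hom) :=
        (SpanMap.comp_ϱ_left _ _ (SpanMap.ofEq_ϱ _ _ _)).trans (compMap_ϱ _ _ _ _)
      Eq₂ _ (assocHom K L M N ◁ N.π₂ ◁ L.π₂ ◁ h.ϱ.hom) :=
        (Eq₂.whiskerLeft_comp_eq (assocHom_π₂_π₂ K L M N) _).symm.trans
          (Eq₂.whiskerLeft rfl (Eq₂.comp_whiskerLeft _ _ _))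
      Eq₂ _ _ := ((SpanMap.comp_ϱ_right (assocMap K L M N) _ (assocMap_ϱ K L M N)).trans
          (Eq₂.whiskerLeft rfl ((compMap_ϱ (S := compObj S U L) (S' := compObj S' U' L') N N' f
            (compMap L L' g h)).trans (Eq₂.whiskerLeft rfl (compMap_ϱ L L' g h))))).symm

theorem assocHom_naturality₂ {f f' : SpanMap R R'} {g g' : SpanMap S S'} {h h' : SpanMap U U'}
    (γ : SpanMap₂ f f') (δ : SpanMap₂ g g') (η : SpanMap₂ h h') :
    Eq₂ (compMap₂Hom (R := compObj R S K) (R' := compObj R' S' K') M M' (compMap₂ K K' γ δ) η ▷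
        assocHom K' L' M' N')
      (assocHom K L M N ◁ compMap₂Hom (S := compObj S U L) (S' := compObj S' U' L') N N' γ
        (compMap₂ L L' δ η)) := by
  have l₁ := compMap₂_π₁ (R := compObj R S K) (R' := compObj R' S' K') M M' (compMap₂ K K' γ δ) η
  have l₂ := compMap₂_π₂ (R := compObj R S K) (R' := compObj R' S' K') M M' (compMap₂ K K' γ δ) η
  have r₁ := compMap₂_π₁ (S := compObj S U L) (S' := compObj S' U' L') N N' γ (compMap₂ L L' δ η)
  have r₂ := compMap₂_π₂ (S := compObj S U L) (S' := compObj S' U' L') N N' γ (compMap₂ L L' δ η)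
  have e := assocHom_naturality K L M N K' L' M' N' f g h
  have e' := assocHom_naturality K L M N K' L' M' N' f' g' h'
  set F := compMap₂Hom (R := compObj R S K) (R' := compObj R' S' K') M M' (compMap₂ K K' γ δ) η
  set G := compMap₂Hom (S := compObj S U L) (S' := compObj S' U' L') N N' γ (compMap₂ L L' δ η)
  change Eq₂ (F ▷ M'.π₁) (M.π₁ ◁ compMap₂Hom K K' γ δ) at l₁
  change Eq₂ (G ▷ N'.π₂) (N.π₂ ◁ compMap₂Hom L L' δ η) at r₂
  refine hom_ext₂_right (L := L') e e' ?_ ?_ ?_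
  · calc
      Eq₂ _ (F ▷ M'.π₁ ▷ K'.π₁) := Eq₂.whiskerRight_comp_congr (assocHom_π₁ K' L' M' N') _
      Eq₂ _ ((M.π₁ ◁ compMap₂Hom K K' γ δ) ▷ K'.π₁) := Eq₂.whiskerRight rfl l₁
      Eq₂ _ (M.π₁ ◁ compMap₂Hom K K' γ δ ▷ K'.π₁) := Eq₂.whisker_assoc _ _ _
      Eq₂ _ (M.π₁ ◁ K.π₁ ◁ γ.hom) := Eq₂.whiskerLeft rfl (compMap₂_π₁ K K' γ δ)
      Eq₂ _ (assocHom K L M N ◁ N.π₁ ◁ γ.hom) :=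
        Eq₂.whiskerLeft_comp_congr (assocHom_π₁ K L M N).symm _
      Eq₂ _ (assocHom K L M N ◁ G ▷ N'.π₁) := Eq₂.whiskerLeft rfl r₁.symm
      Eq₂ _ ((assocHom K L M N ◁ G) ▷ N'.π₁) := (Eq₂.whisker_assoc _ _ _).symm
  · calc
      Eq₂ _ (F ▷ assocHom K' L' M' N' ▷ (N'.π₂ ≫ L'.π₁)) := (Eq₂.whiskerRight_comp _ _ _).symm
      Eq₂ _ (F ▷ M'.π₁ ▷ K'.π₂) := Eq₂.whiskerRight_comp_congr (assocHom_π₂_π₁ K' L' M' N') _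
      Eq₂ _ ((M.π₁ ◁ compMap₂Hom K K' γ δ) ▷ K'.π₂) := Eq₂.whiskerRight rfl l₁
      Eq₂ _ (M.π₁ ◁ compMap₂Hom K K' γ δ ▷ K'.π₂) := Eq₂.whisker_assoc _ _ _
      Eq₂ _ (M.π₁ ◁ K.π₂ ◁ δ.hom) := Eq₂.whiskerLeft rfl (compMap₂_π₂ K K' γ δ)
      Eq₂ _ (assocHom K L M N ◁ (N.π₂ ≫ L.π₁) ◁ δ.hom) :=
        Eq₂.whiskerLeft_comp_congr (assocHom_π₂_π₁ K L M N).symm _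
      Eq₂ _ (assocHom K L M N ◁ N.π₂ ◁ compMap₂Hom L L' δ η ▷ L'.π₁) :=
        Eq₂.whiskerLeft rfl ((Eq₂.comp_whiskerLeft _ _ _).trans
          (Eq₂.whiskerLeft rfl (compMap₂_π₁ L L' δ η).symm))
      Eq₂ _ (assocHom K L M N ◁ G ▷ N'.π₂ ▷ L'.π₁) :=
        Eq₂.whiskerLeft rfl ((Eq₂.whisker_assoc _ _ _).symm.trans (Eq₂.whiskerRight rfl r₂.symm))
      Eq₂ _ ((assocHom K L M N ◁ G) ▷ N'.π₂ ▷ L'.π₁) :=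
        (Eq₂.whisker_assoc _ _ _).symm.trans (Eq₂.whiskerRight rfl (Eq₂.whisker_assoc _ _ _).symm)
  · calc
      Eq₂ _ (F ▷ assocHom K' L' M' N' ▷ (N'.π₂ ≫ L'.π₂)) := (Eq₂.whiskerRight_comp _ _ _).symm
      Eq₂ _ (F ▷ M'.π₂) := Eq₂.whiskerRight_comp_eq (assocHom_π₂_π₂ K' L' M' N') _
      Eq₂ _ (M.π₂ ◁ η.hom) := l₂
      Eq₂ _ (assocHom K L M N ◁ (N.π₂ ≫ L.π₂) ◁ η.hom) :=
        (Eq₂.whiskerLeft_comp_eq (assocHom_π₂_π₂ K L M N) _).symm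
      Eq₂ _ (assocHom K L M N ◁ N.π₂ ◁ compMap₂Hom L L' δ η ▷ L'.π₂) :=
        Eq₂.whiskerLeft rfl ((Eq₂.comp_whiskerLeft _ _ _).trans
          (Eq₂.whiskerLeft rfl (compMap₂_π₂ L L' δ η).symm))
      Eq₂ _ (assocHom K L M N ◁ G ▷ N'.π₂ ▷ L'.π₂) :=
        Eq₂.whiskerLeft rfl ((Eq₂.whisker_assoc _ _ _).symm.trans (Eq₂.whiskerRight rfl r₂.symm))
      Eq₂ _ ((assocHom K L M N ◁ G) ▷ N'.π₂ ▷ L'.π₂) :=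
        (Eq₂.whisker_assoc _ _ _).symm.trans (Eq₂.whiskerRight rfl (Eq₂.whisker_assoc _ _ _).symm)

theorem assocMap_inv : (assocMap K L M N).comp (assocInvMap K L M N) =
    SpanMap.id (compObj (compObj R S K) U M) :=
  SpanMap.hom_ext (assocHom_inv K L M N)
    (((SpanMap.comp_ϖ_left _ _ (SpanMap.ofEq_ϖ _ _ _)).trans
      ((SpanMap.ofEq_ϖ _ _ _).eq₂ (SpanMap.id_ϖ _) rfl)))
    (((SpanMap.comp_ϱ_left _ _ (SpanMap.ofEq_ϱ _ _ _)).trans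
      ((SpanMap.ofEq_ϱ _ _ _).eq₂ (SpanMap.id_ϱ _) rfl)))

theorem assocInvMap_assocMap : (assocInvMap K L M N).comp (assocMap K L M N) =
    SpanMap.id (compObj R (compObj S U L) N) :=
  SpanMap.hom_ext (assocInv_hom K L M N)
    (((SpanMap.comp_ϖ_left _ _ (SpanMap.ofEq_ϖ _ _ _)).trans
      ((SpanMap.ofEq_ϖ _ _ _).eq₂ (SpanMap.id_ϖ _) rfl)))
    (((SpanMap.comp_ϱ_left _ _ (SpanMap.ofEq_ϱ _ _ _)).trans
      ((SpanMap.ofEq_ϱ _ _ _).eq₂ (SpanMap.id_ϱ _) rfl)))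

end Associator

/-! ### Invertible 2-cells into an iso-comma object -/

namespace IsoComma

variable {B : Type u} [Bicategory.{w, v} B] [Strict B] {W X Y Z : B} {f : X ⟶ Z} {g : Y ⟶ Z}
  (K : IsoComma f g) {j k : W ⟶ K.pt} {a a' : W ⟶ X} {b b' : W ⟶ Y}

/-- The compatibility condition for inducing a 2-cell `j ⟶ k` from 2-cells `α` and `β`, where the
boundaries of `α` and `β` are only propositionally equal to the projections of `j` and `k`. -/
theorem lift₂_aux {s : a ≫ f ⟶ b ≫ g} {t : a' ≫ f ⟶ b' ≫ g} (ha : j ≫ K.π₁ = a)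
    (ha' : k ≫ K.π₁ = a') (hb : j ≫ K.π₂ = b) (hb' : k ≫ K.π₂ = b')
    (hs : Eq₂ (j ◁ K.κ.hom) s) (ht : Eq₂ (k ◁ K.κ.hom) t) (α : a ⟶ a') (β : b ⟶ b')
    (e : α ▷ f ≫ t = s ≫ β ▷ g) :
    (α_ j K.π₁ f).inv ≫ (eqToHom ha ≫ α ≫ eqToHom ha'.symm) ▷ f ≫ (α_ k K.π₁ f).hom ≫
        k ◁ K.κ.hom =
      j ◁ K.κ.hom ≫ (α_ j K.π₂ g).inv ≫ (eqToHom hb ≫ β ≫ eqToHom hb'.symm) ▷ g ≫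
        (α_ k K.π₂ g).hom := by
  refine Eq₂.eq ?_
  calc
    Eq₂ _ (α ▷ f ≫ t) := (Eq₂.assoc_inv_comp _).trans
      (Eq₂.comp (Eq₂.whiskerRight rfl (Eq₂.conj ha α ha'.symm)) ((Eq₂.assoc_hom_comp _).trans ht))
    Eq₂ _ (s ≫ β ▷ g) := .of_eq e
    Eq₂ _ _ := (Eq₂.comp hs ((Eq₂.assoc_inv_comp _).trans ((Eq₂.comp_assoc_hom _).trans
      (Eq₂.whiskerRight rfl (Eq₂.conj hb β hb'.symm))))).symm

/-- The invertible 2-cell into an iso-comma object induced by two invertible 2-cells `α` and `β`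
whose boundaries are only propositionally equal to the projections of `j` and `k`; here `s` and `t`
are the 2-cells `κ j` and `κ k` transported along these equalities. -/
noncomputable def liftIso {s : a ≫ f ⟶ b ≫ g} {t : a' ≫ f ⟶ b' ≫ g} (ha : j ≫ K.π₁ = a)
    (ha' : k ≫ K.π₁ = a') (hb : j ≫ K.π₂ = b) (hb' : k ≫ K.π₂ = b')
    (hs : Eq₂ (j ◁ K.κ.hom) s) (ht : Eq₂ (k ◁ K.κ.hom) t) (α : a ≅ a') (β : b ≅ b')
    (e : α.hom ▷ f ≫ t = s ≫ β.hom ▷ g) : j ≅ k where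
  hom := K.lift₂ _ _ (K.lift₂_aux ha ha' hb hb' hs ht α.hom β.hom e)
  inv := K.lift₂ _ _ (K.lift₂_aux ha' ha hb' hb ht hs α.inv β.inv (by
    rw [← cancel_epi (α.hom ▷ f), reassoc_of% e]; simp))
  hom_inv_id := K.hom_ext₂' (by rw [comp_whiskerRight, lift₂_π₁, lift₂_π₁]; simp)
    (by rw [comp_whiskerRight, lift₂_π₂, lift₂_π₂]; simp)
  inv_hom_id := K.hom_ext₂' (by rw [comp_whiskerRight, lift₂_π₁, lift₂_π₁]; simp)
    (by rw [comp_whiskerRight, lift₂_π₂, lift₂_π₂]; simp)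

section

variable {s : a ≫ f ⟶ b ≫ g} {t : a' ≫ f ⟶ b' ≫ g} (ha : j ≫ K.π₁ = a)
  (ha' : k ≫ K.π₁ = a') (hb : j ≫ K.π₂ = b) (hb' : k ≫ K.π₂ = b')
  (hs : Eq₂ (j ◁ K.κ.hom) s) (ht : Eq₂ (k ◁ K.κ.hom) t) (α : a ≅ a') (β : b ≅ b')
  (e : α.hom ▷ f ≫ t = s ≫ β.hom ▷ g)

theorem liftIso_π₁ : Eq₂ ((K.liftIso ha ha' hb hb' hs ht α β e).hom ▷ K.π₁) α.hom :=
  (Eq₂.of_eq (K.lift₂_π₁ _ _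
    (K.lift₂_aux ha ha' hb hb' hs ht α.hom β.hom e))).trans (Eq₂.conj ha α.hom ha'.symm)

theorem liftIso_π₂ : Eq₂ ((K.liftIso ha ha' hb hb' hs ht α β e).hom ▷ K.π₂) β.hom :=
  (Eq₂.of_eq (K.lift₂_π₂ _ _
    (K.lift₂_aux ha ha' hb hb' hs ht α.hom β.hom e))).trans (Eq₂.conj hb β.hom hb'.symm)

end

end IsoComma

/-! ### The left unitor of spans -/

/-- The identity span. Unlike `idSpan` it is reducible, so that its apex and legs are visible to
unification. -/
abbrev unitSpan {B : Type u} [Bicategory.{w, v} B] (X : B) : Span X X := ⟨X, 𝟙 X, 𝟙 X⟩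

section LeftUnitor

variable {B : Type u} [Bicategory.{w, v} B] {X Y : B} {R R' R'' : Span X Y}
  (K : IsoComma R.q (unitSpan Y).p) (K' : IsoComma R'.q (unitSpan Y).p)
  (K'' : IsoComma R''.q (unitSpan Y).p)

/-- The left unitor `R * I ⟶ R`. -/
def leftMap : SpanMap (compObj R (unitSpan Y) K) R where
  hom := K.π₁
  ϖ := Iso.refl _
  ϱ := K.κ.symm

theorem leftMap_ϖ : IsIdentity (leftMap K).ϖ.hom := .id _

variable [Strict B]

/-- The 1-cell `R ⟶ R * I`. -/
noncomputable def leftInvHom : R.pt ⟶ K.pt :=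
  K.liftOf (𝟙 R.pt) R.q (Iso.refl R.q) (Strict.id_comp _) (Strict.comp_id R.q)

theorem leftInvHom_π₁ : leftInvHom K ≫ K.π₁ = 𝟙 R.pt := K.liftOf_π₁ _ _ _ _ _

theorem leftInvHom_π₂ : leftInvHom K ≫ K.π₂ = R.q := K.liftOf_π₂ _ _ _ _ _

theorem leftInvHom_κ : IsIdentity (leftInvHom K ◁ K.κ.hom) :=
  .of_eq₂ (K.liftOf_κ _ _ _ _ _) (.id R.q)

/-- The inverse left unitor `R ⟶ R * I`. -/
noncomputable def leftInvMap : SpanMap R (compObj R (unitSpan Y) K) :=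
  .ofEq (leftInvHom K) (by rw [← Strict.assoc, leftInvHom_π₁, Strict.id_comp])
    ((congrArg (leftInvHom K ≫ ·) (Strict.comp_id K.π₂)).trans (leftInvHom_π₂ K))

theorem leftInvMap_ϖ : IsIdentity (leftInvMap K).ϖ.hom := SpanMap.ofEq_ϖ _ _ _

theorem leftInvMap_ϱ : IsIdentity (leftInvMap K).ϱ.hom := SpanMap.ofEq_ϱ _ _ _

theorem leftMap_naturality (f : SpanMap R R') :
    (compMap K K' f (SpanMap.id (unitSpan Y))).comp (leftMap K') = (leftMap K).comp f := by
  refine SpanMap.hom_ext (compHom_π₁ K K' f _) ?_ ?_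
  · exact (SpanMap.comp_ϖ_left _ _ (leftMap_ϖ K')).trans ((compMap_ϖ K K' f _).trans
      (SpanMap.comp_ϖ_right _ _ (leftMap_ϖ K)).symm)
  · calc
      Eq₂ _ (compHom K K' f (SpanMap.id (unitSpan Y)) ◁ K'.κ.inv) :=
        SpanMap.comp_ϱ_right _ _ (.of_eq₂ (compMap_ϱ K K' f _) ((SpanMap.id_ϱ _).whiskerLeft _))
      Eq₂ _ (K.κ.inv ≫ K.π₁ ◁ f.ϱ.hom) :=
        Eq₂.iso_inv (α := compHom K K' f (SpanMap.id (unitSpan Y)) ◁ᵢ K'.κ)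
          (α' := K.π₁ ◁ᵢ f.ϱ.symm ≪≫ K.κ) (compHom_κ_left K K' f _ (SpanMap.id_ϖ _))
      Eq₂ _ _ := (SpanMap.comp_ϱ_eq₂ (leftMap K) f).symm

theorem leftInvMap_comp : (leftInvMap K).comp (leftMap K) = SpanMap.id R := by
  refine SpanMap.hom_ext (leftInvHom_π₁ K) ?_ ?_
  · exact (SpanMap.comp_ϖ_left _ _ (leftMap_ϖ K)).trans
      ((leftInvMap_ϖ K).eq₂ (SpanMap.id_ϖ R) rfl)
  · exact (SpanMap.comp_ϱ_right _ _ (leftInvMap_ϱ K)).trans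
      (IsIdentity.eq₂' (IsIdentity.inv (e := leftInvHom K ◁ᵢ K.κ) (leftInvHom_κ K)) (SpanMap.id_ϱ R)
        (by rw [← Strict.assoc]; exact congrArg (· ≫ R.q) (leftInvHom_π₁ K)))

/-- The 2-cell underlying the unit `1 ⟶ l⁻¹ l` of the left unitor. -/
noncomputable def leftUnitHom : 𝟙 K.pt ≅ K.π₁ ≫ leftInvHom K :=
  K.liftIso (s := K.κ.hom ≫ eqToHom (Strict.comp_id (K.π₂ ≫ 𝟙 Y)).symm)
    (t := eqToHom (Strict.comp_id (K.π₁ ≫ R.q)).symm)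
    (Strict.id_comp _) (by rw [Strict.assoc, leftInvHom_π₁, Strict.comp_id])
    (by exact (Strict.id_comp K.π₂).trans (Strict.comp_id K.π₂).symm)
    (by rw [Strict.assoc, leftInvHom_π₂])
    ((Eq₂.id_whiskerLeft _).trans (Eq₂.comp_eqToHom K.κ.hom _).symm)
    (((((leftInvHom_κ K).whiskerLeft K.π₁).of_eq₂ (Eq₂.comp_whiskerLeft _ _ _))).eq₂ (.eqToHom _)
      (by rw [Strict.assoc, ← Strict.assoc (leftInvHom K), leftInvHom_π₁, Strict.id_comp]))
    (Iso.refl K.π₁) K.κ.symm (by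
      -- Both sides of the compatibility condition are identities, the right one as `κ ≫ κ⁻¹`.
      refine Eq₂.eq (Eq₂.trans (IsIdentity.eq₂ ?_ (.id (K.π₁ ≫ R.q)) rfl) (Eq₂.symm ?_))
      · exact .comp (.whiskerRight (.id _) _) (.eqToHom _)
      · exact (Eq₂.comp (Eq₂.comp_eqToHom K.κ.hom _) (Eq₂.whiskerRight_id K.κ.inv)).trans
          (.of_eq K.κ.hom_inv_id))

theorem leftUnitHom_π₁ : IsIdentity ((leftUnitHom K).hom ▷ K.π₁) :=
  .of_eq₂ (K.liftIso_π₁ _ _ _ _ _ _ _ _ _) (.id _)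

theorem leftUnitHom_π₂ : Eq₂ ((leftUnitHom K).hom ▷ K.π₂) K.κ.inv :=
  K.liftIso_π₂ _ _ _ _ _ _ _ _ _

/-- The unit `1 ⟶ l⁻¹ l` of the left unitor. -/
noncomputable def leftUnit :
    SpanMap.id (compObj R (unitSpan Y) K) ≅ (leftMap K).comp (leftInvMap K) :=
  SpanMap.isoMk (leftUnitHom K)
    (IsIdentity.eq ((SpanMap.id_ϖ _).comp
        (.of_eq₂ (Eq₂.whiskerRight_comp _ _ _) ((leftUnitHom_π₁ K).whiskerRight _)))
      (.of_eq₂ (SpanMap.comp_ϖ_left _ _ (leftInvMap_ϖ K)) (leftMap_ϖ K)))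
    (Eq₂.eq (calc
      Eq₂ _ ((leftUnitHom K).hom ▷ (K.π₂ ≫ 𝟙 Y)) :=
        Eq₂.id_comp' (SpanMap.id_ϱ (compObj R (unitSpan Y) K))
      Eq₂ _ ((leftUnitHom K).hom ▷ K.π₂) := Eq₂.whiskerRight (Strict.comp_id _) (.refl _)
      Eq₂ _ K.κ.inv := leftUnitHom_π₂ K
      Eq₂ _ _ := (SpanMap.comp_ϱ_left (leftMap K) _ (leftInvMap_ϱ K)).symm))

/-- The 2-cell underlying the naturality 2-cell of the inverse left unitor. -/
noncomputable def leftInvNatHom (f : SpanMap R R') : f.hom ≫ leftInvHom K' ≅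
    leftInvHom K ≫ compHom K K' f (SpanMap.id (unitSpan Y)) :=
  K'.liftIso (s := eqToHom (Strict.comp_id (f.hom ≫ R'.q)).symm)
    (t := f.ϱ.inv ≫ eqToHom (Strict.comp_id R.q).symm)
    (by rw [Strict.assoc, leftInvHom_π₁, Strict.comp_id])
    (by rw [Strict.assoc, compHom_π₁, ← Strict.assoc, leftInvHom_π₁, Strict.id_comp])
    (by rw [Strict.assoc, leftInvHom_π₂])
    ((congrArg (leftInvHom K ≫ ·) ((compHom_π₂ K K' f _).trans (Strict.comp_id K.π₂))).trans
      (leftInvHom_π₂ K) |> (Strict.assoc _ _ _).trans)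
    (((((leftInvHom_κ K').whiskerLeft f.hom).of_eq₂ (Eq₂.comp_whiskerLeft _ _ _))).eq₂ (.eqToHom _)
      (by rw [Strict.assoc, ← Strict.assoc (leftInvHom K'), leftInvHom_π₁, Strict.id_comp]))
    (calc
      Eq₂ _ (leftInvHom K ◁ compHom K K' f (SpanMap.id (unitSpan Y)) ◁ K'.κ.hom) :=
        Eq₂.comp_whiskerLeft _ _ _
      Eq₂ _ (leftInvHom K ◁ (K.π₁ ◁ f.ϱ.inv ≫ K.κ.hom)) :=
        Eq₂.whiskerLeft rfl (compHom_κ_left K K' f _ (SpanMap.id_ϖ _))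
      Eq₂ _ (leftInvHom K ◁ K.π₁ ◁ f.ϱ.inv ≫ leftInvHom K ◁ K.κ.hom) := .of_eq (by simp)
      Eq₂ _ (leftInvHom K ◁ K.π₁ ◁ f.ϱ.inv) := Eq₂.comp_id' (leftInvHom_κ K)
      Eq₂ _ f.ϱ.inv := (Eq₂.whiskerLeft_comp_eq (leftInvHom_π₁ K) _).trans (Eq₂.id_whiskerLeft _)
      Eq₂ _ (f.ϱ.inv ≫ eqToHom (Strict.comp_id R.q).symm) := (Eq₂.comp_eqToHom _ _).symm)
    (Iso.refl f.hom) f.ϱ.symm (by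
      refine Eq₂.eq (Eq₂.trans (Eq₂.id_comp' (.whiskerRight (.id _) _))
        (Eq₂.trans ?_ (Eq₂.id_comp' (.eqToHom _)).symm))
      exact (Eq₂.comp_eqToHom _ _).trans (Eq₂.whiskerRight_id f.ϱ.inv).symm)

theorem leftInvNatHom_π₁ (f : SpanMap R R') :
    IsIdentity ((leftInvNatHom K K' f).hom ▷ K'.π₁) :=
  .of_eq₂ (K'.liftIso_π₁ _ _ _ _ _ _ _ _ _) (.id _)

theorem leftInvNatHom_π₂ (f : SpanMap R R') :
    Eq₂ ((leftInvNatHom K K' f).hom ▷ K'.π₂) f.ϱ.inv :=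
  K'.liftIso_π₂ _ _ _ _ _ _ _ _ _

/-- The naturality 2-cell of the inverse left unitor. -/
noncomputable def leftInvNat (f : SpanMap R R') : f.comp (leftInvMap K') ≅
    (leftInvMap K).comp (compMap K K' f (SpanMap.id (unitSpan Y))) :=
  SpanMap.isoMk (leftInvNatHom K K' f)
    (Eq₂.eq (calc
      Eq₂ _ (f.comp (leftInvMap K')).ϖ.hom :=
        Eq₂.comp_id' (.of_eq₂ (Eq₂.whiskerRight_comp _ _ _)
          ((leftInvNatHom_π₁ K K' f).whiskerRight _))
      Eq₂ _ f.ϖ.hom := SpanMap.comp_ϖ_left _ _ (leftInvMap_ϖ K')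
      Eq₂ _ (leftInvHom K ◁ K.π₁ ◁ f.ϖ.hom) :=
        ((Eq₂.whiskerLeft_comp_eq (leftInvHom_π₁ K) _).trans (Eq₂.id_whiskerLeft _)).symm
      Eq₂ _ _ := ((SpanMap.comp_ϖ_right (leftInvMap K) _ (leftInvMap_ϖ K)).trans
        (Eq₂.whiskerLeft rfl (compMap_ϖ K K' f _))).symm))
    (IsIdentity.eq (.of_eq₂ (calc
        Eq₂ _ (f.ϱ.hom ≫ f.ϱ.inv) := Eq₂.comp (SpanMap.comp_ϱ_left _ _ (leftInvMap_ϱ K'))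
          ((Eq₂.whiskerRight (Strict.comp_id K'.π₂) (.refl _)).trans (leftInvNatHom_π₂ K K' f))
        Eq₂ _ (𝟙 R.q) := .of_eq f.ϱ.hom_inv_id) (.id _))
      (.of_eq₂ ((SpanMap.comp_ϱ_right (leftInvMap K) _ (leftInvMap_ϱ K)).trans
        (Eq₂.whiskerLeft rfl (compMap_ϱ K K' f _)))
        (((SpanMap.id_ϱ _).whiskerLeft _).whiskerLeft _)))

theorem leftInvNatHom_naturality {f g : SpanMap R R'} (γ : SpanMap₂ f g) :
    γ.hom ▷ leftInvHom K' ≫ (leftInvNatHom K K' g).hom =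
      (leftInvNatHom K K' f).hom ≫ leftInvHom K ◁
        compMap₂Hom K K' γ (𝟙 (SpanMap.id (unitSpan Y))) := by
  refine K'.hom_ext₂' (Eq₂.eq ?_) (Eq₂.eq ?_)
  · rw [comp_whiskerRight, comp_whiskerRight]
    calc
      Eq₂ _ (γ.hom ▷ leftInvHom K' ▷ K'.π₁) := Eq₂.comp_id' (leftInvNatHom_π₁ K K' g)
      Eq₂ _ γ.hom := (Eq₂.whiskerRight_comp_eq (leftInvHom_π₁ K') _).trans (Eq₂.whiskerRight_id _)
      Eq₂ _ (leftInvHom K ◁ K.π₁ ◁ γ.hom) :=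
        ((Eq₂.whiskerLeft_comp_eq (leftInvHom_π₁ K) _).trans (Eq₂.id_whiskerLeft _)).symm
      Eq₂ _ ((leftInvHom K ◁ compMap₂Hom K K' γ (𝟙 (SpanMap.id (unitSpan Y)))) ▷ K'.π₁) :=
        ((Eq₂.whisker_assoc _ _ _).trans (Eq₂.whiskerLeft rfl (compMap₂_π₁ K K' γ _))).symm
      Eq₂ _ _ := (Eq₂.id_comp' (leftInvNatHom_π₁ K K' f)).symm
  · rw [comp_whiskerRight, comp_whiskerRight]
    have h₁ : γ.hom ▷ R'.q ≫ g.ϱ.inv = f.ϱ.inv := by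
      rw [Iso.comp_inv_eq, ← γ.w_q]; simp
    calc
      Eq₂ _ (γ.hom ▷ R'.q ≫ g.ϱ.inv) :=
        Eq₂.comp (Eq₂.whiskerRight_comp_eq (leftInvHom_π₂ K') _) (leftInvNatHom_π₂ K K' g)
      Eq₂ _ f.ϱ.inv := .of_eq h₁
      Eq₂ _ ((leftInvNatHom K K' f).hom ▷ K'.π₂) := (leftInvNatHom_π₂ K K' f).symm
      Eq₂ _ _ := (Eq₂.comp_id' (.of_eq₂ ((Eq₂.whisker_assoc _ _ _).trans
        (Eq₂.whiskerLeft rfl (compMap₂_π₂ K K' γ _))) (((IsIdentity.id _).whiskerLeft _).whiskerLeft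
          _))).symm

theorem leftInvNatHom_id : IsIdentity (leftInvNatHom K K (SpanMap.id R)).hom :=
  K.isIdentity (leftInvNatHom_π₁ K K _)
    (.of_eq₂ (leftInvNatHom_π₂ K K _) (SpanMap.id_ϱ R).inv)

theorem SpanMap.comp_ϱ_inv {R R' R'' : Span X Y} (f : SpanMap R R') (g : SpanMap R' R'') :
    Eq₂ (f.comp g).ϱ.inv (f.hom ◁ g.ϱ.inv ≫ f.ϱ.inv) :=
  Eq₂.iso_inv (α' := f.ϱ ≪≫ f.hom ◁ᵢ g.ϱ) (SpanMap.comp_ϱ_eq₂ f g)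

theorem SpanMap.comp_ϖ_inv {R R' R'' : Span X Y} (f : SpanMap R R') (g : SpanMap R' R'') :
    Eq₂ (f.comp g).ϖ.inv (f.hom ◁ g.ϖ.inv ≫ f.ϖ.inv) :=
  Eq₂.iso_inv (α' := f.ϖ ≪≫ f.hom ◁ᵢ g.ϖ) (SpanMap.comp_ϖ_eq₂ f g)

theorem leftInvNatHom_comp (f : SpanMap R R') (g : SpanMap R' R'') :
    Eq₂ (leftInvNatHom K K'' (f.comp g)).hom
      ((α_ _ _ _).hom ≫ f.hom ◁ (leftInvNatHom K' K'' g).hom ≫ (α_ _ _ _).inv ≫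
        (leftInvNatHom K K' f).hom ▷ compHom K' K'' g (SpanMap.id (unitSpan Y))) := by
  refine Eq₂.trans ?_ (Eq₂.assoc_hom_comp _).symm
  have e₁ := Strict.assoc f.hom g.hom (leftInvHom K'')
  have e₂ : leftInvHom K ≫ compHom K K'' (f.comp g) (SpanMap.id (unitSpan Y)) =
      (leftInvHom K ≫ compHom K K' f (SpanMap.id (unitSpan Y))) ≫
        compHom K' K'' g (SpanMap.id (unitSpan Y)) := by
    rw [Strict.assoc, ← compHom_comp]
    congr 2
    exact (Strict.comp_id (𝟙 (unitSpan Y))).symm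
  refine K''.hom_ext₂ e₁ e₂ ?_ ?_
  · rw [comp_whiskerRight]
    refine (leftInvNatHom_π₁ K K'' _).eq₂ (.comp (.of_eq₂ (Eq₂.whisker_assoc _ _ _)
      (.whiskerLeft (leftInvNatHom_π₁ K' K'' g) _)) ?_)
      (congrArg (· ≫ K''.π₁) e₁)
    rw [comp_whiskerRight]
    refine .comp (.whiskerRight (.associator_inv _ _ _) _) (.of_eq₂
      (Eq₂.whiskerRight_comp_congr (compHom_π₁ K' K'' g _) _)
      ((leftInvNatHom_π₁ K K' f).whiskerRight _))
  · rw [comp_whiskerRight, comp_whiskerRight]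
    calc
      Eq₂ _ (f.hom ◁ g.ϱ.inv ≫ f.ϱ.inv) :=
        (leftInvNatHom_π₂ K K'' _).trans (SpanMap.comp_ϱ_inv f g)
      Eq₂ _ _ := Eq₂.symm (Eq₂.comp ((Eq₂.whisker_assoc _ _ _).trans
        (Eq₂.whiskerLeft rfl (leftInvNatHom_π₂ K' K'' g)))
          ((Eq₂.id_comp' (.whiskerRight (.associator_inv _ _ _) _)).trans
            ((Eq₂.whiskerRight_comp_eq ((compHom_π₂ K' K'' g _).trans (Strict.comp_id K'.π₂))
              _).trans (leftInvNatHom_π₂ K K' f))))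

/-- The unit of the left unitor is a modification: its compatibility with a map of spans. -/
theorem leftUnitHom_naturality (f : SpanMap R R')
    {N : compHom K K' f (SpanMap.id (unitSpan Y)) ≫ K'.π₁ ≫ leftInvHom K' ⟶
      (K.π₁ ≫ leftInvHom K) ≫ compHom K K' f (SpanMap.id (unitSpan Y))}
    (hN : Eq₂ N (K.π₁ ◁ (leftInvNatHom K K' f).hom)) :
    Eq₂ (compHom K K' f (SpanMap.id (unitSpan Y)) ◁ (leftUnitHom K').hom ≫ N)
      ((leftUnitHom K).hom ▷ compHom K K' f (SpanMap.id (unitSpan Y))) := by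
  have e₁ : compHom K K' f (SpanMap.id (unitSpan Y)) ≫ 𝟙 K'.pt =
      𝟙 K.pt ≫ compHom K K' f (SpanMap.id (unitSpan Y)) := by rw [Strict.comp_id, Strict.id_comp]
  refine K'.hom_ext₂ e₁ rfl ?_ ?_
  · rw [comp_whiskerRight]
    refine IsIdentity.eq₂ (.comp (.of_eq₂ (Eq₂.whisker_assoc _ _ _)
      ((leftUnitHom_π₁ K').whiskerLeft _)) (.of_eq₂ ((Eq₂.whiskerRight rfl hN).trans
        (Eq₂.whisker_assoc _ _ _)) ((leftInvNatHom_π₁ K K' f).whiskerLeft _)))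
      (.of_eq₂ (Eq₂.whiskerRight_comp_congr (compHom_π₁ K K' f _) _)
        ((leftUnitHom_π₁ K).whiskerRight _)) (by rw [e₁])
  · rw [comp_whiskerRight]
    calc
      Eq₂ _ ((K.κ.inv ≫ K.π₁ ◁ f.ϱ.hom) ≫ K.π₁ ◁ f.ϱ.inv) :=
        Eq₂.comp ((Eq₂.whisker_assoc _ _ _).trans ((Eq₂.whiskerLeft rfl
          (leftUnitHom_π₂ K')).trans
            (Eq₂.iso_inv (α := compHom K K' f (SpanMap.id (unitSpan Y)) ◁ᵢ K'.κ)
              (α' := K.π₁ ◁ᵢ f.ϱ.symm ≪≫ K.κ) (compHom_κ_left K K' f _ (SpanMap.id_ϖ _)))))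
          ((Eq₂.whiskerRight rfl hN).trans ((Eq₂.whisker_assoc _ _ _).trans
            (Eq₂.whiskerLeft rfl (leftInvNatHom_π₂ K K' f))))
      Eq₂ _ K.κ.inv := .of_eq (by
        rw [Category.assoc, ← Bicategory.whiskerLeft_comp, Iso.hom_inv_id]
        simp)
      Eq₂ _ ((leftUnitHom K).hom ▷ K.π₂) := (leftUnitHom_π₂ K).symm
      Eq₂ _ _ := (Eq₂.whiskerRight_comp_eq ((compHom_π₂ K K' f _).trans
        (Strict.comp_id K.π₂)) _).symm

end LeftUnitor

/-! ### The right unitor of spans -/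

section RightUnitor

variable {B : Type u} [Bicategory.{w, v} B] {X Y : B} {R R' R'' : Span X Y}
  (K : IsoComma (unitSpan X).q R.p) (K' : IsoComma (unitSpan X).q R'.p)
  (K'' : IsoComma (unitSpan X).q R''.p)

/-- The right unitor `I * R ⟶ R`. -/
def rightMap : SpanMap (compObj (unitSpan X) R K) R where
  hom := K.π₂
  ϖ := K.κ
  ϱ := Iso.refl _

theorem rightMap_ϱ : IsIdentity (rightMap K).ϱ.hom := .id _

variable [Strict B]

/-- The 1-cell `R ⟶ I * R`. -/
noncomputable def rightInvHom : R.pt ⟶ K.pt :=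
  K.liftOf R.p (𝟙 R.pt) (Iso.refl R.p) (Strict.comp_id R.p) (Strict.id_comp _)

theorem rightInvHom_π₁ : rightInvHom K ≫ K.π₁ = R.p := K.liftOf_π₁ _ _ _ _ _

theorem rightInvHom_π₂ : rightInvHom K ≫ K.π₂ = 𝟙 R.pt := K.liftOf_π₂ _ _ _ _ _

theorem rightInvHom_κ : IsIdentity (rightInvHom K ◁ K.κ.hom) :=
  .of_eq₂ (K.liftOf_κ _ _ _ _ _) (.id R.p)

/-- The inverse right unitor `R ⟶ I * R`. -/
noncomputable def rightInvMap : SpanMap R (compObj (unitSpan X) R K) :=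
  .ofEq (rightInvHom K)
    ((congrArg (rightInvHom K ≫ ·) (Strict.comp_id K.π₁)).trans (rightInvHom_π₁ K))
    (by rw [← Strict.assoc, rightInvHom_π₂, Strict.id_comp])

theorem rightInvMap_ϖ : IsIdentity (rightInvMap K).ϖ.hom := SpanMap.ofEq_ϖ _ _ _

theorem rightInvMap_ϱ : IsIdentity (rightInvMap K).ϱ.hom := SpanMap.ofEq_ϱ _ _ _

theorem rightMap_naturality (f : SpanMap R R') :
    (compMap K K' (SpanMap.id (unitSpan X)) f).comp (rightMap K') = (rightMap K).comp f := by
  refine SpanMap.hom_ext (compHom_π₂ K K' _ f) ?_ ?_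
  · calc
      Eq₂ _ (compHom K K' (SpanMap.id (unitSpan X)) f ◁ K'.κ.hom) :=
        SpanMap.comp_ϖ_right _ _ (.of_eq₂ (compMap_ϖ K K' _ f) ((SpanMap.id_ϖ _).whiskerLeft _))
      Eq₂ _ (K.κ.hom ≫ K.π₂ ◁ f.ϖ.hom) := compHom_κ_right K K' _ f (SpanMap.id_ϱ _)
      Eq₂ _ _ := (SpanMap.comp_ϖ_eq₂ (rightMap K) f).symm
  · exact (SpanMap.comp_ϱ_left _ _ (rightMap_ϱ K')).trans ((compMap_ϱ K K' _ f).trans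
      (SpanMap.comp_ϱ_right _ _ (rightMap_ϱ K)).symm)

theorem rightInvMap_comp : (rightInvMap K).comp (rightMap K) = SpanMap.id R := by
  refine SpanMap.hom_ext (rightInvHom_π₂ K) ?_ ?_
  · exact (SpanMap.comp_ϖ_right _ _ (rightInvMap_ϖ K)).trans
      (IsIdentity.eq₂' (rightInvHom_κ K) (SpanMap.id_ϖ R)
        (by rw [← Strict.assoc]; exact congrArg (· ≫ R.p) (rightInvHom_π₂ K)))
  · exact (SpanMap.comp_ϱ_left _ _ (rightMap_ϱ K)).trans
      ((rightInvMap_ϱ K).eq₂ (SpanMap.id_ϱ R) rfl)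

/-- The 2-cell underlying the unit `1 ⟶ r⁻¹ r` of the right unitor. -/
noncomputable def rightUnitHom : 𝟙 K.pt ≅ K.π₂ ≫ rightInvHom K :=
  K.liftIso (s := eqToHom (Strict.comp_id (K.π₁ ≫ 𝟙 X)) ≫ K.κ.hom)
    (t := eqToHom (Strict.comp_id (K.π₂ ≫ R.p)))
    (by exact (Strict.id_comp K.π₁).trans (Strict.comp_id K.π₁).symm)
    (by rw [Strict.assoc, rightInvHom_π₁])
    (Strict.id_comp _) (by rw [Strict.assoc, rightInvHom_π₂, Strict.comp_id])
    ((Eq₂.id_whiskerLeft _).trans (Eq₂.eqToHom_comp _ K.κ.hom).symm)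
    (((((rightInvHom_κ K).whiskerLeft K.π₂).of_eq₂ (Eq₂.comp_whiskerLeft _ _ _))).eq₂ (.eqToHom _)
      (by rw [Strict.assoc, ← Strict.assoc (rightInvHom K), rightInvHom_π₁, Strict.assoc]))
    K.κ (Iso.refl K.π₂) (by
      refine Eq₂.eq (Eq₂.trans ?_ (Eq₂.comp_id' (.whiskerRight (.id _) _)).symm)
      exact (Eq₂.comp_eqToHom _ _).trans ((Eq₂.whiskerRight_id K.κ.hom).trans
        (Eq₂.eqToHom_comp _ _).symm))

theorem rightUnitHom_π₁ : Eq₂ ((rightUnitHom K).hom ▷ K.π₁) K.κ.hom :=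
  K.liftIso_π₁ _ _ _ _ _ _ _ _ _

theorem rightUnitHom_π₂ : IsIdentity ((rightUnitHom K).hom ▷ K.π₂) :=
  .of_eq₂ (K.liftIso_π₂ _ _ _ _ _ _ _ _ _) (.id _)

/-- The unit `1 ⟶ r⁻¹ r` of the right unitor. -/
noncomputable def rightUnit :
    SpanMap.id (compObj (unitSpan X) R K) ≅ (rightMap K).comp (rightInvMap K) :=
  SpanMap.isoMk (rightUnitHom K)
    (Eq₂.eq (calc
      Eq₂ _ ((rightUnitHom K).hom ▷ (K.π₁ ≫ 𝟙 X)) :=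
        Eq₂.id_comp' (SpanMap.id_ϖ (compObj (unitSpan X) R K))
      Eq₂ _ ((rightUnitHom K).hom ▷ K.π₁) := Eq₂.whiskerRight (Strict.comp_id _) (.refl _)
      Eq₂ _ K.κ.hom := rightUnitHom_π₁ K
      Eq₂ _ _ := (SpanMap.comp_ϖ_left (rightMap K) _ (rightInvMap_ϖ K)).symm))
    (IsIdentity.eq ((SpanMap.id_ϱ _).comp
        (.of_eq₂ (Eq₂.whiskerRight_comp _ _ _) ((rightUnitHom_π₂ K).whiskerRight _)))
      (.of_eq₂ (SpanMap.comp_ϱ_left _ _ (rightInvMap_ϱ K)) (rightMap_ϱ K)))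

/-- The 2-cell underlying the naturality 2-cell of the inverse right unitor. -/
noncomputable def rightInvNatHom (f : SpanMap R R') : f.hom ≫ rightInvHom K' ≅
    rightInvHom K ≫ compHom K K' (SpanMap.id (unitSpan X)) f :=
  K'.liftIso (s := eqToHom (Strict.comp_id (f.hom ≫ R'.p)))
    (t := eqToHom (Strict.comp_id R.p) ≫ f.ϖ.hom)
    (by rw [Strict.assoc, rightInvHom_π₁])
    ((congrArg (rightInvHom K ≫ ·) ((compHom_π₁ K K' _ f).trans (Strict.comp_id K.π₁))).trans
      (rightInvHom_π₁ K) |> (Strict.assoc _ _ _).trans)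
    (by rw [Strict.assoc, rightInvHom_π₂, Strict.comp_id])
    (by rw [Strict.assoc, compHom_π₂, ← Strict.assoc, rightInvHom_π₂, Strict.id_comp])
    (((((rightInvHom_κ K').whiskerLeft f.hom).of_eq₂ (Eq₂.comp_whiskerLeft _ _ _))).eq₂ (.eqToHom _)
      (by rw [Strict.assoc, ← Strict.assoc (rightInvHom K'), rightInvHom_π₁, Strict.assoc]))
    (calc
      Eq₂ _ (rightInvHom K ◁ compHom K K' (SpanMap.id (unitSpan X)) f ◁ K'.κ.hom) :=
        Eq₂.comp_whiskerLeft _ _ _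
      Eq₂ _ (rightInvHom K ◁ (K.κ.hom ≫ K.π₂ ◁ f.ϖ.hom)) :=
        Eq₂.whiskerLeft rfl (compHom_κ_right K K' _ f (SpanMap.id_ϱ _))
      Eq₂ _ (rightInvHom K ◁ K.κ.hom ≫ rightInvHom K ◁ K.π₂ ◁ f.ϖ.hom) := .of_eq (by simp)
      Eq₂ _ (rightInvHom K ◁ K.π₂ ◁ f.ϖ.hom) := Eq₂.id_comp' (rightInvHom_κ K)
      Eq₂ _ f.ϖ.hom := (Eq₂.whiskerLeft_comp_eq (rightInvHom_π₂ K) _).trans (Eq₂.id_whiskerLeft _)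
      Eq₂ _ (eqToHom (Strict.comp_id R.p) ≫ f.ϖ.hom) := (Eq₂.eqToHom_comp _ _).symm)
    f.ϖ.symm (Iso.refl f.hom) (by
      refine Eq₂.eq (Eq₂.trans (Eq₂.comp (Eq₂.whiskerRight_id f.ϖ.inv)
        (Eq₂.eqToHom_comp _ f.ϖ.hom)) ((Eq₂.of_eq f.ϖ.inv_hom_id).trans ?_))
      exact (IsIdentity.id _).eq₂' (.comp (.eqToHom _) (.whiskerRight (.id _) _)) rfl)

theorem rightInvNatHom_π₁ (f : SpanMap R R') :
    Eq₂ ((rightInvNatHom K K' f).hom ▷ K'.π₁) f.ϖ.inv :=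
  K'.liftIso_π₁ _ _ _ _ _ _ _ _ _

theorem rightInvNatHom_π₂ (f : SpanMap R R') :
    IsIdentity ((rightInvNatHom K K' f).hom ▷ K'.π₂) :=
  .of_eq₂ (K'.liftIso_π₂ _ _ _ _ _ _ _ _ _) (.id _)

/-- The naturality 2-cell of the inverse right unitor. -/
noncomputable def rightInvNat (f : SpanMap R R') : f.comp (rightInvMap K') ≅
    (rightInvMap K).comp (compMap K K' (SpanMap.id (unitSpan X)) f) :=
  SpanMap.isoMk (rightInvNatHom K K' f)
    (IsIdentity.eq (.of_eq₂ (calc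
        Eq₂ _ (f.ϖ.hom ≫ f.ϖ.inv) := Eq₂.comp (SpanMap.comp_ϖ_left _ _ (rightInvMap_ϖ K'))
          ((Eq₂.whiskerRight (Strict.comp_id K'.π₁) (.refl _)).trans (rightInvNatHom_π₁ K K' f))
        Eq₂ _ (𝟙 R.p) := .of_eq f.ϖ.hom_inv_id) (.id _))
      (.of_eq₂ ((SpanMap.comp_ϖ_right (rightInvMap K) _ (rightInvMap_ϖ K)).trans
        (Eq₂.whiskerLeft rfl (compMap_ϖ K K' _ f)))
        (((SpanMap.id_ϖ _).whiskerLeft _).whiskerLeft _)))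
    (Eq₂.eq (calc
      Eq₂ _ (f.comp (rightInvMap K')).ϱ.hom :=
        Eq₂.comp_id' (.of_eq₂ (Eq₂.whiskerRight_comp _ _ _)
          ((rightInvNatHom_π₂ K K' f).whiskerRight _))
      Eq₂ _ f.ϱ.hom := SpanMap.comp_ϱ_left _ _ (rightInvMap_ϱ K')
      Eq₂ _ (rightInvHom K ◁ K.π₂ ◁ f.ϱ.hom) :=
        ((Eq₂.whiskerLeft_comp_eq (rightInvHom_π₂ K) _).trans (Eq₂.id_whiskerLeft _)).symm
      Eq₂ _ _ := ((SpanMap.comp_ϱ_right (rightInvMap K) _ (rightInvMap_ϱ K)).trans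
        (Eq₂.whiskerLeft rfl (compMap_ϱ K K' _ f))).symm))

theorem rightInvNatHom_naturality {f g : SpanMap R R'} (γ : SpanMap₂ f g) :
    γ.hom ▷ rightInvHom K' ≫ (rightInvNatHom K K' g).hom =
      (rightInvNatHom K K' f).hom ≫ rightInvHom K ◁
        compMap₂Hom K K' (𝟙 (SpanMap.id (unitSpan X))) γ := by
  refine K'.hom_ext₂' (Eq₂.eq ?_) (Eq₂.eq ?_)
  · rw [comp_whiskerRight, comp_whiskerRight]
    have h₁ : γ.hom ▷ R'.p ≫ g.ϖ.inv = f.ϖ.inv := by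
      rw [Iso.comp_inv_eq, ← γ.w_p]; simp
    calc
      Eq₂ _ (γ.hom ▷ R'.p ≫ g.ϖ.inv) :=
        Eq₂.comp (Eq₂.whiskerRight_comp_eq (rightInvHom_π₁ K') _) (rightInvNatHom_π₁ K K' g)
      Eq₂ _ f.ϖ.inv := .of_eq h₁
      Eq₂ _ ((rightInvNatHom K K' f).hom ▷ K'.π₁) := (rightInvNatHom_π₁ K K' f).symm
      Eq₂ _ _ := (Eq₂.comp_id' (.of_eq₂ ((Eq₂.whisker_assoc _ _ _).trans
        (Eq₂.whiskerLeft rfl (compMap₂_π₁ K K' _ γ))) (((IsIdentity.id _).whiskerLeft _).whiskerLeft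
          _))).symm
  · rw [comp_whiskerRight, comp_whiskerRight]
    calc
      Eq₂ _ (γ.hom ▷ rightInvHom K' ▷ K'.π₂) := Eq₂.comp_id' (rightInvNatHom_π₂ K K' g)
      Eq₂ _ γ.hom := (Eq₂.whiskerRight_comp_eq (rightInvHom_π₂ K') _).trans (Eq₂.whiskerRight_id _)
      Eq₂ _ (rightInvHom K ◁ K.π₂ ◁ γ.hom) :=
        ((Eq₂.whiskerLeft_comp_eq (rightInvHom_π₂ K) _).trans (Eq₂.id_whiskerLeft _)).symm
      Eq₂ _ ((rightInvHom K ◁ compMap₂Hom K K' (𝟙 (SpanMap.id (unitSpan X))) γ) ▷ K'.π₂) :=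
        ((Eq₂.whisker_assoc _ _ _).trans (Eq₂.whiskerLeft rfl (compMap₂_π₂ K K' _ γ))).symm
      Eq₂ _ _ := (Eq₂.id_comp' (rightInvNatHom_π₂ K K' f)).symm

theorem rightInvNatHom_id : IsIdentity (rightInvNatHom K K (SpanMap.id R)).hom :=
  K.isIdentity (.of_eq₂ (rightInvNatHom_π₁ K K _) (SpanMap.id_ϖ R).inv)
    (rightInvNatHom_π₂ K K _)

theorem rightInvNatHom_comp (f : SpanMap R R') (g : SpanMap R' R'') :
    Eq₂ (rightInvNatHom K K'' (f.comp g)).hom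
      ((α_ _ _ _).hom ≫ f.hom ◁ (rightInvNatHom K' K'' g).hom ≫ (α_ _ _ _).inv ≫
        (rightInvNatHom K K' f).hom ▷ compHom K' K'' (SpanMap.id (unitSpan X)) g) := by
  refine Eq₂.trans ?_ (Eq₂.assoc_hom_comp _).symm
  have e₁ := Strict.assoc f.hom g.hom (rightInvHom K'')
  have e₂ : rightInvHom K ≫ compHom K K'' (SpanMap.id (unitSpan X)) (f.comp g) =
      (rightInvHom K ≫ compHom K K' (SpanMap.id (unitSpan X)) f) ≫
        compHom K' K'' (SpanMap.id (unitSpan X)) g := by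
    rw [Strict.assoc, ← compHom_comp]
    congr 2
    exact (Strict.comp_id (𝟙 (unitSpan X))).symm
  refine K''.hom_ext₂ e₁ e₂ ?_ ?_
  · rw [comp_whiskerRight, comp_whiskerRight]
    calc
      Eq₂ _ (f.hom ◁ g.ϖ.inv ≫ f.ϖ.inv) :=
        (rightInvNatHom_π₁ K K'' _).trans (SpanMap.comp_ϖ_inv f g)
      Eq₂ _ _ := Eq₂.symm (Eq₂.comp ((Eq₂.whisker_assoc _ _ _).trans
        (Eq₂.whiskerLeft rfl (rightInvNatHom_π₁ K' K'' g)))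
          ((Eq₂.id_comp' (.whiskerRight (.associator_inv _ _ _) _)).trans
            ((Eq₂.whiskerRight_comp_eq ((compHom_π₁ K' K'' _ g).trans (Strict.comp_id K'.π₁))
              _).trans (rightInvNatHom_π₁ K K' f))))
  · rw [comp_whiskerRight]
    refine (rightInvNatHom_π₂ K K'' _).eq₂ (.comp (.of_eq₂ (Eq₂.whisker_assoc _ _ _)
      (.whiskerLeft (rightInvNatHom_π₂ K' K'' g) _)) ?_)
      (congrArg (· ≫ K''.π₂) e₁)
    rw [comp_whiskerRight]
    refine .comp (.whiskerRight (.associator_inv _ _ _) _) (.of_eq₂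
      (Eq₂.whiskerRight_comp_congr (compHom_π₂ K' K'' _ g) _)
      ((rightInvNatHom_π₂ K K' f).whiskerRight _))

/-- The unit of the right unitor is a modification: its compatibility with a map of spans. -/
theorem rightUnitHom_naturality (f : SpanMap R R')
    {N : compHom K K' (SpanMap.id (unitSpan X)) f ≫ K'.π₂ ≫ rightInvHom K' ⟶
      (K.π₂ ≫ rightInvHom K) ≫ compHom K K' (SpanMap.id (unitSpan X)) f}
    (hN : Eq₂ N (K.π₂ ◁ (rightInvNatHom K K' f).hom)) :
    Eq₂ (compHom K K' (SpanMap.id (unitSpan X)) f ◁ (rightUnitHom K').hom ≫ N)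
      ((rightUnitHom K).hom ▷ compHom K K' (SpanMap.id (unitSpan X)) f) := by
  have e₁ : compHom K K' (SpanMap.id (unitSpan X)) f ≫ 𝟙 K'.pt =
      𝟙 K.pt ≫ compHom K K' (SpanMap.id (unitSpan X)) f := by rw [Strict.comp_id, Strict.id_comp]
  refine K'.hom_ext₂ e₁ rfl ?_ ?_
  · rw [comp_whiskerRight]
    calc
      Eq₂ _ ((K.κ.hom ≫ K.π₂ ◁ f.ϖ.hom) ≫ K.π₂ ◁ f.ϖ.inv) :=
        Eq₂.comp ((Eq₂.whisker_assoc _ _ _).trans ((Eq₂.whiskerLeft rfl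
          (rightUnitHom_π₁ K')).trans (compHom_κ_right K K' _ f (SpanMap.id_ϱ _))))
          ((Eq₂.whiskerRight rfl hN).trans ((Eq₂.whisker_assoc _ _ _).trans
            (Eq₂.whiskerLeft rfl (rightInvNatHom_π₁ K K' f))))
      Eq₂ _ K.κ.hom := .of_eq (by
        rw [Category.assoc, ← Bicategory.whiskerLeft_comp, Iso.hom_inv_id]
        simp)
      Eq₂ _ ((rightUnitHom K).hom ▷ K.π₁) := (rightUnitHom_π₁ K).symm
      Eq₂ _ _ := (Eq₂.whiskerRight_comp_eq ((compHom_π₁ K K' _ f).trans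
        (Strict.comp_id K.π₁)) _).symm
  · rw [comp_whiskerRight]
    refine IsIdentity.eq₂ (.comp (.of_eq₂ (Eq₂.whisker_assoc _ _ _)
      ((rightUnitHom_π₂ K').whiskerLeft _)) (.of_eq₂ ((Eq₂.whiskerRight rfl hN).trans
        (Eq₂.whisker_assoc _ _ _)) ((rightInvNatHom_π₂ K K' f).whiskerLeft _)))
      (.of_eq₂ (Eq₂.whiskerRight_comp_congr (compHom_π₂ K K' _ f) _)
        ((rightUnitHom_π₂ K).whiskerRight _)) (by rw [e₁])

end RightUnitor

/-! ### The adjoint equivalences of the tricategory of spans -/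

section Equivalences

open TriBase TwoFunctor

variable {B : Type u} [Bicategory.{w, v} B] [Strict B]
  (pb : ∀ {X Y Z : B} (f : X ⟶ Z) (g : Y ⟶ Z), IsoComma f g) (W X Y Z : B)

/-- The associator of spans, as a strict transformation. -/
noncomputable def assocTrans :
    (tensor (tensor ((spanBase pb).q₁ W X Y Z) ((spanBase pb).q₂ W X Y Z))
      ((spanBase pb).q₃ W X Y Z)).toPs ⟶
    (tensor ((spanBase pb).q₁ W X Y Z) (tensor ((spanBase pb).q₂ W X Y Z)
      ((spanBase pb).q₃ W X Y Z))).toPs :=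
  mkStrict (fun P => assocMap (R := P.1.1) (S := P.1.2) (U := P.2) (pb _ _) (pb _ _) (pb _ _)
      (pb _ _))
    (fun f => assocMap_naturality _ _ _ _ _ _ _ _ f.1.1 f.1.2 f.2)
    (fun {_ _ f g} θ => Span.eq₂_of_hom
      (assocMap_naturality _ _ _ _ _ _ _ _ f.1.1 f.1.2 f.2)
      (assocMap_naturality _ _ _ _ _ _ _ _ g.1.1 g.1.2 g.2)
      (assocHom_naturality₂ _ _ _ _ _ _ _ _ θ.1.1 θ.1.2 θ.2))

theorem isStrict_assocTrans : IsStrict (assocTrans pb W X Y Z) := fun f =>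
  IsIdentity.eqToHom (assocMap_naturality _ _ _ _ _ _ _ _ f.1.1 f.1.2 f.2)

/-- The inverse associator of spans, as a strict transformation. -/
noncomputable def assocInvTrans :
    (tensor ((spanBase pb).q₁ W X Y Z) (tensor ((spanBase pb).q₂ W X Y Z)
      ((spanBase pb).q₃ W X Y Z))).toPs ⟶
    (tensor (tensor ((spanBase pb).q₁ W X Y Z) ((spanBase pb).q₂ W X Y Z))
      ((spanBase pb).q₃ W X Y Z)).toPs :=
  mkStrict (fun P => assocInvMap (R := P.1.1) (S := P.1.2) (U := P.2) (pb _ _) (pb _ _) (pb _ _)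
      (pb _ _))
    (inverse_naturality (assocTrans pb W X Y Z) (isStrict_assocTrans pb W X Y Z) _
      (fun _ => assocMap_inv _ _ _ _) (fun _ => assocInvMap_assocMap _ _ _ _))
    (inverse_naturality₂ (assocTrans pb W X Y Z) (isStrict_assocTrans pb W X Y Z) _
      (fun _ => assocMap_inv _ _ _ _) (fun _ => assocInvMap_assocMap _ _ _ _))

theorem isStrict_assocInvTrans : IsStrict (assocInvTrans pb W X Y Z) := fun f =>
  IsIdentity.eqToHom (inverse_naturality (assocTrans pb W X Y Z) (isStrict_assocTrans pb W X Y Z) _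
    (fun _ => assocMap_inv _ _ _ _) (fun _ => assocInvMap_assocMap _ _ _ _) f)

/-- The associator of spans, as a strict adjoint equivalence. -/
noncomputable def assocEquivalence : Bicategory.Equivalence
    (tensor (tensor ((spanBase pb).q₁ W X Y Z) ((spanBase pb).q₂ W X Y Z))
      ((spanBase pb).q₃ W X Y Z)).toPs
    (tensor ((spanBase pb).q₁ W X Y Z) (tensor ((spanBase pb).q₂ W X Y Z)
      ((spanBase pb).q₃ W X Y Z))).toPs := strictEquivalence (assocTrans pb W X Y Z)
  (assocInvTrans pb W X Y Z)
  (IsStrict.ext (IsStrict.id _)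
    (IsStrict.comp (isStrict_assocTrans pb W X Y Z) (isStrict_assocInvTrans pb W X Y Z))
    (fun _ => (assocMap_inv _ _ _ _).symm))
  (IsStrict.ext (IsStrict.comp (isStrict_assocInvTrans pb W X Y Z) (isStrict_assocTrans pb W X Y Z))
    (IsStrict.id _)
    (fun _ => assocInvMap_assocMap _ _ _ _))

theorem isStrictEquivalence_assocEquivalence : IsStrictEquivalence (assocEquivalence pb W X Y Z) :=
  isStrictEquivalence_strictEquivalence (isStrict_assocTrans pb W X Y Z)
    (isStrict_assocInvTrans pb W X Y Z) _ _

/-- The left unitor of spans, as a strict transformation. -/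
noncomputable def leftTrans :
    (tensor (TwoFunctor.id ((spanBase pb).Hom X Y))
      ((spanBase pb).unitF ((spanBase pb).Hom X Y) Y)).toPs ⟶
    (TwoFunctor.id ((spanBase pb).Hom X Y)).toPs :=
  mkStrict (fun R => leftMap (R := R) (pb _ _))
    (fun f => leftMap_naturality _ _ f)
    (fun {_ _ f g} θ => by
      refine Span.eq₂_of_hom (leftMap_naturality _ _ f) (leftMap_naturality _ _ g) ?_
      exact compMap₂_π₁ _ _ θ (𝟙 (SpanMap.id (unitSpan Y))))

theorem isStrict_leftTrans : IsStrict (leftTrans pb X Y) := fun f =>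
  ⟨leftMap_naturality _ _ f, rfl⟩

/-- The inverse left unitor of spans, as a strong transformation. -/
noncomputable def leftInvTrans : (TwoFunctor.id ((spanBase pb).Hom X Y)).toPs ⟶
    (tensor (TwoFunctor.id ((spanBase pb).Hom X Y))
      ((spanBase pb).unitF ((spanBase pb).Hom X Y) Y)).toPs :=
  mkTrans (fun R => leftInvMap (R := R) (pb _ _))
    (fun f => leftInvNat _ _ f)
    (fun θ => Span.hom₂_ext (leftInvNatHom_naturality _ _ θ))
    (fun _ => Span.isIdentity (leftInvNatHom_id _))
    (fun f g => Span.eq₂_of_hom rfl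
      ((congrArg (leftInvMap (pb _ _) ≫ ·) (StrictPseudofunctorPreCore.map_comp
        (tensor (TwoFunctor.id ((spanBase pb).Hom X Y))
          ((spanBase pb).unitF ((spanBase pb).Hom X Y) Y)) f g)).trans (Strict.assoc _ _ _).symm)
      (leftInvNatHom_comp _ _ _ f g))

/-- The unit of the left unitor, as an invertible modification. -/
noncomputable def leftUnitModification :
    𝟙 (tensor (TwoFunctor.id ((spanBase pb).Hom X Y))
      ((spanBase pb).unitF ((spanBase pb).Hom X Y) Y)).toPs ≅
      leftTrans pb X Y ≫ leftInvTrans pb X Y :=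
  Pseudofunctor.StrongTrans.isoMk (fun R => leftUnit (R := R) (pb _ _)) (fun {_ _} f => by
    refine Span.hom₂_ext (Eq₂.eq ((leftUnitHom_naturality _ _ f (Span.eq₂_hom
      (IsStrict.comp_naturality_left (isStrict_leftTrans pb X Y) (leftInvTrans pb X Y) f))).trans
        (Eq₂.symm ?_)))
    exact Eq₂.id_comp' (Span.isIdentity_hom (IsStrict.id
      (tensor (TwoFunctor.id ((spanBase pb).Hom X Y))
          ((spanBase pb).unitF ((spanBase pb).Hom X Y) Y)) f)))

theorem leftInvTrans_comp : leftInvTrans pb X Y ≫ leftTrans pb X Y =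
    𝟙 (TwoFunctor.id ((spanBase pb).Hom X Y)).toPs :=
  IsStrict.ext (fun f => .of_eq₂ (IsStrict.comp_naturality_right _ (isStrict_leftTrans pb X Y) f)
    (Span.isIdentity (leftInvNatHom_π₁ _ _ f))) (IsStrict.id _) (fun _ => leftInvMap_comp _)

/-- The left unitor of spans, as an adjoint equivalence. -/
noncomputable def leftEquivalence : Bicategory.Equivalence
    (tensor (TwoFunctor.id ((spanBase pb).Hom X Y))
      ((spanBase pb).unitF ((spanBase pb).Hom X Y) Y)).toPs
    (TwoFunctor.id ((spanBase pb).Hom X Y)).toPs :=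
  mkEquivalence (leftTrans pb X Y) (leftInvTrans pb X Y) (leftUnitModification pb X Y)
    (eqToIso (leftInvTrans_comp pb X Y)) (fun _ => by
      refine IsIdentity.comp ?_ (IsIdentity.comp ?_ ?_)
      · exact Span.isIdentity (leftUnitHom_π₁ _)
      · exact IsIdentity.associator _ _ _
      · exact (isIdentity_as_app (IsIdentity.eqToHom (leftInvTrans_comp pb X Y)) _).whiskerLeft _)

/-- The right unitor of spans, as a strict transformation. -/
noncomputable def rightTrans :
    (tensor ((spanBase pb).unitF ((spanBase pb).Hom X Y) X)
      (TwoFunctor.id ((spanBase pb).Hom X Y))).toPs ⟶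
    (TwoFunctor.id ((spanBase pb).Hom X Y)).toPs :=
  mkStrict (fun R => rightMap (R := R) (pb _ _))
    (fun f => rightMap_naturality _ _ f)
    (fun {_ _ f g} θ => by
      refine Span.eq₂_of_hom (rightMap_naturality _ _ f) (rightMap_naturality _ _ g) ?_
      exact compMap₂_π₂ _ _ (𝟙 (SpanMap.id (unitSpan X))) θ)

theorem isStrict_rightTrans : IsStrict (rightTrans pb X Y) := fun f =>
  ⟨rightMap_naturality _ _ f, rfl⟩

/-- The inverse right unitor of spans, as a strong transformation. -/
noncomputable def rightInvTrans : (TwoFunctor.id ((spanBase pb).Hom X Y)).toPs ⟶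
    (tensor ((spanBase pb).unitF ((spanBase pb).Hom X Y) X)
      (TwoFunctor.id ((spanBase pb).Hom X Y))).toPs :=
  mkTrans (fun R => rightInvMap (R := R) (pb _ _))
    (fun f => rightInvNat _ _ f)
    (fun θ => Span.hom₂_ext (rightInvNatHom_naturality _ _ θ))
    (fun _ => Span.isIdentity (rightInvNatHom_id _))
    (fun f g => Span.eq₂_of_hom rfl
      ((congrArg (rightInvMap (pb _ _) ≫ ·) (StrictPseudofunctorPreCore.map_comp
        (tensor ((spanBase pb).unitF ((spanBase pb).Hom X Y) X)
          (TwoFunctor.id ((spanBase pb).Hom X Y))) f g)).trans (Strict.assoc _ _ _).symm)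
      (rightInvNatHom_comp _ _ _ f g))

/-- The unit of the right unitor, as an invertible modification. -/
noncomputable def rightUnitModification :
    𝟙 (tensor ((spanBase pb).unitF ((spanBase pb).Hom X Y) X)
      (TwoFunctor.id ((spanBase pb).Hom X Y))).toPs ≅
      rightTrans pb X Y ≫ rightInvTrans pb X Y :=
  Pseudofunctor.StrongTrans.isoMk (fun R => rightUnit (R := R) (pb _ _)) (fun {_ _} f => by
    refine Span.hom₂_ext (Eq₂.eq ((rightUnitHom_naturality _ _ f (Span.eq₂_hom
      (IsStrict.comp_naturality_left (isStrict_rightTrans pb X Y) (rightInvTrans pb X Y) f))).trans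
        (Eq₂.symm ?_)))
    exact Eq₂.id_comp' (Span.isIdentity_hom (IsStrict.id
      (tensor ((spanBase pb).unitF ((spanBase pb).Hom X Y) X)
          (TwoFunctor.id ((spanBase pb).Hom X Y))) f)))

theorem rightInvTrans_comp : rightInvTrans pb X Y ≫ rightTrans pb X Y =
    𝟙 (TwoFunctor.id ((spanBase pb).Hom X Y)).toPs :=
  IsStrict.ext (fun f => .of_eq₂ (IsStrict.comp_naturality_right _ (isStrict_rightTrans pb X Y) f)
    (Span.isIdentity (rightInvNatHom_π₂ _ _ f))) (IsStrict.id _) (fun _ => rightInvMap_comp _)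

/-- The right unitor of spans, as an adjoint equivalence. -/
noncomputable def rightEquivalence : Bicategory.Equivalence
    (tensor ((spanBase pb).unitF ((spanBase pb).Hom X Y) X)
      (TwoFunctor.id ((spanBase pb).Hom X Y))).toPs
    (TwoFunctor.id ((spanBase pb).Hom X Y)).toPs :=
  mkEquivalence (rightTrans pb X Y) (rightInvTrans pb X Y) (rightUnitModification pb X Y)
    (eqToIso (rightInvTrans_comp pb X Y)) (fun _ => by
      refine IsIdentity.comp ?_ (IsIdentity.comp ?_ ?_)
      · exact Span.isIdentity (rightUnitHom_π₂ _)
      · exact IsIdentity.associator _ _ _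
      · exact (isIdentity_as_app (IsIdentity.eqToHom (rightInvTrans_comp pb X Y)) _).whiskerLeft _)

/-- The associator and unitors of the tricategory of spans. -/
noncomputable def spanAdj : TriAdj (spanBase pb) where
  assoc := assocEquivalence pb
  left := leftEquivalence pb
  right := rightEquivalence pb

end Equivalences

/-! ### The equations between the components of the associator and the unitors -/

section

variable {B : Type u} [Bicategory.{w, v} B] [Strict B]

theorem Eq₂.whiskerLeft_comp₃_congr {V W X Y Z Z' : B} {f g : X ⟶ Y} {k : V ⟶ W} {l : W ⟶ Z}
    {m : Z ⟶ X} {k' : V ⟶ Z'} {l' : Z' ⟶ X} (h : k ≫ l ≫ m = k' ≫ l') (α : f ⟶ g) :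
    Eq₂ (k ◁ l ◁ m ◁ α) (k' ◁ l' ◁ α) :=
  (Eq₂.whiskerLeft rfl (Eq₂.whiskerLeft_comp_eq rfl α)).trans (Eq₂.whiskerLeft_comp_congr h α)

namespace SpanMap

variable {X Y : B} {R S T : Span X Y}

theorem comp_ϖ_isIdentity (f : SpanMap R S) (g : SpanMap S T) (hf : IsIdentity f.ϖ.hom)
    (hg : IsIdentity g.ϖ.hom) : IsIdentity (f.comp g).ϖ.hom :=
  .of_eq₂ (comp_ϖ_left f g hg) hf

theorem comp_ϱ_isIdentity (f : SpanMap R S) (g : SpanMap S T) (hf : IsIdentity f.ϱ.hom)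
    (hg : IsIdentity g.ϱ.hom) : IsIdentity (f.comp g).ϱ.hom :=
  .of_eq₂ (comp_ϱ_left f g hg) hf

end SpanMap

section

variable {X Y Z : B} {R R' : Span X Y} {S S' : Span Y Z}
  (K : IsoComma R.q S.p) (K' : IsoComma R'.q S'.p)

theorem compMap_ϖ_isIdentity (f : SpanMap R R') (g : SpanMap S S') (hf : IsIdentity f.ϖ.hom) :
    IsIdentity (compMap K K' f g).ϖ.hom :=
  .of_eq₂ (compMap_ϖ K K' f g) (hf.whiskerLeft _)

theorem compMap_ϱ_isIdentity (f : SpanMap R R') (g : SpanMap S S') (hg : IsIdentity g.ϱ.hom) :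
    IsIdentity (compMap K K' f g).ϱ.hom :=
  .of_eq₂ (compMap_ϱ K K' f g) (hg.whiskerLeft _)

end

/-! #### The pentagon -/

section Pentagon

variable {V W X Y Z : B} {R : Span V W} {S : Span W X} {T : Span X Y} {U : Span Y Z}
  (K : IsoComma R.q S.p) (L : IsoComma S.q T.p) (Q : IsoComma T.q U.p)
  -- iso-comma objects for `(R * S) * T`, `R * (S * T)`, `(S * T) * U` and `S * (T * U)`
  (M : IsoComma (K.π₂ ≫ S.q) T.p) (N : IsoComma R.q (L.π₁ ≫ S.p))
  (M' : IsoComma (L.π₂ ≫ T.q) U.p) (N' : IsoComma S.q (Q.π₁ ≫ T.p))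
  -- iso-comma objects for the five bracketings `((R * S) * T) * U`, `(R * (S * T)) * U`,
  -- `R * ((S * T) * U)`, `R * (S * (T * U))` and `(R * S) * (T * U)`
  (A₁ : IsoComma (M.π₂ ≫ T.q) U.p) (A₂ : IsoComma (N.π₂ ≫ L.π₂ ≫ T.q) U.p)
  (A₃ : IsoComma R.q (M'.π₁ ≫ L.π₁ ≫ S.p)) (A₄ : IsoComma R.q (N'.π₁ ≫ S.p))
  (A₅ : IsoComma (K.π₂ ≫ S.q) (Q.π₁ ≫ T.p))

theorem assocHom_pentagon :
    compHom (R := compObj (compObj R S K) T M) (R' := compObj R (compObj S T L) N) A₁ A₂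
        (assocMap K L M N) (SpanMap.id U) ≫
      assocHom (S := compObj S T L) N M' A₂ A₃ ≫
        compHom (S := compObj (compObj S T L) U M') (S' := compObj S (compObj T U Q) N') A₃ A₄
          (SpanMap.id R) (assocMap L Q M' N') =
    assocHom (R := compObj R S K) M Q A₁ A₅ ≫ assocHom (U := compObj T U Q) K N' A₅ A₄ := by
  set h₁ := compHom (R := compObj (compObj R S K) T M) (R' := compObj R (compObj S T L) N) A₁ A₂
    (assocMap K L M N) (SpanMap.id U)
  set h₂ := assocHom (S := compObj S T L) N M' A₂ A₃
  set h₃ := compHom (S := compObj (compObj S T L) U M') (S' := compObj S (compObj T U Q) N') A₃ A₄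
    (SpanMap.id R) (assocMap L Q M' N')
  set g₁ := assocHom (R := compObj R S K) M Q A₁ A₅
  set g₂ := assocHom (U := compObj T U Q) K N' A₅ A₄
  have h₁π₁ : h₁ ≫ A₂.π₁ = A₁.π₁ ≫ assocHom K L M N := compHom_π₁ _ _ _ _
  have h₁π₂ : h₁ ≫ A₂.π₂ = A₁.π₂ := (compHom_π₂ _ _ _ _).trans (Strict.comp_id _)
  have h₁κ : Eq₂ (h₁ ◁ A₂.κ.hom) A₁.κ.hom :=
    compHom_κ_id _ _ _ _ (assocMap_ϱ K L M N) (SpanMap.id_ϖ U)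
  have h₂π₁ : h₂ ≫ A₃.π₁ = A₂.π₁ ≫ N.π₁ := assocHom_π₁ _ _ _ _
  have h₂π₂π₁ : h₂ ≫ A₃.π₂ ≫ M'.π₁ = A₂.π₁ ≫ N.π₂ :=
    assocHom_π₂_π₁ (S := compObj S T L) _ _ _ _
  have h₂π₂π₂ : h₂ ≫ A₃.π₂ ≫ M'.π₂ = A₂.π₂ := assocHom_π₂_π₂ (S := compObj S T L) _ _ _ _
  have h₂κ : Eq₂ (h₂ ◁ A₃.κ.hom) (A₂.π₁ ◁ N.κ.hom) := assocHom_κ (S := compObj S T L) _ _ _ _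
  have h₂κ' : Eq₂ (h₂ ◁ A₃.π₂ ◁ M'.κ.hom) A₂.κ.hom := assocHom_π₂_κ (S := compObj S T L) _ _ _ _
  have h₃π₁ : h₃ ≫ A₄.π₁ = A₃.π₁ := (compHom_π₁ _ _ _ _).trans (Strict.comp_id _)
  have h₃π₂ : h₃ ≫ A₄.π₂ = A₃.π₂ ≫ assocHom L Q M' N' := compHom_π₂ _ _ _ _
  have h₃κ : Eq₂ (h₃ ◁ A₄.κ.hom) A₃.κ.hom :=
    compHom_κ_id _ _ _ _ (SpanMap.id_ϱ R) (assocMap_ϖ L Q M' N')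
  have g₁π₁ : g₁ ≫ A₅.π₁ = A₁.π₁ ≫ M.π₁ := assocHom_π₁ _ _ _ _
  have g₁π₂π₁ : g₁ ≫ A₅.π₂ ≫ Q.π₁ = A₁.π₁ ≫ M.π₂ := assocHom_π₂_π₁ (R := compObj R S K) _ _ _ _
  have g₁π₂π₂ : g₁ ≫ A₅.π₂ ≫ Q.π₂ = A₁.π₂ := assocHom_π₂_π₂ (R := compObj R S K) _ _ _ _
  have g₁κ : Eq₂ (g₁ ◁ A₅.κ.hom) (A₁.π₁ ◁ M.κ.hom) := assocHom_κ (R := compObj R S K) _ _ _ _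
  have g₁κ' : Eq₂ (g₁ ◁ A₅.π₂ ◁ Q.κ.hom) A₁.κ.hom := assocHom_π₂_κ (R := compObj R S K) _ _ _ _
  have g₂π₁ : g₂ ≫ A₄.π₁ = A₅.π₁ ≫ K.π₁ := assocHom_π₁ _ _ _ _
  have g₂π₂π₁ : g₂ ≫ A₄.π₂ ≫ N'.π₁ = A₅.π₁ ≫ K.π₂ :=
    assocHom_π₂_π₁ (U := compObj T U Q) _ _ _ _
  have g₂π₂π₂ : g₂ ≫ A₄.π₂ ≫ N'.π₂ = A₅.π₂ := assocHom_π₂_π₂ (U := compObj T U Q) _ _ _ _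
  have g₂κ : Eq₂ (g₂ ◁ A₄.κ.hom) (A₅.π₁ ◁ K.κ.hom) := assocHom_κ (U := compObj T U Q) _ _ _ _
  have g₂κ' : Eq₂ (g₂ ◁ A₄.π₂ ◁ N'.κ.hom) A₅.κ.hom := assocHom_π₂_κ (U := compObj T U Q) _ _ _ _
  clear_value h₁ h₂ h₃ g₁ g₂
  have h₃π₂' {C : B} (x : N'.pt ⟶ C) :
      h₃ ≫ A₄.π₂ ≫ x = A₃.π₂ ≫ assocHom L Q M' N' ≫ x := by
    rw [← Strict.assoc, h₃π₂, Strict.assoc]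
  have h₁π₁' {C : B} (x : N.pt ⟶ C) :
      h₁ ≫ A₂.π₁ ≫ x = A₁.π₁ ≫ assocHom K L M N ≫ x := by
    rw [← Strict.assoc, h₁π₁, Strict.assoc]
  -- Compare the projections to `R`, `S`, `T`, `U` and the comma 2-cells of `S`, `T`, of
  -- `T`, `U` and of `R`, `S`, in this order.
  refine A₄.hom_ext ?_ (hom_ext_right (L := Q) (N := N') ?_ ?_ ?_ ?_ ?_) ?_
  · rw [Strict.assoc, Strict.assoc, Strict.assoc, h₃π₁, h₂π₁, h₁π₁', assocHom_π₁, g₂π₁,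
      ← Strict.assoc g₁, g₁π₁, Strict.assoc]
  · simp only [Strict.assoc]
    rw [h₃π₂', assocHom_π₁, ← Strict.assoc A₃.π₂, ← Strict.assoc h₂, h₂π₂π₁, Strict.assoc, h₁π₁',
      assocHom_π₂_π₁, g₂π₂π₁, ← Strict.assoc g₁, g₁π₁, Strict.assoc]
  · simp only [Strict.assoc]
    rw [h₃π₂', assocHom_π₂_π₁, ← Strict.assoc A₃.π₂, ← Strict.assoc h₂, h₂π₂π₁, Strict.assoc,
      h₁π₁', assocHom_π₂_π₂, ← Strict.assoc A₄.π₂, ← Strict.assoc g₂, g₂π₂π₂, g₁π₂π₁]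
  · simp only [Strict.assoc]
    rw [h₃π₂', assocHom_π₂_π₂, h₂π₂π₂, h₁π₂, ← Strict.assoc A₄.π₂, ← Strict.assoc g₂, g₂π₂π₂,
      g₁π₂π₂]
  · calc
      Eq₂ (((h₁ ≫ h₂ ≫ h₃) ≫ A₄.π₂) ◁ N'.κ.hom) (h₁ ◁ h₂ ◁ h₃ ◁ A₄.π₂ ◁ N'.κ.hom) :=
        (Eq₂.comp_whiskerLeft _ _ _).trans ((Eq₂.comp_whiskerLeft _ _ _).trans
          (Eq₂.whiskerLeft rfl (Eq₂.comp_whiskerLeft _ _ _)))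
      Eq₂ _ (h₁ ◁ h₂ ◁ A₃.π₂ ◁ assocHom L Q M' N' ◁ N'.κ.hom) :=
        Eq₂.whiskerLeft rfl (Eq₂.whiskerLeft rfl (Eq₂.whiskerLeft_comp_congr h₃π₂ _))
      Eq₂ _ (h₁ ◁ h₂ ◁ A₃.π₂ ◁ M'.π₁ ◁ L.κ.hom) :=
        Eq₂.whiskerLeft rfl (Eq₂.whiskerLeft rfl (Eq₂.whiskerLeft rfl (assocHom_κ L Q M' N')))
      Eq₂ _ (h₁ ◁ A₂.π₁ ◁ N.π₂ ◁ L.κ.hom) :=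
        Eq₂.whiskerLeft rfl (Eq₂.whiskerLeft_comp₃_congr h₂π₂π₁ _)
      Eq₂ _ (A₁.π₁ ◁ assocHom K L M N ◁ N.π₂ ◁ L.κ.hom) := Eq₂.whiskerLeft_comp_congr h₁π₁ _
      Eq₂ _ (A₁.π₁ ◁ M.κ.hom) := Eq₂.whiskerLeft rfl (assocHom_π₂_κ K L M N)
      Eq₂ _ (g₁ ◁ A₅.κ.hom) := g₁κ.symm
      Eq₂ _ (g₁ ◁ g₂ ◁ A₄.π₂ ◁ N'.κ.hom) := Eq₂.whiskerLeft rfl g₂κ'.symm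
      Eq₂ _ _ := ((Eq₂.comp_whiskerLeft _ _ _).trans (Eq₂.comp_whiskerLeft _ _ _)).symm
  · calc
      Eq₂ (((h₁ ≫ h₂ ≫ h₃) ≫ A₄.π₂) ◁ N'.π₂ ◁ Q.κ.hom) (h₁ ◁ h₂ ◁ h₃ ◁ A₄.π₂ ◁ N'.π₂ ◁ Q.κ.hom) :=
        (Eq₂.comp_whiskerLeft _ _ _).trans ((Eq₂.comp_whiskerLeft _ _ _).trans
          (Eq₂.whiskerLeft rfl (Eq₂.comp_whiskerLeft _ _ _)))
      Eq₂ _ (h₁ ◁ h₂ ◁ A₃.π₂ ◁ assocHom L Q M' N' ◁ N'.π₂ ◁ Q.κ.hom) :=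
        Eq₂.whiskerLeft rfl (Eq₂.whiskerLeft rfl (Eq₂.whiskerLeft_comp_congr h₃π₂ _))
      Eq₂ _ (h₁ ◁ h₂ ◁ A₃.π₂ ◁ M'.κ.hom) :=
        Eq₂.whiskerLeft rfl (Eq₂.whiskerLeft rfl (Eq₂.whiskerLeft rfl (assocHom_π₂_κ L Q M' N')))
      Eq₂ _ (h₁ ◁ A₂.κ.hom) := Eq₂.whiskerLeft rfl h₂κ'
      Eq₂ _ A₁.κ.hom := h₁κ
      Eq₂ _ (g₁ ◁ A₅.π₂ ◁ Q.κ.hom) := g₁κ'.symm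
      Eq₂ _ (g₁ ◁ g₂ ◁ A₄.π₂ ◁ N'.π₂ ◁ Q.κ.hom) := Eq₂.whiskerLeft rfl
        ((Eq₂.whiskerLeft rfl (Eq₂.whiskerLeft_comp_eq rfl _)).trans
          (Eq₂.whiskerLeft_comp_eq g₂π₂π₂ _)).symm
      Eq₂ _ _ := ((Eq₂.comp_whiskerLeft _ _ _).trans (Eq₂.comp_whiskerLeft _ _ _)).symm
  · calc
      Eq₂ ((h₁ ≫ h₂ ≫ h₃) ◁ A₄.κ.hom) (h₁ ◁ h₂ ◁ h₃ ◁ A₄.κ.hom) :=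
        (Eq₂.comp_whiskerLeft _ _ _).trans (Eq₂.whiskerLeft rfl (Eq₂.comp_whiskerLeft _ _ _))
      Eq₂ _ (h₁ ◁ h₂ ◁ A₃.κ.hom) := Eq₂.whiskerLeft rfl (Eq₂.whiskerLeft rfl h₃κ)
      Eq₂ _ (h₁ ◁ A₂.π₁ ◁ N.κ.hom) := Eq₂.whiskerLeft rfl h₂κ
      Eq₂ _ (A₁.π₁ ◁ assocHom K L M N ◁ N.κ.hom) := Eq₂.whiskerLeft_comp_congr h₁π₁ _
      Eq₂ _ (A₁.π₁ ◁ M.π₁ ◁ K.κ.hom) := Eq₂.whiskerLeft rfl (assocHom_κ K L M N)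
      Eq₂ _ (g₁ ◁ A₅.π₁ ◁ K.κ.hom) := (Eq₂.whiskerLeft_comp_congr g₁π₁ _).symm
      Eq₂ _ (g₁ ◁ g₂ ◁ A₄.κ.hom) := Eq₂.whiskerLeft rfl g₂κ.symm
      Eq₂ _ _ := (Eq₂.comp_whiskerLeft _ _ _).symm

theorem assocMap_pentagon :
    (compMap (R := compObj (compObj R S K) T M) (R' := compObj R (compObj S T L) N) A₁ A₂
        (assocMap K L M N) (SpanMap.id U)).comp
      ((assocMap (S := compObj S T L) N M' A₂ A₃).comp
        (compMap (S := compObj (compObj S T L) U M') (S' := compObj S (compObj T U Q) N') A₃ A₄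
          (SpanMap.id R) (assocMap L Q M' N'))) =
    (assocMap (R := compObj R S K) M Q A₁ A₅).comp (assocMap (U := compObj T U Q) K N' A₅ A₄) :=
  SpanMap.hom_ext (assocHom_pentagon K L Q M N M' N' A₁ A₂ A₃ A₄ A₅)
    ((SpanMap.comp_ϖ_isIdentity _ _ (compMap_ϖ_isIdentity _ _ _ _ (assocMap_ϖ _ _ _ _))
      (SpanMap.comp_ϖ_isIdentity _ _ (assocMap_ϖ _ _ _ _)
        (compMap_ϖ_isIdentity _ _ _ _ (SpanMap.id_ϖ _)))).eq₂
      (SpanMap.comp_ϖ_isIdentity _ _ (assocMap_ϖ _ _ _ _) (assocMap_ϖ _ _ _ _)) rfl)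
    ((SpanMap.comp_ϱ_isIdentity _ _ (compMap_ϱ_isIdentity _ _ _ _ (SpanMap.id_ϱ _))
      (SpanMap.comp_ϱ_isIdentity _ _ (assocMap_ϱ _ _ _ _)
        (compMap_ϱ_isIdentity _ _ _ _ (assocMap_ϱ _ _ _ _)))).eq₂
      (SpanMap.comp_ϱ_isIdentity _ _ (assocMap_ϱ _ _ _ _) (assocMap_ϱ _ _ _ _)) rfl)

end Pentagon

/-! #### The unit triangles -/

section Units

variable {X Y Z : B} {R : Span X Y} {S : Span Y Z}

/-- The triangle on `R * (S * I)`: the left unitor of a composite is the left unitor of its second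
factor. -/
theorem compMap_leftMap (K : IsoComma R.q S.p) (L : IsoComma S.q (unitSpan Z).p)
    (M : IsoComma (K.π₂ ≫ S.q) (unitSpan Z).p) (N : IsoComma R.q (L.π₁ ≫ S.p)) :
    compMap (S := compObj S (unitSpan Z) L) N K (SpanMap.id R) (leftMap L) =
      (assocInvMap K L M N).comp (leftMap (R := compObj R S K) M) := by
  refine SpanMap.hom_ext (K.hom_ext ?_ ?_ ?_) ?_ ?_
  · exact (compHom_π₁ (S := compObj S (unitSpan Z) L) N K _ _).trans ((Strict.comp_id _).trans
      ((Strict.assoc _ _ _).trans (assocInv_π₁_π₁ K L M N)).symm)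
  · exact (compHom_π₂ (S := compObj S (unitSpan Z) L) N K _ _).trans
      ((Strict.assoc _ _ _).trans (assocInv_π₁_π₂ K L M N)).symm
  · exact (compHom_κ_id (S := compObj S (unitSpan Z) L) N K _ _ (SpanMap.id_ϱ R)
      (leftMap_ϖ L)).trans ((Eq₂.comp_whiskerLeft _ _ _).trans (assocInv_π₁_κ K L M N)).symm
  · exact (compMap_ϖ_isIdentity (S := compObj S (unitSpan Z) L) N K _ _ (SpanMap.id_ϖ R)).eq₂
      (SpanMap.comp_ϖ_isIdentity _ _ (assocInvMap_ϖ K L M N)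
        (leftMap_ϖ (R := compObj R S K) M)) rfl
  · calc
      Eq₂ _ (N.π₂ ◁ L.κ.inv) := compMap_ϱ (S := compObj S (unitSpan Z) L) N K _ _
      Eq₂ _ (assocInv K L M N ◁ M.κ.inv) :=
        (Eq₂.iso_inv (α := assocInv K L M N ◁ᵢ M.κ) (α' := N.π₂ ◁ᵢ L.κ)
          (assocInv_κ K L M N)).symm
      Eq₂ _ _ := (SpanMap.comp_ϱ_right _ (leftMap (R := compObj R S K) M)
        (assocInvMap_ϱ K L M N)).symm

/-- The triangle on `(I * R) * S`: the right unitor of a composite is the right unitor of its first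
factor. -/
theorem compMap_rightMap (K : IsoComma (unitSpan X).q R.p) (L : IsoComma R.q S.p)
    (M : IsoComma (K.π₂ ≫ R.q) S.p) (N : IsoComma (unitSpan X).q (L.π₁ ≫ R.p)) :
    compMap (R := compObj (unitSpan X) R K) M L (rightMap K) (SpanMap.id S) =
      (assocMap K L M N).comp (rightMap (R := compObj R S L) N) := by
  refine SpanMap.hom_ext (L.hom_ext ?_ ?_ ?_) ?_ ?_
  · exact (compHom_π₁ (R := compObj (unitSpan X) R K) M L _ _).trans
      ((Strict.assoc _ _ _).trans (assocHom_π₂_π₁ K L M N)).symm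
  · exact (compHom_π₂ (R := compObj (unitSpan X) R K) M L _ _).trans ((Strict.comp_id _).trans
      ((Strict.assoc _ _ _).trans (assocHom_π₂_π₂ K L M N)).symm)
  · exact (compHom_κ_id (R := compObj (unitSpan X) R K) M L _ _ (rightMap_ϱ K)
      (SpanMap.id_ϖ S)).trans ((Eq₂.comp_whiskerLeft _ _ _).trans (assocHom_π₂_κ K L M N)).symm
  · calc
      Eq₂ _ (M.π₁ ◁ K.κ.hom) := compMap_ϖ (R := compObj (unitSpan X) R K) M L _ _
      Eq₂ _ (assocHom K L M N ◁ N.κ.hom) := (assocHom_κ K L M N).symm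
      Eq₂ _ _ := (SpanMap.comp_ϖ_right _ (rightMap (R := compObj R S L) N)
        (assocMap_ϖ K L M N)).symm
  · exact (compMap_ϱ_isIdentity (R := compObj (unitSpan X) R K) M L _ _ (SpanMap.id_ϱ S)).eq₂
      (SpanMap.comp_ϱ_isIdentity _ _ (assocMap_ϱ K L M N)
        (rightMap_ϱ (R := compObj R S L) N)) rfl

variable (P : IsoComma R.q S.p) (K : IsoComma R.q (unitSpan Y).p)
  (L : IsoComma (unitSpan Y).q S.p) (M : IsoComma (K.π₂ ≫ (unitSpan Y).q) S.p)
  (N : IsoComma R.q (L.π₁ ≫ (unitSpan Y).p))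

/-- The map `R * (I * S) ⟶ (R * I) * S ⟶ R * S` that contracts the middle unit. -/
noncomputable def contractMap :
    SpanMap (compObj R (compObj (unitSpan Y) S L) N) (compObj R S P) :=
  (assocInvMap K L M N).comp (compMap (R := compObj R (unitSpan Y) K) M P (leftMap K)
    (SpanMap.id S))

theorem contractMap_π₁ : (contractMap P K L M N).hom ≫ P.π₁ = N.π₁ :=
  (Strict.assoc _ _ _).trans ((congrArg (assocInv K L M N ≫ ·)
    (compHom_π₁ (R := compObj R (unitSpan Y) K) M P _ _)).trans (assocInv_π₁_π₁ K L M N))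

theorem contractMap_π₂ : (contractMap P K L M N).hom ≫ P.π₂ = N.π₂ ≫ L.π₂ :=
  (Strict.assoc _ _ _).trans ((congrArg (assocInv K L M N ≫ ·)
    ((compHom_π₂ (R := compObj R (unitSpan Y) K) M P _ _).trans (Strict.comp_id _))).trans
      (assocInv_π₂ K L M N))

/-- The contraction pastes the two comma 2-cells adjacent to the unit. -/
theorem contractMap_κ :
    Eq₂ ((contractMap P K L M N).hom ◁ P.κ.hom) (N.κ.hom ≫ N.π₂ ◁ L.κ.hom) := by
  calc
    Eq₂ _ (assocInv K L M N ◁ (M.π₁ ◁ K.κ.hom ≫ M.κ.hom)) :=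
      (Eq₂.comp_whiskerLeft _ _ _).trans (Eq₂.whiskerLeft rfl
        (compHom_κ_left (R := compObj R (unitSpan Y) K) M P (leftMap K) _ (SpanMap.id_ϖ S)))
    Eq₂ _ (assocInv K L M N ◁ M.π₁ ◁ K.κ.hom ≫ assocInv K L M N ◁ M.κ.hom) :=
      .of_eq (Bicategory.whiskerLeft_comp _ _ _)
    Eq₂ _ _ := Eq₂.comp (assocInv_π₁_κ K L M N) (assocInv_κ K L M N)

theorem contractMap_ϖ : IsIdentity (contractMap P K L M N).ϖ.hom :=
  SpanMap.comp_ϖ_isIdentity _ _ (assocInvMap_ϖ K L M N)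
    (compMap_ϖ_isIdentity (R := compObj R (unitSpan Y) K) M P _ _ (leftMap_ϖ K))

theorem contractMap_ϱ : IsIdentity (contractMap P K L M N).ϱ.hom :=
  SpanMap.comp_ϱ_isIdentity _ _ (assocInvMap_ϱ K L M N)
    (compMap_ϱ_isIdentity (R := compObj R (unitSpan Y) K) M P _ _ (SpanMap.id_ϱ S))

/-- Contracting the middle unit only remembers the outer projections of a 2-cell. -/
theorem contractMap_isIdentity {V : B} {j k : V ⟶ N.pt} {γ : j ⟶ k}
    (h₁ : IsIdentity (γ ▷ N.π₁)) (h₂ : IsIdentity (γ ▷ N.π₂ ▷ L.π₂)) :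
    IsIdentity (γ ▷ (contractMap P K L M N).hom) :=
  P.isIdentity (.of_eq₂ (Eq₂.whiskerRight_comp_eq (contractMap_π₁ P K L M N) _) h₁)
    (.of_eq₂ (Eq₂.whiskerRight_comp_congr (contractMap_π₂ P K L M N) _) h₂)

/-- The triangle on `R * S`: inserting and contracting a middle unit is the identity. -/
theorem compMap_rightInvMap_contractMap :
    (compMap (S' := compObj (unitSpan Y) S L) P N (SpanMap.id R) (rightInvMap L)).comp
      (contractMap P K L M N) = SpanMap.id (compObj R S P) := by
  let c := compHom (S' := compObj (unitSpan Y) S L) P N (SpanMap.id R) (rightInvMap L)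
  have c₁ : c ≫ N.π₁ = P.π₁ ≫ 𝟙 R.pt := compHom_π₁ _ _ _ _
  have c₂ : c ≫ N.π₂ = P.π₂ ≫ rightInvHom L := compHom_π₂ _ _ _ _
  refine SpanMap.hom_ext (P.hom_ext ?_ ?_ ?_) ?_ ?_
  · change (c ≫ _) ≫ _ = 𝟙 P.pt ≫ _
    rw [Strict.assoc, contractMap_π₁, c₁, Strict.comp_id, Strict.id_comp]
  · change (c ≫ _) ≫ _ = 𝟙 P.pt ≫ _
    rw [Strict.assoc, contractMap_π₂, ← Strict.assoc, c₂, Strict.assoc, rightInvHom_π₂,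
      Strict.comp_id, Strict.id_comp]
  · calc
      Eq₂ _ (c ◁ (N.κ.hom ≫ N.π₂ ◁ L.κ.hom)) :=
        (Eq₂.comp_whiskerLeft _ _ _).trans (Eq₂.whiskerLeft rfl (contractMap_κ P K L M N))
      Eq₂ _ (c ◁ N.κ.hom ≫ c ◁ N.π₂ ◁ L.κ.hom) := .of_eq (Bicategory.whiskerLeft_comp _ _ _)
      -- The section `r⁻¹` makes the comma 2-cell of `I * S` an identity.
      Eq₂ _ (c ◁ N.κ.hom) := Eq₂.comp_id' (.of_eq₂ (Eq₂.whiskerLeft_comp_congr c₂ _)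
          ((rightInvHom_κ L).whiskerLeft P.π₂))
      Eq₂ _ P.κ.hom := compHom_κ_id (S' := compObj (unitSpan Y) S L) P N _ _ (SpanMap.id_ϱ R)
        (rightInvMap_ϖ L)
      Eq₂ _ _ := (Eq₂.id_whiskerLeft _).symm
  · exact (SpanMap.comp_ϖ_isIdentity _ _ (compMap_ϖ_isIdentity
      (S' := compObj (unitSpan Y) S L) P N _ _ (SpanMap.id_ϖ R)) (contractMap_ϖ P K L M N)).eq₂
        (SpanMap.id_ϖ _) rfl
  · exact (SpanMap.comp_ϱ_isIdentity _ _ (compMap_ϱ_isIdentity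
      (S' := compObj (unitSpan Y) S L) P N _ _ (rightInvMap_ϱ L)) (contractMap_ϱ P K L M N)).eq₂
        (SpanMap.id_ϱ _) rfl

end Units

end

/-! ### The tricategory of spans -/

section Tricategory

open TriBase TriAdj TwoFunctor

variable {B : Type u} [Bicategory.{w, v} B] [Strict B]
  (pb : ∀ {X Y Z : B} (f : X ⟶ Z) (g : Y ⟶ Z), IsoComma f g) (V W X Y Z : B)

theorem isStrict_aT {A : Type u₁} [Bicategory.{w₁, v₁} A] [Strict A]
    (F : TwoFunctor A ((spanBase pb).Hom W X)) (G : TwoFunctor A ((spanBase pb).Hom X Y))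
    (K : TwoFunctor A ((spanBase pb).Hom Y Z)) : IsStrict ((spanAdj pb).aT F G K) :=
  IsStrict.whiskerL _ (isStrict_assocTrans pb W X Y Z)

theorem isStrict_aT' {A : Type u₁} [Bicategory.{w₁, v₁} A] [Strict A]
    (F : TwoFunctor A ((spanBase pb).Hom W X)) (G : TwoFunctor A ((spanBase pb).Hom X Y))
    (K : TwoFunctor A ((spanBase pb).Hom Y Z)) : IsStrict ((spanAdj pb).aT' F G K) :=
  IsStrict.whiskerL _ (isStrict_assocInvTrans pb W X Y Z)

theorem isStrict_lT {A : Type u₁} [Bicategory.{w₁, v₁} A] [Strict A]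
    (F : TwoFunctor A ((spanBase pb).Hom X Y)) : IsStrict ((spanAdj pb).lT F) :=
  IsStrict.whiskerL _ (isStrict_leftTrans pb X Y)

theorem isStrict_rT {A : Type u₁} [Bicategory.{w₁, v₁} A] [Strict A]
    (F : TwoFunctor A ((spanBase pb).Hom X Y)) : IsStrict ((spanAdj pb).rT F) :=
  IsStrict.whiskerL _ (isStrict_rightTrans pb X Y)

theorem isStrict_tensorT {A : Type u₁} [Bicategory.{w₁, v₁} A] [Strict A]
    {F F' : TwoFunctor A ((spanBase pb).Hom X Y)} {G G' : TwoFunctor A ((spanBase pb).Hom Y Z)}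
    {η : F.toPs ⟶ F'.toPs} {θ : G.toPs ⟶ G'.toPs} (hη : IsStrict η) (hθ : IsStrict θ) :
    IsStrict (tensorT (H := spanBase pb) η θ) :=
  IsStrict.whiskerR (IsStrict.pairT hη hθ) _

theorem pentSource_eq : (spanAdj pb).pentSource V W X Y Z = (spanAdj pb).pentTarget V W X Y Z :=
  IsStrict.ext
    (IsStrict.comp (isStrict_tensorT pb V Y Z (isStrict_aT pb V W X Y _ _ _) (IsStrict.id _))
      (IsStrict.comp (isStrict_aT pb V W Y Z _ _ _)
        (isStrict_tensorT pb V W Z (IsStrict.id _) (isStrict_aT pb W X Y Z _ _ _))))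
    (IsStrict.comp (isStrict_aT pb V X Y Z _ _ _) (isStrict_aT pb V W X Z _ _ _))
    (fun P => assocMap_pentagon (R := P.1.1.1) (S := P.1.1.2) (T := P.1.2) (U := P.2)
      (pb _ _) (pb _ _) (pb _ _) (pb _ _) (pb _ _) (pb _ _) (pb _ _) (pb _ _) (pb _ _) (pb _ _)
      (pb _ _) (pb _ _))

theorem leftSource_eq : (spanAdj pb).leftSource X Y Z = (spanAdj pb).leftTarget X Y Z :=
  IsStrict.ext (isStrict_tensorT pb X Y Z (IsStrict.id _) (isStrict_lT pb Y Z _))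
    (IsStrict.comp (isStrict_aT' pb X Y Z Z _ _ _) (isStrict_lT pb X Z _))
    (fun P => compMap_leftMap (R := P.1) (S := P.2) (pb _ _) (pb _ _) (pb _ _) (pb _ _))

theorem rightSource_eq : (spanAdj pb).rightSource X Y Z = (spanAdj pb).rightTarget X Y Z :=
  IsStrict.ext (isStrict_tensorT pb X Y Z (isStrict_rT pb X Y _) (IsStrict.id _))
    (IsStrict.comp (isStrict_aT pb X X Y Z _ _ _) (isStrict_rT pb X Z _))
    (fun P => compMap_rightMap (R := P.1) (S := P.2) (pb _ _) (pb _ _) (pb _ _) (pb _ _))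

/-- Although the inverse right unitor is not strict, its naturality 2-cells are concentrated in the
middle unit, which is contracted. -/
theorem isStrict_middleSource : IsStrict ((spanAdj pb).middleSource X Y Z) := fun {P Q} f => by
  refine .of_eq₂ (IsStrict.comp_naturality_right _ (IsStrict.comp (isStrict_aT' pb X Y Y Z _ _ _)
    (isStrict_tensorT pb X Y Z (isStrict_lT pb X Y _) (IsStrict.id _))) f) ?_
  have e := Span.eq₂_hom (IsStrict.whiskerR_naturality
    (pairT (𝟙 ((spanBase pb).p₁ X Y Z).toPs) ((spanAdj pb).rT' ((spanBase pb).p₂ X Y Z)))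
    ((spanBase pb).comp X Y Z) f)
  refine Span.isIdentity ?_
  refine contractMap_isIdentity (R := Q.1) (S := Q.2) (pb _ _) (pb _ _) (pb _ _) (pb _ _) (pb _ _)
    ?_ ?_
  · refine .of_eq₂ ((Eq₂.whiskerRight rfl e).trans
      (compMap₂_π₁ _ _ _ _)) (.whiskerLeft ?_ _)
    exact Span.isIdentity_hom (IsStrict.id ((spanBase pb).p₁ X Y Z) f)
  · refine .of_eq₂ (Eq₂.whiskerRight rfl ((Eq₂.whiskerRight rfl
      e).trans (compMap₂_π₂ _ _ _ _))) ?_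
    exact .of_eq₂ (Eq₂.whisker_assoc _ _ _) (.whiskerLeft (rightInvNatHom_π₂ _ _ f.2) _)

theorem middleSource_eq : (spanAdj pb).middleSource X Y Z = (spanAdj pb).middleTarget X Y Z :=
  IsStrict.ext (isStrict_middleSource pb X Y Z) (IsStrict.id _)
    (fun P => compMap_rightInvMap_contractMap (R := P.1) (S := P.2)
      (pb _ _) (pb _ _) (pb _ _) (pb _ _) (pb _ _))

/-- The tricategory of spans, without its axioms. -/
noncomputable def spanData : TriData (spanBase pb) where
  toTriAdj := spanAdj pb
  pent V W X Y Z := eqToIso (pentSource_eq pb V W X Y Z)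
  leftMod X Y Z := eqToIso (leftSource_eq pb X Y Z)
  middleMod X Y Z := eqToIso (middleSource_eq pb X Y Z)
  rightMod X Y Z := eqToIso (rightSource_eq pb X Y Z)

variable {V W X Y Z}

theorem pi_isIdentity (R : (spanBase pb).Hom V W) (S : (spanBase pb).Hom W X)
    (T : (spanBase pb).Hom X Y) (U : (spanBase pb).Hom Y Z) :
    IsIdentity ((spanData pb).pi R S T U) :=
  isIdentity_as_app (IsIdentity.eqToHom (pentSource_eq pb V W X Y Z)) _

theorem aNat_isIdentity {R R' : (spanBase pb).Hom W X} {S S' : (spanBase pb).Hom X Y}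
    {T T' : (spanBase pb).Hom Y Z} (f : R ⟶ R') (g : S ⟶ S') (h : T ⟶ T') :
    IsIdentity ((spanData pb).aNat f g h).hom :=
  isStrict_assocTrans pb W X Y Z (x := ((R, S), T)) (y := ((R', S'), T')) ((f, g), h)

theorem aUnitInv_isIdentity (R : (spanBase pb).Hom W X) (S : (spanBase pb).Hom X Y)
    (T : (spanBase pb).Hom Y Z) : IsIdentity ((spanData pb).aUnitInv R S T) :=
  isIdentity_as_app (isStrictEquivalence_assocEquivalence pb W X Y Z).unit.inv _

theorem rho_isIdentity (R : (spanBase pb).Hom X Y) (S : (spanBase pb).Hom Y Z) :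
    IsIdentity ((spanData pb).rho R S) :=
  isIdentity_as_app (IsIdentity.eqToHom (rightSource_eq pb X Y Z)) _

theorem lamMate_isIdentity (R : (spanBase pb).Hom X Y) (S : (spanBase pb).Hom Y Z) :
    IsIdentity ((spanData pb).lamMate R S) :=
  .cast₂ (.comp₂ (.whiskerLeft (isIdentity_as_app
    (IsIdentity.eqToHom (leftSource_eq pb X Y Z)) _) _)
      (.whiskerRight (aUnitInv_isIdentity pb _ _ _) _) _) _ _

theorem midMate_isIdentity (R : (spanBase pb).Hom X Y) (S : (spanBase pb).Hom Y Z) :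
    IsIdentity ((spanData pb).midMate R S) := by
  refine .cast₂ (.comp₂ ?_ (.comp₂ ?_ ?_ _) _) _ _
  · exact .whiskerLeft (isIdentity_as_app (IsIdentity.inv (e := (spanData pb).middleMod X Y Z)
      (IsIdentity.eqToHom (middleSource_eq pb X Y Z))) _) _
  · -- The unit of `r` is not an identity, but its projection away from the middle unit is.
    refine .whiskerLeft (Span.isIdentity ?_) _
    refine contractMap_isIdentity (R := R) (S := S) (pb _ _) (pb _ _) (pb _ _) (pb _ _) (pb _ _)
      ?_ ?_
    · exact .of_eq₂ (compMap₂_π₁ _ _ _ _) (.whiskerLeft (.id _) _)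
    · refine .of_eq₂ (Eq₂.whiskerRight rfl (compMap₂_π₂ _ _ _ _)) (.of_eq₂ (Eq₂.whisker_assoc _ _ _)
        (.whiskerLeft ?_ _))
      exact IsIdentity.inv (e := whiskerRightIso (rightUnitHom (pb _ _)) _) (rightUnitHom_π₂ _)
  · exact .whiskerRight (aUnitInv_isIdentity pb _ _ _) _

/-- The tricategory of spans. -/
noncomputable def spanTricategory : Tricategory (spanBase pb) where
  toTriData := spanData pb
  cocycle := TriData.cocycle_of_isIdentity _ (pi_isIdentity pb) (aNat_isIdentity pb)
  norm₁ := TriData.norm₁_of_isIdentity _ (pi_isIdentity pb) (aNat_isIdentity pb)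
    (midMate_isIdentity pb) (rho_isIdentity pb)
  norm₂ := TriData.norm₂_of_isIdentity _ (pi_isIdentity pb) (aNat_isIdentity pb)
    (midMate_isIdentity pb) (lamMate_isIdentity pb)

end Tricategory

/-! ### Explicit description of the constraints -/

section Description

open TriBase TriAdj TwoFunctor

variable {B : Type u} [Bicategory.{w, v} B] [Strict B]
  (pb : ∀ {X Y Z : B} (f : X ⟶ Z) (g : Y ⟶ Z), IsoComma f g) {W X Y Z : B}

theorem isSpanAssociator (R : Span W X) (S : Span X Y) (U : Span Y Z) :
    IsSpanAssociator (spanTricategory pb) R S U where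
  π₁ := assocHom_π₁ _ _ _ _
  π₂ := assocHom_π₂_π₁ _ _ _ _
  π₃ := assocHom_π₂_π₂ _ _ _ _
  κ₁ := assocHom_κ _ _ _ _
  κ₂ := assocHom_π₂_κ _ _ _ _
  ϖ := assocMap_ϖ _ _ _ _
  ϱ := assocMap_ϱ _ _ _ _

theorem isSpanAssociatorInv (R : Span W X) (S : Span X Y) (U : Span Y Z) :
    IsSpanAssociatorInv (spanTricategory pb) R S U where
  π₁ := assocInv_π₁_π₁ _ _ _ _
  π₂ := assocInv_π₁_π₂ _ _ _ _
  π₃ := assocInv_π₂ _ _ _ _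
  κ₁ := assocInv_π₁_κ _ _ _ _
  κ₂ := assocInv_κ _ _ _ _
  ϖ := assocInvMap_ϖ _ _ _ _
  ϱ := assocInvMap_ϱ _ _ _ _

theorem isSpanLeftUnitor (R : Span X Y) : IsSpanLeftUnitor (spanTricategory pb) R where
  hom := rfl
  hom_ϖ := leftMap_ϖ _
  hom_ϱ := .refl _
  inv_π₁ := leftInvHom_π₁ _
  inv_π₂ := leftInvHom_π₂ _
  inv_κ := leftInvHom_κ _
  inv_ϖ := leftInvMap_ϖ _
  inv_ϱ := leftInvMap_ϱ _
  unit_π₁ := leftUnitHom_π₁ _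
  unit_π₂ := leftUnitHom_π₂ _

theorem isSpanRightUnitor (R : Span X Y) : IsSpanRightUnitor (spanTricategory pb) R where
  hom := rfl
  hom_ϖ := .refl _
  hom_ϱ := rightMap_ϱ _
  inv_π₁ := rightInvHom_π₁ _
  inv_π₂ := rightInvHom_π₂ _
  inv_κ := rightInvHom_κ _
  inv_ϖ := rightInvMap_ϖ _
  inv_ϱ := rightInvMap_ϱ _
  unit_π₁ := rightUnitHom_π₁ _
  unit_π₂ := rightUnitHom_π₂ _

theorem lNat'_eq₂ {R R' : Span X Y} (f : R ⟶ R') :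
    Eq₂ ((spanTricategory pb).lNat' f).hom (leftInvNatHom (pb _ _) (pb _ _) f).hom :=
  Span.eq₂_hom (Eq₂.comp_eqToHom (leftInvNat (pb _ _) (pb _ _) f).hom
    (congrArg (fun x => (spanTricategory pb).l' R ≫ tMap f x)
      (((spanBase pb).unit Y).map_id ⟨⟨⟨⟩⟩⟩)))

theorem rNat'_eq₂ {R R' : Span X Y} (f : R ⟶ R') :
    Eq₂ ((spanTricategory pb).rNat' f).hom (rightInvNatHom (pb _ _) (pb _ _) f).hom :=
  Span.eq₂_hom (Eq₂.comp_eqToHom (rightInvNat (pb _ _) (pb _ _) f).hom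
    (congrArg (fun x => (spanTricategory pb).r' R ≫ tMap x f)
      (((spanBase pb).unit X).map_id ⟨⟨⟨⟩⟩⟩)))

theorem isSpanLeftUnitorInvNat {R R' : Span X Y} (f : R ⟶ R') :
    IsSpanLeftUnitorInvNat (spanTricategory pb) f where
  π₁ := .of_eq₂ (Eq₂.whiskerRight rfl (lNat'_eq₂ pb f)) (leftInvNatHom_π₁ _ _ f)
  π₂ := (Eq₂.whiskerRight rfl (lNat'_eq₂ pb f)).trans (leftInvNatHom_π₂ _ _ f)

theorem isSpanRightUnitorInvNat {R R' : Span X Y} (f : R ⟶ R') :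
    IsSpanRightUnitorInvNat (spanTricategory pb) f where
  π₁ := (Eq₂.whiskerRight rfl (rNat'_eq₂ pb f)).trans (rightInvNatHom_π₁ _ _ f)
  π₂ := .of_eq₂ (Eq₂.whiskerRight rfl (rNat'_eq₂ pb f)) (rightInvNatHom_π₂ _ _ f)

end Description

end SpanTri

theorem mainTheorem1 {B : Type u} [Bicategory.{w, v} B] [Bicategory.Strict B]
    (pb : ∀ {X Y Z : B} (f : X ⟶ Z) (g : Y ⟶ Z), SpanTri.IsoComma f g) :
    ∃ T : SpanTri.Tricategory (SpanTri.spanBase pb),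
      (∀ W X Y Z : B, SpanTri.IsStrictEquivalence (T.assoc W X Y Z)) ∧
      (∀ X Y : B, SpanTri.IsStrict (T.left X Y).hom ∧
        SpanTri.IsIdentity (T.left X Y).counit.hom) ∧
      (∀ X Y : B, SpanTri.IsStrict (T.right X Y).hom ∧
        SpanTri.IsIdentity (T.right X Y).counit.hom) ∧
      (∀ {W X Y Z : B} (R : SpanTri.Span W X) (S : SpanTri.Span X Y) (U : SpanTri.Span Y Z),
        SpanTri.IsSpanAssociator T R S U ∧ SpanTri.IsSpanAssociatorInv T R S U) ∧
      (∀ {X Y : B} (R : SpanTri.Span X Y),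
        SpanTri.IsSpanLeftUnitor T R ∧ SpanTri.IsSpanRightUnitor T R) ∧
      (∀ {X Y : B} {R S : SpanTri.Span X Y} (f : R ⟶ S),
        SpanTri.IsSpanLeftUnitorInvNat T f ∧ SpanTri.IsSpanRightUnitorInvNat T f) ∧
      (∀ V W X Y Z : B, SpanTri.IsIdentity (T.pent V W X Y Z).hom) ∧
      (∀ X Y Z : B, SpanTri.IsIdentity (T.leftMod X Y Z).hom ∧
        SpanTri.IsIdentity (T.middleMod X Y Z).hom ∧
          SpanTri.IsIdentity (T.rightMod X Y Z).hom) := by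
  exact ⟨SpanTri.spanTricategory pb, SpanTri.isStrictEquivalence_assocEquivalence pb,
    fun X Y => ⟨SpanTri.isStrict_leftTrans pb X Y, .eqToHom (SpanTri.leftInvTrans_comp pb X Y)⟩,
    fun X Y => ⟨SpanTri.isStrict_rightTrans pb X Y, .eqToHom (SpanTri.rightInvTrans_comp pb X Y)⟩,
    fun R S U => ⟨SpanTri.isSpanAssociator pb R S U, SpanTri.isSpanAssociatorInv pb R S U⟩,
    fun R => ⟨SpanTri.isSpanLeftUnitor pb R, SpanTri.isSpanRightUnitor pb R⟩,
    fun f => ⟨SpanTri.isSpanLeftUnitorInvNat pb f, SpanTri.isSpanRightUnitorInvNat pb f⟩,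
    fun V W X Y Z => .eqToHom (SpanTri.pentSource_eq pb V W X Y Z),
    fun X Y Z => ⟨.eqToHom (SpanTri.leftSource_eq pb X Y Z),
      .eqToHom (SpanTri.middleSource_eq pb X Y Z), .eqToHom (SpanTri.rightSource_eq pb X Y Z)⟩⟩
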